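/- Let $\mathbb K=\mathbb R$ or $\mathbb C$. Let $C^\infty(S^{1|1})$ be the superalgebra of functions $F=f+g\theta$, with $f,g\in C^\infty(S^1,\mathbb K)$, $S^1=\mathbb R/2\pi\mathbb Z$ and $\theta^2=0$ ($f$ even, $g\theta$ odd), with parity $p$ and $\sigma(F)=(-1)^{p(F)}F$; put $\eta=\partial_\theta+\theta\partial_x$ and $\bar\eta=\partial_\theta-\theta\partial_x$. Let $\mathcal S\Psi\mathcal{DO}$ be the space of series $\sum_{k\le N}F_k\eta^k$ ($N\in\mathbb Z$, $F_k\in C^\infty(S^{1|1})$), with composition $$F\eta^m\circ G\eta^n=\sum_{k\ge0}\binom mk_{\!s}F\,\eta^k(\sigma^{m-k}(G))\,\eta^{m+n-k},$$ where $\binom mk_s=\binom{[m/2]}{[k/2]}$ if $k$ is even or $m$ is odd and $\binom mk_s=0$ otherwise, and with the supercommutator. Let $\mathcal K(1)$ be the Lie superalgebra of contact vector fields $v_F=F\eta^2+\frac12\eta(F)\bar\eta$ on $S^{1|1}$, and let $\rho(v_F)=F\eta^2+\frac12\eta(F)\bar\eta$ be its standard embedding into $\mathcal S\Psi\mathcal{DO}$.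 Consider the cocycles $\Theta_1(v_F)=\eta^2(F)$, $$\Theta_2(v_F)=\sum_{n\ge1}(-1)^n\tfrac{n-2}{n}\,\sigma(\bar\eta^{2n+1}(F))\,\bar\eta^{-2n+1}+\sum_{n\ge1}(-1)^n\tfrac{n-3}{n+1}\,\bar\eta^{2n+2}(F)\,\bar\eta^{-2n},$$ $$\Theta_3(v_F)=\sum_{n\ge2}(-1)^n\tfrac{n-1}{n}\,\sigma(\bar\eta^{2n+1}(F))\,\bar\eta^{-2n+1}+\sum_{n\ge2}(-1)^n\tfrac{n-1}{n+1}\,\bar\eta^{2n+2}(F)\,\bar\eta^{-2n}.$$ Let $V\subseteq\mathbb R^3$ be a set of parameters such that each $c\in V$ lies on a polynomial curve $\gamma:\mathbb R\to\mathbb R^3$ with $\gamma(0)=0$ and $\gamma(\mathbb R)\subseteq V$. A polynomial deformation of $\rho$ over $V$ corresponding to the infinitesimal deformation $\rho+c_1\Theta_1+c_2\Theta_2+c_3\Theta_3$ is a family of homomorphisms of Lie superalgebras $\widetilde\rho(c):\mathcal K(1)\to\mathcal S\Psi\mathcal{DO}$, $c\in V$, of the form $$\widetilde\rho(c)(v_F)=\rho(v_F)+c_1\Theta_1(v_F)+c_2\Theta_2(v_F)+c_3\Theta_3(v_F)+\sum_{k\in\mathbb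 Z}S_k(c)(F)\,\eta^k,$$ where $S_k=0$ for large $k$ and each $S_k(c)$ is a polynomial in $c$, without terms of degree less than $2$, whose coefficients are differential operators on $C^\infty(S^{1|1})$ such that $v_F\mapsto S_k(c)(F)\eta^k$ is even. It has no $\Theta_0$-component if, for all $c\in V$, writing $f_c+g_c\theta$ for the coefficient of $\eta^0$ in $\widetilde\rho(c)(\partial_x)$, $\partial_x=v_1$, we have $\int_{S^1}f_c\,dx=0$. (For the remaining generator $\Theta_0(v_F)=\frac14(F+\sigma(F))+\frac12F$ of $H^1(\mathcal K(1),\mathcal S\Psi\mathcal{DO})$ this coefficient is $1$.) It is homogeneous of degree $m$ if there are polynomials $P_k$ with $\widetilde\rho(c)(v_F)=\sum_{k\ge-m}P_k(c)\,\sigma^k(\bar\eta^{k+m}(F))\,\bar\eta^{-k}$ for all $c\in V$. Two deformations $\widetilde\rho,\widetilde\rho'$ over $V$ are equivalent if $\widetilde\rho'(c)=I(c)\circ\widetilde\rho(c)$ for all $c\in V$, where $I(c)=\exp(\mathrm{ad}\,G(c))$ is an automorphism of the Lie superalgebra $\mathcal S\Psi\mathcal{DO}$ and $G(c)=\sum_{\alpha\ne0}c^\alpha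 F_\alpha$ with even $F_\alpha\in\mathcal S\Psi\mathcal{DO}$ of bounded order. (Here, for each $k$, only finitely many $F_\alpha$ have a nonzero coefficient at $\eta^k$, and the coefficients at $\eta^k$ of the partial sums of the exponential series, applied to any operator, are eventually constant.) **Proposition.** Every polynomial deformation of $\rho$ over $V$ that corresponds to the infinitesimal deformation $\rho+c_1\Theta_1+c_2\Theta_2+c_3\Theta_3$ and has no $\Theta_0$-component is equivalent to a polynomial deformation over $V$ that corresponds to the same infinitesimal deformation and is homogeneous of degree $2$. -/

import Mathlib

open scoped ContDiff

noncomputable section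

namespace SuperCircle

/-! ### Functions on the circle and on the supercircle -/

/-- `C^∞(S¹)`: smooth `2π`-periodic functions on the line, with values in `𝕜` (`ℝ` or `ℂ`). -/
def CircleFun (𝕜 : Type*) [RCLike 𝕜] : Subalgebra 𝕜 (ℝ → 𝕜) where
  carrier := {f | ContDiff ℝ ∞ f ∧ Function.Periodic f (2 * Real.pi)}
  mul_mem' hf hg := ⟨hf.1.mul hg.1, hf.2.mul hg.2⟩
  add_mem' hf hg := ⟨hf.1.add hg.1, hf.2.add hg.2⟩
  algebraMap_mem' _ := ⟨contDiff_const, fun _ => rfl⟩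

variable {𝕜 : Type*} [RCLike 𝕜]

theorem deriv_mem_circleFun (f : CircleFun 𝕜) : deriv (f : ℝ → 𝕜) ∈ CircleFun 𝕜 := by
  refine ⟨(contDiff_infty_iff_deriv.1 f.2.1).2, fun x => ?_⟩
  have h : (fun y => (f : ℝ → 𝕜) (y + 2 * Real.pi)) = (f : ℝ → 𝕜) := funext f.2.2
  rw [← deriv_comp_add_const, h]

/-- The derivative `f ↦ f'` on `C^∞(S¹)`. -/
def ddx (f : CircleFun 𝕜) : CircleFun 𝕜 := ⟨deriv (f : ℝ → 𝕜), deriv_mem_circleFun f⟩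

/-- `C^∞(S^{1|1})`: an element is `F = F.fst + F.snd θ` with `θ² = 0` (the letter `θ` commutes
with the coefficient functions), that is, a dual number over `C^∞(S¹)`. It is even when
`F.snd = 0` and odd when `F.fst = 0`. -/
abbrev SuperFun (𝕜 : Type*) [RCLike 𝕜] : Type _ := DualNumber (CircleFun 𝕜)

/-- The function with components `f`, `g`, namely `f + g θ`. -/
def mkFun (f g : CircleFun 𝕜) : SuperFun 𝕜 := TrivSqZeroExt.inl f + TrivSqZeroExt.inr g

/-- The odd coordinate `θ`. -/
def theta : SuperFun 𝕜 := mkFun 0 1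

/-- The parity involution `σ(F) = (-1)^{p(F)} F`. -/
def sigma (F : SuperFun 𝕜) : SuperFun 𝕜 := mkFun F.fst (-F.snd)

/-- `σ^n` for an integer `n` (note `σ² = 1`). -/
def sigmaPow (n : ℤ) (F : SuperFun 𝕜) : SuperFun 𝕜 := if Even n then F else sigma F

/-- `η = ∂_θ + θ ∂_x` acting on functions; `η² = ∂_x`. -/
def eta (F : SuperFun 𝕜) : SuperFun 𝕜 := mkFun F.snd (ddx F.fst)

/-- `η̄ = ∂_θ - θ ∂_x` acting on functions; `η̄² = -∂_x`. -/
def etaBar (F : SuperFun 𝕜) : SuperFun 𝕜 := mkFun F.snd (-ddx F.fst)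

/-! ### The Lie superalgebra of contact vector fields -/

/-- The contact bracket. The superspace of contact vector fields `v_F = F η² + ½ η(F) η̄` is
identified with `C^∞(S^{1|1})` by `v_F ↔ F`, and `[v_F, v_G] = v_{{F, G}}`, where
`{f₀ + f₁ θ, g₀ + g₁ θ} =
  (f₀ g₀' - f₀' g₀ + ½ f₁ g₁) + (f₀ g₁' - ½ f₀' g₁ + ½ f₁ g₀' - f₁' g₀) θ`. -/
def contactBracket (F G : SuperFun 𝕜) : SuperFun 𝕜 :=
  mkFun (F.fst * ddx G.fst - ddx F.fst * G.fst + (1 / 2 : 𝕜) • (F.snd * G.snd))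
    (F.fst * ddx G.snd - (1 / 2 : 𝕜) • (ddx F.fst * G.snd)
      + (1 / 2 : 𝕜) • (F.snd * ddx G.fst) - ddx F.snd * G.fst)

/-! ### Superpseudodifferential operators -/

/-- Superpseudodifferential operators `A = ∑_k A_k η^k`: families of coefficients
`A_k ∈ C^∞(S^{1|1})`, `k ∈ ℤ`, that vanish for large `k`. -/
def SPDO (𝕜 : Type*) [RCLike 𝕜] : Submodule 𝕜 (ℤ → SuperFun 𝕜) where
  carrier := {A | ∃ N : ℤ, ∀ k, N < k → A k = 0}
  zero_mem' := ⟨0, fun _ _ => rfl⟩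
  add_mem' := by
    rintro A B ⟨M, hM⟩ ⟨N, hN⟩
    refine ⟨max M N, fun k hk => ?_⟩
    simp [hM k (lt_of_le_of_lt (le_max_left _ _) hk),
      hN k (lt_of_le_of_lt (le_max_right _ _) hk)]
  smul_mem' := by
    rintro r A ⟨N, hN⟩
    exact ⟨N, fun k hk => by simp [hN k hk]⟩

/-- The coefficient of `η^k` in `A`. -/
def coeff (A : SPDO 𝕜) (k : ℤ) : SuperFun 𝕜 := (A : ℤ → SuperFun 𝕜) k

/-- The super binomial coefficient `(m choose k)_s`, `m ∈ ℤ`, `k ∈ ℕ`: it is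
`([m/2] choose [k/2])` if `k` is even or `m` is odd, and `0` otherwise. -/
def superBinom (m : ℤ) (k : ℕ) : ℤ :=
  if Even k ∨ Odd m then Ring.choose (m / 2) (k / 2) else 0

@[simp] theorem eta_zero : eta (0 : SuperFun 𝕜) = 0 := by
  have : ddx (0 : CircleFun 𝕜) = 0 := by
    apply Subtype.ext
    funext x
    simp [ddx]
  simp [eta, mkFun, this]

@[simp] theorem sigmaPow_zero (n : ℤ) : sigmaPow n (0 : SuperFun 𝕜) = 0 := by
  simp [sigmaPow, sigma, mkFun]

/-- Composition, determined by
`F η^m ∘ G η^n = ∑_k (m choose k)_s F η^k(σ^{m-k}(G)) η^{m+n-k}`: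
the coefficient of `η^p` collects the triples with `m + n - k = p`; only finitely many of them
contribute. -/
def comp (A B : SPDO 𝕜) : SPDO 𝕜 :=
  ⟨fun p => ∑ᶠ q : ℤ × ℕ, superBinom q.1 q.2 •
      (coeff A q.1 * eta^[q.2] (sigmaPow (q.1 - q.2) (coeff B (p - q.1 + q.2)))), by
    obtain ⟨M, hM⟩ := A.2
    obtain ⟨N, hN⟩ := B.2
    refine ⟨M + N, fun p hp => ?_⟩
    refine (finsum_congr fun q => ?_).trans finsum_zero
    by_cases h : M < q.1
    · have : coeff A q.1 = 0 := hM _ h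
      simp [this]
    · have : coeff B (p - q.1 + q.2) = 0 := hN _ (by omega)
      simp [this, Function.iterate_fixed eta_zero]⟩

/-- The parity involution of `SPDO`: `F η^k` has parity `p(F) + k`. -/
def parity (A : SPDO 𝕜) : SPDO 𝕜 :=
  ⟨fun k => if Even k then sigma (coeff A k) else -sigma (coeff A k), by
    obtain ⟨N, hN⟩ := A.2
    refine ⟨N, fun k hk => ?_⟩
    have : coeff A k = 0 := hN k hk
    simp [this, sigma, mkFun]⟩

/-- The supercommutator, `[A, B] = A ∘ B - (-1)^{p(A)p(B)} B ∘ A` on homogeneous elements, extended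
bilinearly: with `A = A₀ + A₁` (even and odd part) it is
`A ∘ B - B ∘ A₀ - (parity of B) ∘ A₁`. -/
def superBracket (A B : SPDO 𝕜) : SPDO 𝕜 :=
  comp A B - comp B ((1 / 2 : 𝕜) • (A + parity A))
    - comp (parity B) ((1 / 2 : 𝕜) • (A - parity A))

/-- The coefficient of `η^j` in the operator `η̄^m`, `m ∈ ℤ`. Since `η̄ = η - 2 θ η²` and
`η̄² = -η²`, one has `η̄^{2i} = (-1)^i η^{2i}` and
`η̄^{2i+1} = (-1)^i (η^{2i+1} - 2 θ η^{2i+2})`. -/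
def etaBarPow (m j : ℤ) : SuperFun 𝕜 :=
  (if Even (m / 2) then (1 : 𝕜) else -1) •
    ((if j = m then 1 else 0) + if Odd m ∧ j = m + 1 then (-2 : 𝕜) • theta else 0)

theorem etaBarPow_eq_zero {m j : ℤ} (h : m + 1 < j) : etaBarPow (𝕜 := 𝕜) m j = 0 := by
  have h1 : j ≠ m := by omega
  have h2 : j ≠ m + 1 := by omega
  simp [etaBarPow, h1, h2]

/-- The standard embedding `ρ(v_F) = F η² + ½ η(F) η̄`. -/
def rho (F : SuperFun 𝕜) : SPDO 𝕜 :=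
  ⟨fun j => (if j = 2 then F else 0) + (1 / 2 : 𝕜) • (eta F * etaBarPow 1 j), 2, fun j hj => by
    simp [etaBarPow_eq_zero (show (1 : ℤ) + 1 < j by omega), show j ≠ 2 by omega]⟩

/-- `Θ₁(v_F) = η²(F)`. -/
def Theta1 (F : SuperFun 𝕜) : SPDO 𝕜 :=
  ⟨fun j => if j = 0 then eta (eta F) else 0, 0, fun j hj => by simp [show j ≠ 0 by omega]⟩

/-- `Θ₂(v_F) = ∑_{n ≥ 1} (-1)^n ((n-2)/n) σ(η̄^{2n+1}(F)) η̄^{-2n+1}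
  + ∑_{n ≥ 1} (-1)^n ((n-3)/(n+1)) η̄^{2n+2}(F) η̄^{-2n}`. -/
def Theta2 (F : SuperFun 𝕜) : SPDO 𝕜 :=
  ⟨fun j => ∑ᶠ n : ℕ, if 1 ≤ n then
      ((-1 : 𝕜) ^ n * (((n : 𝕜) - 2) / n)) •
        (sigma (etaBar^[2 * n + 1] F) * etaBarPow (-2 * n + 1) j)
      + ((-1 : 𝕜) ^ n * (((n : 𝕜) - 3) / (n + 1))) •
        (etaBar^[2 * n + 2] F * etaBarPow (-2 * n) j) else 0, 0, fun j hj => by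
    refine (finsum_congr fun n => ?_).trans finsum_zero
    split_ifs with hn
    · simp only [etaBarPow_eq_zero (show (-2 * (n : ℤ) + 1) + 1 < j by omega),
        etaBarPow_eq_zero (show (-2 * (n : ℤ)) + 1 < j by omega), mul_zero, smul_zero, add_zero]
    · rfl⟩

/-- `Θ₃(v_F) = ∑_{n ≥ 2} (-1)^n ((n-1)/n) σ(η̄^{2n+1}(F)) η̄^{-2n+1}
  + ∑_{n ≥ 2} (-1)^n ((n-1)/(n+1)) η̄^{2n+2}(F) η̄^{-2n}`. -/
def Theta3 (F : SuperFun 𝕜) : SPDO 𝕜 :=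
  ⟨fun j => ∑ᶠ n : ℕ, if 2 ≤ n then
      ((-1 : 𝕜) ^ n * (((n : 𝕜) - 1) / n)) •
        (sigma (etaBar^[2 * n + 1] F) * etaBarPow (-2 * n + 1) j)
      + ((-1 : 𝕜) ^ n * (((n : 𝕜) - 1) / (n + 1))) •
        (etaBar^[2 * n + 2] F * etaBarPow (-2 * n) j) else 0, 0, fun j hj => by
    refine (finsum_congr fun n => ?_).trans finsum_zero
    split_ifs with hn
    · simp only [etaBarPow_eq_zero (show (-2 * (n : ℤ) + 1) + 1 < j by omega),
        etaBarPow_eq_zero (show (-2 * (n : ℤ)) + 1 < j by omega), mul_zero, smul_zero, add_zero]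
    · rfl⟩

/-- The series `∑_k p_{k+m} σ^k(η̄^{k+m}(F)) η̄^{-k}`, `k ≥ -m`, indexed by `i = k + m ∈ ℕ`. -/
def homogeneousSeries (m : ℤ) (p : ℕ → 𝕜) (F : SuperFun 𝕜) : SPDO 𝕜 :=
  ⟨fun j => ∑ᶠ i : ℕ, p i • (sigmaPow (i - m) (etaBar^[i] F) * etaBarPow (m - i) j), m + 1,
    fun j hj => by
    refine (finsum_congr fun i => ?_).trans finsum_zero
    simp only [etaBarPow_eq_zero (show (m - (i : ℤ)) + 1 < j by omega), mul_zero, smul_zero]⟩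

/-! ### Polynomials in the parameters `c = (c₁, c₂, c₃) ∈ ℝ³` -/

/-- Polynomials in `c ∈ ℝ³` with coefficients in a module: finite sums `∑_α m_α c^α`. -/
abbrev ParamPoly (M : Type*) [AddCommGroup M] : Type _ := (Fin 3 →₀ ℕ) →₀ M

/-- The value `∑_α c^α m_α` of a polynomial at `c`. -/
def ParamPoly.eval {M : Type*} [AddCommGroup M] [Module 𝕜 M] (c : Fin 3 → ℝ)
    (P : ParamPoly M) : M :=
  P.sum fun α m => ((∏ i, c i ^ α i : ℝ) : 𝕜) • m

/-- All monomials of `P` have degree at least `d`. -/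
def ParamPoly.OrderGE {M : Type*} [AddCommGroup M] (d : ℕ) (P : ParamPoly M) : Prop :=
  ∀ α ∈ P.support, d ≤ α.degree

/-- The parameter sets: each point of `V` can be joined to the origin, inside `V`, by a polynomial
curve. Examples are `ℝ³`, images of polynomial maps `ℝⁿ → ℝ³` that fix the origin, and unions of
such. -/
def IsParameterSet (V : Set (Fin 3 → ℝ)) : Prop :=
  ∀ c ∈ V, ∃ γ : Fin 3 → Polynomial ℝ, (∀ i, (γ i).eval 0 = 0) ∧
    (∃ t : ℝ, ∀ i, (γ i).eval t = c i) ∧ ∀ t : ℝ, (fun i => (γ i).eval t) ∈ V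

/-! ### Deformations -/

/-- Differential operators on `S^{1|1}`: `F ↦ ∑_{i < N} a_i η̄^i(F)`. -/
def IsDifferentialOperator (φ : SuperFun 𝕜 →ₗ[𝕜] SuperFun 𝕜) : Prop :=
  ∃ (N : ℕ) (a : ℕ → SuperFun 𝕜), ∀ F, φ F = ∑ i ∈ Finset.range N, a i * etaBar^[i] F

/-- `F ↦ φ(F) η^k` is an even map. -/
def IsEvenAt (k : ℤ) (φ : SuperFun 𝕜 →ₗ[𝕜] SuperFun 𝕜) : Prop :=
  ∀ F, φ (sigma F) = if Even k then sigma (φ F) else -sigma (φ F)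

/-- `R(c)`, `c ∈ V`, is a polynomial deformation of the standard embedding, corresponding to the
infinitesimal deformation `ρ + c₁ Θ₁ + c₂ Θ₂ + c₃ Θ₃`: each `R(c)` is a homomorphism of Lie
superalgebras, and `R(c) = ρ + c₁ Θ₁ + c₂ Θ₂ + c₃ Θ₃ + ∑_k S_k(c)(·) η^k`, where `S_k` is
polynomial in `c` without terms of degree less than two, its coefficients are differential
operators giving even maps, and `S_k = 0` for large `k`. -/
structure IsPolynomialDeformation (V : Set (Fin 3 → ℝ))
    (R : (Fin 3 → ℝ) → SuperFun 𝕜 →ₗ[𝕜] SPDO 𝕜) : Prop where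
  map_bracket : ∀ c ∈ V, ∀ F G, R c (contactBracket F G) = superBracket (R c F) (R c G)
  form : ∃ S : ℤ → ParamPoly (SuperFun 𝕜 →ₗ[𝕜] SuperFun 𝕜),
    (∃ N : ℤ, ∀ k, N < k → S k = 0) ∧
    (∀ k, (S k).OrderGE 2) ∧
    (∀ k α, IsDifferentialOperator (S k α) ∧ IsEvenAt k (S k α)) ∧
    ∀ c ∈ V, ∀ F k, coeff (R c F) k =
      coeff (rho F + (c 0 : 𝕜) • Theta1 F + (c 1 : 𝕜) • Theta2 F + (c 2 : 𝕜) • Theta3 F) k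
        + ParamPoly.eval (𝕜 := 𝕜) c (S k) F

/-- The `Θ₀`-component of a linear map `φ` on contact vector fields: the mean over the circle of
the function `f`, where `f + g θ` is the coefficient of `η⁰` in `φ(v_1)`, `v_1 = ∂_x`. It is `1` on
the cocycle `Θ₀(v_F) = ¼ (F + σ(F)) + ½ F`, and `0` on `ρ`, `Θ₁`, `Θ₂`, `Θ₃`. -/
def theta0Component (φ : SuperFun 𝕜 →ₗ[𝕜] SPDO 𝕜) : 𝕜 :=
  ((1 / (2 * Real.pi) : ℝ) : 𝕜) *
    ∫ x in (0 : ℝ)..(2 * Real.pi), ((coeff (φ 1) 0).fst : ℝ → 𝕜) x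

/-- `R(c)` is homogeneous of degree `m`: `R(c)(v_F) = ∑_k P_k(c) σ^k(η̄^{k+m}(F)) η̄^{-k}` with
polynomials `P_k` (here `P (k + m)`). -/
def IsHomogeneousOfDegree (m : ℤ) (V : Set (Fin 3 → ℝ))
    (R : (Fin 3 → ℝ) → SuperFun 𝕜 →ₗ[𝕜] SPDO 𝕜) : Prop :=
  ∃ P : ℕ → ParamPoly 𝕜, ∀ c ∈ V, ∀ F,
    R c F = homogeneousSeries m (fun i => ParamPoly.eval (𝕜 := 𝕜) c (P i)) F

/-- `I = exp(ad G) = ∑_n (ad G)^n / n!`, where for every argument and every `k` the coefficients of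
`η^k` of the partial sums are eventually constant. -/
def IsExpAd (G : SPDO 𝕜) (I : SPDO 𝕜 → SPDO 𝕜) : Prop :=
  ∀ A k, ∀ᶠ N : ℕ in Filter.atTop,
    coeff (I A) k = ∑ n ∈ Finset.range N, (1 / (n.factorial : 𝕜)) •
      coeff ((superBracket G)^[n] A) k

/-- Equivalence of deformations with parameters in `V`: `R'(c) = I(c) ∘ R(c)`, where `I(c)` is an
automorphism of the Lie superalgebra of superpseudodifferential operators of the form
`I(c) = exp(ad G(c))`, `G(c) = ∑_α c^α F_α` the sum over nonzero multi-indices `α` with even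
superpseudodifferential operators `F_α`. (The coefficient of `η^k` in `F_α` is `E k α`, and in each
degree `k` the sum over `α` is finite.) -/
def IsEquivalent (V : Set (Fin 3 → ℝ)) (R R' : (Fin 3 → ℝ) → SuperFun 𝕜 →ₗ[𝕜] SPDO 𝕜) : Prop :=
  ∃ (E : ℤ → ParamPoly (SuperFun 𝕜)) (G : (Fin 3 → ℝ) → SPDO 𝕜)
    (I : (Fin 3 → ℝ) → SPDO 𝕜 ≃ₗ[𝕜] SPDO 𝕜),
    (∃ N : ℤ, ∀ k, N < k → E k = 0) ∧
    (∀ k, (E k).OrderGE 1) ∧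
    (∀ k α, sigma (E k α) = if Even k then E k α else -E k α) ∧
    (∀ c k, coeff (G c) k = ParamPoly.eval (𝕜 := 𝕜) c (E k)) ∧
    ∀ c ∈ V, IsExpAd (G c) (I c) ∧
      (∀ A B, I c (superBracket A B) = superBracket (I c A) (I c B)) ∧
      ∀ F, R' c F = I c (R c F)

end SuperCircle

end

open scoped ContDiff

noncomputable section

namespace SuperCircle

variable {𝕜 : Type*} [RCLike 𝕜]

/-! The leading part of a deformation cannot move, the remaining part can be normalized by
conjugation, and a normalized homomorphism is forced to be homogeneous.

Matrix picture. Since η² = ∂_x, an operator is a 2×2 matrix of ordinary symbols ∑ u_k ξ^k with ξ =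
d/dx (`blkA`, `blkB`, `blkC`, `blkD`), composition is the matrix product (`fst_coeff_comp`), even
operators are diagonal and odd ones antidiagonal. Identities between differential operators are
tested on periodic functions that agree with (x - x₀)^n / n! near a point (`locMon`).

Rigidity of the leading part. On even fields each diagonal block is a homomorphism from vector
fields on the circle to symbols. Comparing top symbols shows that its order is at most one and its
symbol is a f ξ with a = 0 or 1 (`vect_hom_symbol`). When a = 1 in both blocks, the off-diagonal
blocks on odd fields start with β h ξ^r and κ h ξ^(1-r), where β κ = 1/4 (`IsRep.odd_symbol`). Along
a polynomial curve in V starting at the origin, a and r are integer valued polynomials and β(x) is a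
polynomial dividing a nonzero constant, so all of them keep the values they have for ρ. Hence every
member of the deformation differs from ρ by order at most zero (`ordLE_sub_rho_of_curve`). This is
the role of the curves in the definition of V.

Normalization. An even G of order at most zero is built two orders at a time (`gaugeSeq`, `gauge`).
The terms g η^(-2m) and q θ η^(-2m-1) are used to make the image of v_θ have coefficient zero at
η^(-2m-1) and a constant multiple μ θ at η^(-2m); the constant of integration in g normalizes the
image of the local Euler field x d/dx at the origin. The constants μ vanish by themselves: v_1 is
sent to four times the square of the image of v_θ, so it acquires the coefficient 2μ. For m = 0 this
is the Θ₀-component, which conjugation changes only by the mean of a derivative. For m > 0 the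
relation [v_1, v_f] = v_{f'} would produce a periodic function with constant derivative 2μm. So v_θ
goes to ½ η (`IsRep.conj_gauge_theta`).

Homogeneity. Once v_θ goes to ½ η, brackets with v_θ make all blocks commute with d/dx, and the
bracket with the local Euler field, evaluated at the origin, is a weight count that leaves a single
derivative f^(n) in each degree (`IsRep.eq_homogeneousSeries`).

Dependence on c. The corrections are linear in coefficients to which the homogeneous part ρ + ∑ c_i
Θ_i contributes nothing, so G(c) is polynomial in each degree without terms of degree less than two
(`coeff_gaugeSeq_mem`), and conjugation does not alter the infinitesimal deformation. -/

/-! ### Shortcut instances -/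

/-- The commutative ring of functions on the circle. -/
@[reducible] def CircleFun.instCommRing : CommRing (CircleFun 𝕜) := inferInstance

/-- The commutative additive group of functions on the circle. -/
@[reducible] def CircleFun.instAddCommGroup : AddCommGroup (CircleFun 𝕜) :=
  CircleFun.instCommRing.toRing.toAddCommGroup

/-- The commutative additive monoid of functions on the circle. -/
@[reducible] def CircleFun.instAddCommMonoid : AddCommMonoid (CircleFun 𝕜) :=
  CircleFun.instAddCommGroup.toAddCommMonoid

/-- The additive group of functions on the circle. -/
@[reducible] def CircleFun.instAddGroup : AddGroup (CircleFun 𝕜) :=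
  CircleFun.instAddCommGroup.toAddGroup

/-- The additive monoid of functions on the circle. -/
@[reducible] def CircleFun.instAddMonoid : AddMonoid (CircleFun 𝕜) :=
  CircleFun.instAddGroup.toSubNegMonoid.toAddMonoid

/-- The additive unital magma of functions on the circle. -/
@[reducible] def CircleFun.instAddZeroClass : AddZeroClass (CircleFun 𝕜) :=
  CircleFun.instAddMonoid.toAddZeroClass

/-- The commutative semiring of functions on the circle. -/
@[reducible] def CircleFun.instCommSemiring : CommSemiring (CircleFun 𝕜) :=
  CircleFun.instCommRing.toCommSemiring

/-- The ring of functions on the circle. -/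
@[reducible] def CircleFun.instRing : Ring (CircleFun 𝕜) := CircleFun.instCommRing.toRing

/-- The semiring of functions on the circle. -/
@[reducible] def CircleFun.instSemiring : Semiring (CircleFun 𝕜) :=
  CircleFun.instCommSemiring.toSemiring

/-- The nonassociative semiring of functions on the circle. -/
@[reducible] def CircleFun.instNonAssocSemiring : NonAssocSemiring (CircleFun 𝕜) :=
  CircleFun.instSemiring.toNonAssocSemiring

/-- The multiplication of functions on the circle. -/
@[reducible] def CircleFun.instMul : Mul (CircleFun 𝕜) := CircleFun.instSemiring.toMul

/-- The algebra of functions on the circle. -/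
@[reducible] def CircleFun.instAlgebra : Algebra 𝕜 (CircleFun 𝕜) := inferInstance

/-- The module of functions on the circle. -/
@[reducible] def CircleFun.instModule : Module 𝕜 (CircleFun 𝕜) := CircleFun.instAlgebra.toModule

/-- The scalar action of functions on the circle. -/
@[reducible] def CircleFun.instDistribMulAction : DistribMulAction 𝕜 (CircleFun 𝕜) :=
  CircleFun.instModule.toDistribMulAction

/-- The scalar action, as a monoid action, of functions on the circle. -/
@[reducible] def CircleFun.instMulAction : MulAction 𝕜 (CircleFun 𝕜) :=
  CircleFun.instDistribMulAction.toMulAction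

/-- The scalar multiplication of functions on the circle. -/
@[reducible] def CircleFun.instSMul : SMul 𝕜 (CircleFun 𝕜) := CircleFun.instMulAction.toSMul

/-- The zero-preserving scalar multiplication of functions on the circle. -/
@[reducible] def CircleFun.instSMulZeroClass : SMulZeroClass 𝕜 (CircleFun 𝕜) :=
  CircleFun.instDistribMulAction.toDistribSMul.toSMulZeroClass

attribute [local instance] CircleFun.instSMulZeroClass CircleFun.instSMul CircleFun.instMulAction
  CircleFun.instDistribMulAction CircleFun.instModule CircleFun.instAlgebra CircleFun.instMul
  CircleFun.instNonAssocSemiring CircleFun.instSemiring CircleFun.instRing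
  CircleFun.instCommSemiring CircleFun.instAddZeroClass CircleFun.instAddMonoid
  CircleFun.instAddGroup CircleFun.instAddCommMonoid CircleFun.instAddCommGroup
  CircleFun.instCommRing

/-- The commutative ring of functions on the supercircle. -/
@[reducible] def SuperFun.instCommRing : CommRing (SuperFun 𝕜) := inferInstance

/-- The commutative additive group of functions on the supercircle. -/
@[reducible] def SuperFun.instAddCommGroup : AddCommGroup (SuperFun 𝕜) :=
  SuperFun.instCommRing.toRing.toAddCommGroup

/-- The commutative additive monoid of functions on the supercircle. -/
@[reducible] def SuperFun.instAddCommMonoid : AddCommMonoid (SuperFun 𝕜) :=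
  SuperFun.instAddCommGroup.toAddCommMonoid

/-- The additive group of functions on the supercircle. -/
@[reducible] def SuperFun.instAddGroup : AddGroup (SuperFun 𝕜) :=
  SuperFun.instAddCommGroup.toAddGroup

/-- The additive monoid of functions on the supercircle. -/
@[reducible] def SuperFun.instAddMonoid : AddMonoid (SuperFun 𝕜) :=
  SuperFun.instAddGroup.toSubNegMonoid.toAddMonoid

/-- The additive unital magma of functions on the supercircle. -/
@[reducible] def SuperFun.instAddZeroClass : AddZeroClass (SuperFun 𝕜) :=
  SuperFun.instAddMonoid.toAddZeroClass

/-- The commutative semiring of functions on the supercircle. -/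
@[reducible] def SuperFun.instCommSemiring : CommSemiring (SuperFun 𝕜) :=
  SuperFun.instCommRing.toCommSemiring

/-- The ring of functions on the supercircle. -/
@[reducible] def SuperFun.instRing : Ring (SuperFun 𝕜) := SuperFun.instCommRing.toRing

/-- The semiring of functions on the supercircle. -/
@[reducible] def SuperFun.instSemiring : Semiring (SuperFun 𝕜) :=
  SuperFun.instCommSemiring.toSemiring

/-- The nonassociative semiring of functions on the supercircle. -/
@[reducible] def SuperFun.instNonAssocSemiring : NonAssocSemiring (SuperFun 𝕜) :=
  SuperFun.instSemiring.toNonAssocSemiring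

/-- The multiplication of functions on the supercircle. -/
@[reducible] def SuperFun.instMul : Mul (SuperFun 𝕜) := SuperFun.instSemiring.toMul

/-- The algebra of functions on the supercircle. -/
@[reducible] def SuperFun.instAlgebra : Algebra 𝕜 (SuperFun 𝕜) := inferInstance

/-- The module of functions on the supercircle. -/
@[reducible] def SuperFun.instModule : Module 𝕜 (SuperFun 𝕜) := SuperFun.instAlgebra.toModule

/-- The scalar action of functions on the supercircle. -/
@[reducible] def SuperFun.instDistribMulAction : DistribMulAction 𝕜 (SuperFun 𝕜) :=
  SuperFun.instModule.toDistribMulAction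

/-- The scalar action, as a monoid action, of functions on the supercircle. -/
@[reducible] def SuperFun.instMulAction : MulAction 𝕜 (SuperFun 𝕜) :=
  SuperFun.instDistribMulAction.toMulAction

/-- The scalar multiplication of functions on the supercircle. -/
@[reducible] def SuperFun.instSMul : SMul 𝕜 (SuperFun 𝕜) := SuperFun.instMulAction.toSMul

/-- The zero-preserving scalar multiplication of functions on the supercircle. -/
@[reducible] def SuperFun.instSMulZeroClass : SMulZeroClass 𝕜 (SuperFun 𝕜) :=
  SuperFun.instDistribMulAction.toDistribSMul.toSMulZeroClass

attribute [local instance] SuperFun.instSMulZeroClass SuperFun.instSMul SuperFun.instMulAction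
  SuperFun.instDistribMulAction SuperFun.instModule SuperFun.instAlgebra SuperFun.instMul
  SuperFun.instNonAssocSemiring SuperFun.instSemiring SuperFun.instRing SuperFun.instCommSemiring
  SuperFun.instAddZeroClass SuperFun.instAddMonoid SuperFun.instAddGroup
  SuperFun.instAddCommMonoid SuperFun.instAddCommGroup SuperFun.instCommRing

/-- The commutative additive group of operators. -/
@[reducible] def SPDO.instAddCommGroup : AddCommGroup (SPDO 𝕜) := Submodule.addCommGroup _

/-- The commutative additive monoid of operators. -/
@[reducible] def SPDO.instAddCommMonoid : AddCommMonoid (SPDO 𝕜) :=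
  SPDO.instAddCommGroup.toAddCommMonoid

/-- The additive group of operators. -/
@[reducible] def SPDO.instAddGroup : AddGroup (SPDO 𝕜) := SPDO.instAddCommGroup.toAddGroup

/-- The monoid with subtraction of operators. -/
@[reducible] def SPDO.instSubNegMonoid : SubNegMonoid (SPDO 𝕜) := SPDO.instAddGroup.toSubNegMonoid

/-- The additive monoid of operators. -/
@[reducible] def SPDO.instAddMonoid : AddMonoid (SPDO 𝕜) := SPDO.instSubNegMonoid.toAddMonoid

/-- The additive unital magma of operators. -/
@[reducible] def SPDO.instAddZeroClass : AddZeroClass (SPDO 𝕜) := SPDO.instAddMonoid.toAddZeroClass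

/-- The module of operators. -/
@[reducible] def SPDO.instModule : Module 𝕜 (SPDO 𝕜) := Submodule.module _

/-- The scalar action of operators. -/
@[reducible] def SPDO.instDistribMulAction : DistribMulAction 𝕜 (SPDO 𝕜) :=
  SPDO.instModule.toDistribMulAction

/-- The scalar action, as a monoid action, of operators. -/
@[reducible] def SPDO.instMulAction : MulAction 𝕜 (SPDO 𝕜) := SPDO.instDistribMulAction.toMulAction

/-- The scalar multiplication of operators. -/
@[reducible] def SPDO.instSMul : SMul 𝕜 (SPDO 𝕜) := SPDO.instMulAction.toSMul

/-- The zero-preserving scalar multiplication of operators. -/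
@[reducible] def SPDO.instSMulZeroClass : SMulZeroClass 𝕜 (SPDO 𝕜) :=
  SPDO.instDistribMulAction.toDistribSMul.toSMulZeroClass

attribute [local instance] SPDO.instSMulZeroClass SPDO.instSMul SPDO.instMulAction
  SPDO.instDistribMulAction SPDO.instModule SPDO.instAddZeroClass SPDO.instAddMonoid
  SPDO.instSubNegMonoid SPDO.instAddGroup SPDO.instAddCommMonoid SPDO.instAddCommGroup

/-! ### Calculus on the circle -/

theorem differentiable_circleFun (f : CircleFun 𝕜) : Differentiable ℝ (f : ℝ → 𝕜) :=
  f.2.1.differentiable (by simp)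

theorem CircleFun.ext {f g : CircleFun 𝕜} (h : ∀ x, (f : ℝ → 𝕜) x = (g : ℝ → 𝕜) x) : f = g :=
  Subtype.ext (funext h)

theorem ddx_apply (f : CircleFun 𝕜) (x : ℝ) : (ddx f : ℝ → 𝕜) x = deriv (f : ℝ → 𝕜) x := rfl

theorem ddx_add (f g : CircleFun 𝕜) : ddx (f + g) = ddx f + ddx g :=
  CircleFun.ext fun x => deriv_add ((differentiable_circleFun f) x) ((differentiable_circleFun g) x)

theorem ddx_mul (f g : CircleFun 𝕜) : ddx (f * g) = ddx f * g + f * ddx g :=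
  CircleFun.ext fun x => deriv_mul ((differentiable_circleFun f) x) ((differentiable_circleFun g) x)

theorem ddx_smul (r : 𝕜) (f : CircleFun 𝕜) : ddx (r • f) = r • ddx f :=
  CircleFun.ext fun x => deriv_const_smul r ((differentiable_circleFun f) x)

/-- The derivative as a linear map. -/
def ddxL (𝕜 : Type*) [RCLike 𝕜] : CircleFun 𝕜 →ₗ[𝕜] CircleFun 𝕜 where
  toFun := ddx
  map_add' := ddx_add
  map_smul' := ddx_smul

@[simp] theorem ddxL_apply (f : CircleFun 𝕜) : (ddxL 𝕜) f = ddx f := rfl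

@[simp] theorem ddx_zero : ddx (0 : CircleFun 𝕜) = 0 := (ddxL 𝕜).map_zero
theorem ddx_sub (f g : CircleFun 𝕜) : ddx (f - g) = ddx f - ddx g := (ddxL 𝕜).map_sub f g

@[simp] theorem ddx_algebraMap (r : 𝕜) : ddx (algebraMap 𝕜 (CircleFun 𝕜) r) = 0 :=
  CircleFun.ext fun x => by
    rw [ddx_apply]
    exact deriv_const x r

@[simp] theorem ddx_one : ddx (1 : CircleFun 𝕜) = 0 := by
  simpa using ddx_algebraMap (1 : 𝕜)

theorem iterate_ddx_eq (n : ℕ) (f : CircleFun 𝕜) : ddx^[n] f = ((ddxL 𝕜) ^ n) f := by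
  rw [Module.End.pow_apply]; rfl

theorem iterate_ddx_add (n : ℕ) (f g : CircleFun 𝕜) :
    ddx^[n] (f + g) = ddx^[n] f + ddx^[n] g := by
  simp only [iterate_ddx_eq, map_add]

theorem iterate_ddx_sub (n : ℕ) (f g : CircleFun 𝕜) :
    ddx^[n] (f - g) = ddx^[n] f - ddx^[n] g := by
  simp only [iterate_ddx_eq, map_sub]

theorem iterate_ddx_smul (n : ℕ) (r : 𝕜) (f : CircleFun 𝕜) :
    ddx^[n] (r • f) = r • ddx^[n] f := by
  simp only [iterate_ddx_eq, map_smul]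

@[simp] theorem iterate_ddx_zero (n : ℕ) : ddx^[n] (0 : CircleFun 𝕜) = 0 := by
  simp only [iterate_ddx_eq, map_zero]

theorem const_of_ddx_eq_zero {f : CircleFun 𝕜} (h : ddx f = 0) (x y : ℝ) :
    (f : ℝ → 𝕜) x = (f : ℝ → 𝕜) y :=
  is_const_of_deriv_eq_zero (differentiable_circleFun f)
    (fun z => by rw [← ddx_apply, h]; rfl) x y

theorem eq_algebraMap_of_ddx_eq_zero {f : CircleFun 𝕜} (h : ddx f = 0) :
    f = algebraMap 𝕜 (CircleFun 𝕜) ((f : ℝ → 𝕜) 0) :=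
  CircleFun.ext fun x => const_of_ddx_eq_zero h x 0

/-- The mean value over the circle. -/
def mean (f : CircleFun 𝕜) : 𝕜 :=
  ((1 / (2 * Real.pi) : ℝ) : 𝕜) * ∫ x in (0 : ℝ)..(2 * Real.pi), (f : ℝ → 𝕜) x

/-- The mean value as a linear map. -/
def meanL (𝕜 : Type*) [RCLike 𝕜] : CircleFun 𝕜 →ₗ[𝕜] 𝕜 where
  toFun := mean
  map_add' f g := by
    unfold mean
    rw [← mul_add, ← intervalIntegral.integral_add
      ((differentiable_circleFun f).continuous.intervalIntegrable _ _)
      ((differentiable_circleFun g).continuous.intervalIntegrable _ _)]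
    rfl
  map_smul' r f := by
    have : ∫ x in (0 : ℝ)..(2 * Real.pi), ((r • f : CircleFun 𝕜) : ℝ → 𝕜) x
        = r * ∫ x in (0 : ℝ)..(2 * Real.pi), (f : ℝ → 𝕜) x := by
      rw [← intervalIntegral.integral_const_mul]; rfl
    unfold mean
    rw [this]
    simp only [smul_eq_mul, RingHom.id_apply]
    ring

theorem mean_add (f g : CircleFun 𝕜) : mean (f + g) = mean f + mean g := (meanL 𝕜).map_add f g
theorem mean_smul (r : 𝕜) (f : CircleFun 𝕜) : mean (r • f) = r * mean f := (meanL 𝕜).map_smul r f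

theorem mean_algebraMap (r : 𝕜) : mean (algebraMap 𝕜 (CircleFun 𝕜) r) = r := by
  have h : ∫ x in (0 : ℝ)..(2 * Real.pi), ((algebraMap 𝕜 (CircleFun 𝕜) r : CircleFun 𝕜) : ℝ → 𝕜) x
      = ∫ x in (0 : ℝ)..(2 * Real.pi), r := rfl
  have hpi : ((Real.pi : ℝ) : 𝕜) ≠ 0 := by exact_mod_cast Real.pi_ne_zero
  change ((1 / (2 * Real.pi) : ℝ) : 𝕜) * _ = r
  rw [h, intervalIntegral.integral_const, sub_zero, RCLike.real_smul_eq_coe_mul]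
  push_cast
  field_simp

theorem mean_ddx (f : CircleFun 𝕜) : mean (ddx f) = 0 := by
  have h : ∫ x in (0 : ℝ)..(2 * Real.pi), (ddx f : ℝ → 𝕜) x = 0 := by
    have := intervalIntegral.integral_deriv_eq_sub (a := 0) (b := 2 * Real.pi)
      (fun x _ => (differentiable_circleFun f) x)
      ((differentiable_circleFun (ddx f)).continuous.intervalIntegrable 0 (2 * Real.pi))
    refine this.trans ?_
    have := f.2.2 0
    rw [zero_add] at this
    rw [this, sub_self]
  change _ * ∫ x in (0 : ℝ)..(2 * Real.pi), (ddx f : ℝ → 𝕜) x = 0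
  rw [h, mul_zero]

/-- A function whose derivative is constant has derivative zero. -/
theorem eq_zero_of_ddx_eq_algebraMap {f : CircleFun 𝕜} {r : 𝕜}
    (h : ddx f = algebraMap 𝕜 (CircleFun 𝕜) r) : r = 0 := by
  rw [← mean_algebraMap r, ← h, mean_ddx]

/-- Subtracting the mean removes the only obstruction to periodicity of a primitive, the integral
over one period. -/
theorem antideriv_mem (f : CircleFun 𝕜) :
    (fun x : ℝ => ∫ y in (0 : ℝ)..x, ((f : ℝ → 𝕜) y - mean f)) ∈ CircleFun 𝕜 := by
  have hc : Continuous fun y => (f : ℝ → 𝕜) y - mean f :=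
    (differentiable_circleFun f).continuous.sub continuous_const
  have hd : ∀ x, HasDerivAt (fun x : ℝ => ∫ y in (0 : ℝ)..x, ((f : ℝ → 𝕜) y - mean f))
      ((f : ℝ → 𝕜) x - mean f) x := fun x =>
    intervalIntegral.integral_hasDerivAt_right (hc.intervalIntegrable _ _)
      hc.stronglyMeasurable.stronglyMeasurableAtFilter hc.continuousAt
  refine ⟨?_, fun x => ?_⟩
  · rw [contDiff_infty_iff_deriv]
    refine ⟨fun x => (hd x).differentiableAt, ?_⟩
    rw [show deriv (fun x : ℝ => ∫ y in (0 : ℝ)..x, ((f : ℝ → 𝕜) y - mean f))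
      = fun x => (f : ℝ → 𝕜) x - mean f from funext fun x => (hd x).deriv]
    exact f.2.1.sub contDiff_const
  · change ∫ y in (0 : ℝ)..(x + 2 * Real.pi), ((f : ℝ → 𝕜) y - mean f)
      = ∫ y in (0 : ℝ)..x, ((f : ℝ → 𝕜) y - mean f)
    rw [← intervalIntegral.integral_add_adjacent_intervals (b := x)
      (hc.intervalIntegrable _ _) (hc.intervalIntegrable _ _), add_eq_left]
    have hp : Function.Periodic (fun y => (f : ℝ → 𝕜) y - mean f) (2 * Real.pi) := fun y => by
      simp only [f.2.2 y]
    rw [hp.intervalIntegral_add_eq x 0, zero_add, intervalIntegral.integral_sub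
      ((differentiable_circleFun f).continuous.intervalIntegrable _ _)
      (continuous_const.intervalIntegrable _ _), intervalIntegral.integral_const, sub_zero,
      RCLike.real_smul_eq_coe_mul]
    have hpi : ((Real.pi : ℝ) : 𝕜) ≠ 0 := by exact_mod_cast Real.pi_ne_zero
    change _ - _ * (((1 / (2 * Real.pi) : ℝ) : 𝕜) * ∫ x in (0 : ℝ)..(2 * Real.pi), (f : ℝ → 𝕜) x) = 0
    push_cast
    field_simp
    simp

/-- The antiderivative of `f - mean f` that vanishes at the origin. -/
def antideriv (f : CircleFun 𝕜) : CircleFun 𝕜 :=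
  ⟨fun x => ∫ y in (0 : ℝ)..x, ((f : ℝ → 𝕜) y - mean f), antideriv_mem f⟩

/-- The normalized antiderivative as a linear map. -/
def antiderivL (𝕜 : Type*) [RCLike 𝕜] : CircleFun 𝕜 →ₗ[𝕜] CircleFun 𝕜 where
  toFun := antideriv
  map_add' f g := CircleFun.ext fun x => by
    have hf : Continuous fun y => (f : ℝ → 𝕜) y - mean f :=
      (differentiable_circleFun f).continuous.sub continuous_const
    have hg : Continuous fun y => (g : ℝ → 𝕜) y - mean g :=
      (differentiable_circleFun g).continuous.sub continuous_const
    change ∫ y in (0 : ℝ)..x, (((f : ℝ → 𝕜) y + (g : ℝ → 𝕜) y) - mean (f + g)) =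
      (∫ y in (0 : ℝ)..x, ((f : ℝ → 𝕜) y - mean f)) + ∫ y in (0 : ℝ)..x, ((g : ℝ → 𝕜) y - mean g)
    rw [← intervalIntegral.integral_add (hf.intervalIntegrable _ _) (hg.intervalIntegrable _ _)]
    refine intervalIntegral.integral_congr fun y _ => ?_
    rw [mean_add]
    ring
  map_smul' r f := CircleFun.ext fun x => by
    change ∫ y in (0 : ℝ)..x, (r * (f : ℝ → 𝕜) y - mean (r • f)) =
      r * ∫ y in (0 : ℝ)..x, ((f : ℝ → 𝕜) y - mean f)
    rw [← intervalIntegral.integral_const_mul]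
    refine intervalIntegral.integral_congr fun y _ => ?_
    rw [mean_smul]
    ring

theorem ddx_antideriv (f : CircleFun 𝕜) :
    ddx (antideriv f) = f - algebraMap 𝕜 (CircleFun 𝕜) (mean f) := CircleFun.ext fun x => by
  have hc : Continuous fun y => (f : ℝ → 𝕜) y - mean f :=
    (differentiable_circleFun f).continuous.sub continuous_const
  exact (intervalIntegral.integral_hasDerivAt_right (hc.intervalIntegrable _ _)
      hc.stronglyMeasurable.stronglyMeasurableAtFilter hc.continuousAt).deriv

theorem antideriv_apply_zero (f : CircleFun 𝕜) : (antideriv f : ℝ → 𝕜) 0 = 0 :=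
  intervalIntegral.integral_same

/-! ### Functions that are monomials near a point -/

/-- The sine is periodic and a local coordinate at the origin. Its local inverse, cut off so as to
be smooth on the whole line, turns it back into `x`; in this way germs of polynomials are realized
by periodic functions. -/
theorem exists_locally_id : ∃ h : ℝ → ℝ, ContDiff ℝ ∞ h ∧ ∀ᶠ x in nhds (0 : ℝ), h (Real.sin x) = x := by
  let χ : ContDiffBump (0 : ℝ) := ⟨1 / 4, 1 / 2, by norm_num, by norm_num⟩
  refine ⟨fun s => χ s * Real.arcsin s, ?_, ?_⟩
  · rw [contDiff_iff_contDiffAt]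
    intro s
    by_cases hs : |s| < 1
    · exact χ.contDiff.contDiffAt.mul
        (Real.contDiffAt_arcsin (by rintro rfl; norm_num at hs) (by rintro rfl; norm_num at hs))
    · refine (contDiffAt_const (c := (0 : ℝ))).congr_of_eventuallyEq ?_
      have : ∀ᶠ y in nhds s, 1 / 2 < |y| :=
        continuous_abs.continuousAt.eventually (lt_mem_nhds (by push Not at hs; linarith))
      filter_upwards [this] with y hy
      have : χ y = 0 := χ.zero_of_le_dist (by simpa [Real.dist_eq, χ] using hy.le)
      rw [this, zero_mul]
  · have h1 : ∀ᶠ x in nhds (0 : ℝ), |Real.sin x| < 1 / 4 :=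
      (Real.continuous_sin.abs.continuousAt).eventually (gt_mem_nhds (by norm_num))
    have h2 : ∀ᶠ x in nhds (0 : ℝ), x ∈ Set.Ioo (-(Real.pi / 2)) (Real.pi / 2) :=
      Ioo_mem_nhds (by linarith [Real.pi_pos]) (by linarith [Real.pi_pos])
    filter_upwards [h1, h2] with x hx hx2
    have : χ (Real.sin x) = 1 := χ.one_of_mem_closedBall (by
      simpa [Real.dist_eq, χ] using hx.le)
    rw [this, one_mul, Real.arcsin_sin hx2.1.le hx2.2.le]

theorem exists_locally_monomial (n : ℕ) (x₀ : ℝ) : ∃ f : CircleFun 𝕜,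
    (f : ℝ → 𝕜) =ᶠ[nhds x₀] fun x => (((x - x₀) ^ n / n.factorial : ℝ) : 𝕜) := by
  obtain ⟨h, hc, he⟩ := exists_locally_id
  refine ⟨⟨fun x => (((h (Real.sin (x - x₀))) ^ n / n.factorial : ℝ) : 𝕜), ?_, fun x => ?_⟩, ?_⟩
  · have h1 : ContDiff ℝ ∞ fun x : ℝ => (h (Real.sin (x - x₀))) ^ n / (n.factorial : ℝ) :=
      ((hc.comp (Real.contDiff_sin.comp (contDiff_id.sub contDiff_const))).pow n).div_const _
    exact (RCLike.ofRealCLM (K := 𝕜)).contDiff.comp h1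
  · have : x + 2 * Real.pi - x₀ = x - x₀ + 2 * Real.pi := by ring
    simp only [this, Real.sin_add_two_pi]
  · have ht : Filter.Tendsto (fun x => x - x₀) (nhds x₀) (nhds 0) := by
      have : ContinuousAt (fun x : ℝ => x - x₀) x₀ := by fun_prop
      simpa [ContinuousAt] using this
    filter_upwards [ht.eventually he] with x hx
    simp only [hx]

/-- A function on the circle equal to `(x - x₀)^n / n!` near `x₀`. -/
def locMon (n : ℕ) (x₀ : ℝ) : CircleFun 𝕜 := (exists_locally_monomial n x₀).choose

theorem locMon_eventuallyEq (n : ℕ) (x₀ : ℝ) :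
    (locMon n x₀ : CircleFun 𝕜) =ᶠ[nhds x₀] fun x => (((x - x₀) ^ n / n.factorial : ℝ) : 𝕜) :=
  (exists_locally_monomial n x₀).choose_spec

/-- Equality of germs at `x₀`. -/
def GermEq (x₀ : ℝ) (f g : CircleFun 𝕜) : Prop := (f : ℝ → 𝕜) =ᶠ[nhds x₀] (g : ℝ → 𝕜)

theorem GermEq.apply_eq {x₀ : ℝ} {f g : CircleFun 𝕜} (h : GermEq x₀ f g) :
    (f : ℝ → 𝕜) x₀ = (g : ℝ → 𝕜) x₀ := h.eq_of_nhds

theorem GermEq.refl (x₀ : ℝ) (f : CircleFun 𝕜) : GermEq x₀ f f := Filter.EventuallyEq.refl _ _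

theorem GermEq.trans {x₀ : ℝ} {f g k : CircleFun 𝕜} (h : GermEq x₀ f g) (h' : GermEq x₀ g k) :
    GermEq x₀ f k := Filter.EventuallyEq.trans h h'

theorem GermEq.ddx {x₀ : ℝ} {f g : CircleFun 𝕜} (h : GermEq x₀ f g) :
    GermEq x₀ (ddx f) (ddx g) := Filter.EventuallyEq.deriv h

theorem GermEq.iterate_ddx {x₀ : ℝ} {f g : CircleFun 𝕜} (h : GermEq x₀ f g) (n : ℕ) :
    GermEq x₀ (SuperCircle.ddx^[n] f) (SuperCircle.ddx^[n] g) := by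
  induction n with
  | zero => exact h
  | succ n ih => rw [Function.iterate_succ_apply', Function.iterate_succ_apply']; exact ih.ddx

theorem GermEq.sub {x₀ : ℝ} {f g f' g' : CircleFun 𝕜} (h : GermEq x₀ f g) (h' : GermEq x₀ f' g') :
    GermEq x₀ (f - f') (g - g') := Filter.EventuallyEq.sub h h'

theorem GermEq.mul {x₀ : ℝ} {f g f' g' : CircleFun 𝕜} (h : GermEq x₀ f g) (h' : GermEq x₀ f' g') :
    GermEq x₀ (f * f') (g * g') := Filter.EventuallyEq.mul h h'

theorem GermEq.smul {x₀ : ℝ} {f g : CircleFun 𝕜} (r : 𝕜) (h : GermEq x₀ f g) :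
    GermEq x₀ (r • f) (r • g) := Filter.EventuallyEq.const_smul h r

theorem ddx_locMon_zero (x₀ : ℝ) : GermEq x₀ (ddx (locMon 0 x₀ : CircleFun 𝕜)) 0 := by
  have h := (locMon_eventuallyEq (𝕜 := 𝕜) 0 x₀).deriv
  refine h.trans (Filter.Eventually.of_forall fun x => ?_)
  simp

theorem ddx_locMon_succ (n : ℕ) (x₀ : ℝ) :
    GermEq x₀ (ddx (locMon (n + 1) x₀ : CircleFun 𝕜)) (locMon n x₀) := by
  have h := (locMon_eventuallyEq (𝕜 := 𝕜) (n + 1) x₀).deriv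
  refine h.trans (Filter.EventuallyEq.trans ?_ (locMon_eventuallyEq (𝕜 := 𝕜) n x₀).symm)
  refine Filter.Eventually.of_forall fun x => ?_
  have hd : HasDerivAt (fun x : ℝ => (x - x₀) ^ (n + 1) / ((n + 1).factorial : ℝ))
      ((x - x₀) ^ n / (n.factorial : ℝ)) x := by
    have h1 := (((hasDerivAt_id x).sub_const x₀).pow (n + 1)).div_const ((n + 1).factorial : ℝ)
    refine h1.congr_deriv ?_
    have h2 : (n.factorial : ℝ) ≠ 0 := by exact_mod_cast n.factorial_ne_zero
    rw [Nat.factorial_succ]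
    push_cast
    have h3 : (n : ℝ) + 1 ≠ 0 := by positivity
    simp only [id]
    field_simp
  exact ((RCLike.ofRealCLM (K := 𝕜)).hasFDerivAt.comp_hasDerivAt x hd).deriv

theorem locMon_apply (n : ℕ) (x₀ : ℝ) :
    (locMon n x₀ : CircleFun 𝕜).1 x₀ = if n = 0 then 1 else 0 := by
  have := (locMon_eventuallyEq (𝕜 := 𝕜) n x₀).eq_of_nhds
  refine this.trans ?_
  split_ifs with h
  · simp [h]
  · simp [h]

/-- Local monomials are dual to the derivatives at `x₀`: applying a differential operator to them
and evaluating at `x₀` isolates its coefficients one at a time. -/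
theorem iterate_ddx_locMon (n i : ℕ) (x₀ : ℝ) :
    (ddx^[i] (locMon n x₀ : CircleFun 𝕜)).1 x₀ = if i = n then 1 else 0 := by
  induction i generalizing n with
  | zero => simpa [eq_comm] using locMon_apply (𝕜 := 𝕜) n x₀
  | succ i ih =>
    rw [Function.iterate_succ_apply]
    cases n with
    | zero =>
      rw [((ddx_locMon_zero x₀).iterate_ddx i).apply_eq, iterate_ddx_zero]
      simp
    | succ n =>
      rw [((ddx_locMon_succ n x₀).iterate_ddx i).apply_eq, ih]
      simp

theorem locMon_mul (p q : ℕ) (x₀ : ℝ) : GermEq x₀ (locMon p x₀ * locMon q x₀ : CircleFun 𝕜)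
    (((p + q).choose p : 𝕜) • locMon (p + q) x₀) := by
  have h1 := locMon_eventuallyEq (𝕜 := 𝕜) p x₀
  have h2 := locMon_eventuallyEq (𝕜 := 𝕜) q x₀
  have h3 := locMon_eventuallyEq (𝕜 := 𝕜) (p + q) x₀
  have h4 : (((p + q).choose p : ℝ)) * (p.factorial * q.factorial) = (p + q).factorial := by
    have := Nat.choose_mul_factorial_mul_factorial (Nat.le_add_right p q)
    rw [Nat.add_sub_cancel_left] at this
    rw [← mul_assoc]
    exact_mod_cast this
  filter_upwards [h1, h2, h3] with x hx1 hx2 hx3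
  change (locMon p x₀ : CircleFun 𝕜).1 x * (locMon q x₀ : CircleFun 𝕜).1 x =
    ((p + q).choose p : 𝕜) * (locMon (p + q) x₀ : CircleFun 𝕜).1 x
  rw [hx1, hx2, hx3, ← RCLike.ofReal_natCast (K := 𝕜), ← RCLike.ofReal_mul, ← RCLike.ofReal_mul]
  congr 1
  have e1 : (p.factorial : ℝ) ≠ 0 := by exact_mod_cast p.factorial_ne_zero
  have e2 : (q.factorial : ℝ) ≠ 0 := by exact_mod_cast q.factorial_ne_zero
  have e3 : ((p + q).factorial : ℝ) ≠ 0 := by exact_mod_cast (p + q).factorial_ne_zero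
  field_simp
  rw [← h4]
  ring

/-! ### Functions on the supercircle -/

@[simp] theorem fst_mkFun (f g : CircleFun 𝕜) : (mkFun f g).fst = f := by simp [mkFun]
@[simp] theorem snd_mkFun (f g : CircleFun 𝕜) : (mkFun f g).snd = g := by simp [mkFun]
@[simp] theorem fst_sigma (F : SuperFun 𝕜) : (sigma F).fst = F.fst := by simp [sigma]
@[simp] theorem snd_sigma (F : SuperFun 𝕜) : (sigma F).snd = -F.snd := by simp [sigma]
@[simp] theorem fst_eta (F : SuperFun 𝕜) : (eta F).fst = F.snd := by simp [eta]
@[simp] theorem snd_eta (F : SuperFun 𝕜) : (eta F).snd = ddx F.fst := by simp [eta]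
@[simp] theorem fst_etaBar (F : SuperFun 𝕜) : (etaBar F).fst = F.snd := by simp [etaBar]
@[simp] theorem snd_etaBar (F : SuperFun 𝕜) : (etaBar F).snd = -ddx F.fst := by simp [etaBar]
@[simp] theorem fst_theta : (theta : SuperFun 𝕜).fst = 0 := by simp [theta]
@[simp] theorem snd_theta : (theta : SuperFun 𝕜).snd = 1 := by simp [theta]

theorem SuperFun.fst_mul (F G : SuperFun 𝕜) : (F * G).fst = F.fst * G.fst :=
  TrivSqZeroExt.fst_mul F G

theorem SuperFun.snd_mul (F G : SuperFun 𝕜) : (F * G).snd = F.fst * G.snd + F.snd * G.fst :=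
  TrivSqZeroExt.snd_mul F G

theorem SuperFun.ext {F G : SuperFun 𝕜} (h1 : F.fst = G.fst) (h2 : F.snd = G.snd) : F = G :=
  TrivSqZeroExt.ext h1 h2

theorem mkFun_fst_snd (F : SuperFun 𝕜) : mkFun F.fst F.snd = F := by
  apply SuperFun.ext <;> simp

/-- `η` as a linear map. -/
def etaL (𝕜 : Type*) [RCLike 𝕜] : SuperFun 𝕜 →ₗ[𝕜] SuperFun 𝕜 where
  toFun := eta
  map_add' F G := by apply SuperFun.ext <;> simp [ddx_add]
  map_smul' r F := by apply SuperFun.ext <;> simp [ddx_smul]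

/-- `σ` as a linear map. -/
def sigmaL (𝕜 : Type*) [RCLike 𝕜] : SuperFun 𝕜 →ₗ[𝕜] SuperFun 𝕜 where
  toFun := sigma
  map_add' F G := by apply SuperFun.ext <;> simp; abel
  map_smul' r F := by apply SuperFun.ext <;> simp

theorem sigma_add (F G : SuperFun 𝕜) : sigma (F + G) = sigma F + sigma G := (sigmaL 𝕜).map_add F G
theorem sigma_neg (F : SuperFun 𝕜) : sigma (-F) = -sigma F := (sigmaL 𝕜).map_neg F
theorem sigma_smul (r : 𝕜) (F : SuperFun 𝕜) : sigma (r • F) = r • sigma F := (sigmaL 𝕜).map_smul r F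
@[simp] theorem sigma_zero : sigma (0 : SuperFun 𝕜) = 0 := (sigmaL 𝕜).map_zero

theorem eta_mul (F G : SuperFun 𝕜) : eta (F * G) = eta F * G + sigma F * eta G := by
  apply SuperFun.ext
  · simp; ring
  · simp [ddx_mul]; ring

theorem sigma_mul (F G : SuperFun 𝕜) : sigma (F * G) = sigma F * sigma G := by
  apply SuperFun.ext
  · simp
  · simp; ring

@[simp] theorem sigma_sigma (F : SuperFun 𝕜) : sigma (sigma F) = F := by
  apply SuperFun.ext <;> simp

theorem sigma_eta (F : SuperFun 𝕜) : sigma (eta F) = -eta (sigma F) := by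
  apply SuperFun.ext <;> simp

theorem eta_eta (F : SuperFun 𝕜) : eta (eta F) = mkFun (ddx F.fst) (ddx F.snd) := by
  apply SuperFun.ext <;> simp

theorem iterate_eta_eq (n : ℕ) (F : SuperFun 𝕜) : eta^[n] F = ((etaL 𝕜) ^ n) F := by
  rw [Module.End.pow_apply]; rfl

theorem iterate_eta_even (n : ℕ) (F : SuperFun 𝕜) :
    eta^[2 * n] F = mkFun (ddx^[n] F.fst) (ddx^[n] F.snd) := by
  induction n with
  | zero => simp [mkFun_fst_snd]
  | succ n ih =>
    rw [mul_add, mul_one, Function.iterate_succ_apply', Function.iterate_succ_apply', ih, eta_eta,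
      Function.iterate_succ_apply', Function.iterate_succ_apply']
    simp

theorem iterate_etaBar_even (n : ℕ) (F : SuperFun 𝕜) :
    etaBar^[2 * n] F = (-1 : 𝕜) ^ n • mkFun (ddx^[n] F.fst) (ddx^[n] F.snd) := by
  induction n with
  | zero => simp [mkFun_fst_snd]
  | succ n ih =>
    rw [mul_add, mul_one, Function.iterate_succ_apply', Function.iterate_succ_apply', ih,
      Function.iterate_succ_apply', Function.iterate_succ_apply']
    apply SuperFun.ext <;> simp [pow_succ, ddx_smul]

theorem iterate_etaBar_odd (n : ℕ) (F : SuperFun 𝕜) :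
    etaBar^[2 * n + 1] F = (-1 : 𝕜) ^ n • mkFun (ddx^[n] F.snd) (-ddx^[n + 1] F.fst) := by
  rw [Function.iterate_succ_apply', iterate_etaBar_even, Function.iterate_succ_apply']
  apply SuperFun.ext <;> simp [ddx_smul]

theorem sigmaPow_even {n : ℤ} (h : Even n) (F : SuperFun 𝕜) : sigmaPow n F = F := if_pos h
theorem sigmaPow_odd {n : ℤ} (h : Odd n) (F : SuperFun 𝕜) : sigmaPow n F = sigma F :=
  if_neg (Int.not_even_iff_odd.2 h)

/-- `σ^n` as a linear map. -/
def sigmaPowL (𝕜 : Type*) [RCLike 𝕜] (n : ℤ) : SuperFun 𝕜 →ₗ[𝕜] SuperFun 𝕜 := if Even n then LinearMap.id else (sigmaL 𝕜)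

theorem sigmaPowL_apply (n : ℤ) (F : SuperFun 𝕜) : (sigmaPowL 𝕜) n F = sigmaPow n F := by
  unfold sigmaPowL sigmaPow
  split_ifs <;> rfl

theorem sigmaPow_add_one (n : ℤ) (F : SuperFun 𝕜) : sigmaPow (n + 1) F = sigma (sigmaPow n F) := by
  rcases Int.even_or_odd n with h | h
  · rw [sigmaPow_even h, sigmaPow_odd h.add_one]
  · rw [sigmaPow_odd h, sigmaPow_even h.add_one, sigma_sigma]

/-! ### Coefficients and order -/

theorem SPDO.ext {A B : SPDO 𝕜} (h : ∀ k, coeff A k = coeff B k) : A = B :=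
  Subtype.ext (funext h)

@[simp] theorem coeff_add (A B : SPDO 𝕜) (k : ℤ) : coeff (A + B) k = coeff A k + coeff B k := rfl
@[simp] theorem coeff_sub (A B : SPDO 𝕜) (k : ℤ) : coeff (A - B) k = coeff A k - coeff B k := rfl
@[simp] theorem coeff_neg (A : SPDO 𝕜) (k : ℤ) : coeff (-A) k = -coeff A k := rfl
@[simp] theorem coeff_zero (k : ℤ) : coeff (0 : SPDO 𝕜) k = 0 := rfl
@[simp] theorem coeff_smul (r : 𝕜) (A : SPDO 𝕜) (k : ℤ) : coeff (r • A) k = r • coeff A k := rfl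

/-- The coefficient of `η^k` as a linear map. -/
def coeffL (𝕜 : Type*) [RCLike 𝕜] (k : ℤ) : SPDO 𝕜 →ₗ[𝕜] SuperFun 𝕜 where
  toFun A := coeff A k
  map_add' _ _ := rfl
  map_smul' _ _ := rfl

theorem coeff_sum {ι : Type*} (s : Finset ι) (A : ι → SPDO 𝕜) (k : ℤ) :
    coeff (∑ i ∈ s, A i) k = ∑ i ∈ s, coeff (A i) k := map_sum ((coeffL 𝕜) k) A s

/-- The order of `A` is at most `a`. -/
def OrdLE (A : SPDO 𝕜) (a : ℤ) : Prop := ∀ k, a < k → coeff A k = 0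

theorem exists_ordLE (A : SPDO 𝕜) : ∃ a, OrdLE A a := A.2

theorem OrdLE.mono {A : SPDO 𝕜} {a b : ℤ} (h : OrdLE A a) (hab : a ≤ b) : OrdLE A b :=
  fun k hk => h k (hab.trans_lt hk)

theorem OrdLE.add {A B : SPDO 𝕜} {a : ℤ} (h : OrdLE A a) (h' : OrdLE B a) : OrdLE (A + B) a :=
  fun k hk => by rw [coeff_add, h k hk, h' k hk, add_zero]

theorem OrdLE.smul {A : SPDO 𝕜} {a : ℤ} (r : 𝕜) (h : OrdLE A a) : OrdLE (r • A) a :=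
  fun k hk => by rw [coeff_smul, h k hk, smul_zero]

theorem OrdLE.zero (a : ℤ) : OrdLE (0 : SPDO 𝕜) a := fun _ _ => rfl

theorem OrdLE.sum {ι : Type*} {s : Finset ι} {A : ι → SPDO 𝕜} {a : ℤ}
    (h : ∀ i ∈ s, OrdLE (A i) a) : OrdLE (∑ i ∈ s, A i) a := fun k hk => by
  rw [coeff_sum]
  exact Finset.sum_eq_zero fun i hi => h i hi k hk

/-! ### Composition with a power of `η` -/

/-- The coefficients of `η^m ∘ Q`. -/
def etaPowCoeff (m : ℤ) (Q : SPDO 𝕜) (p : ℤ) : SuperFun 𝕜 :=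
  ∑ᶠ k : ℕ, superBinom m k • eta^[k] (sigmaPow (m - k) (coeff Q (p - m + k)))

theorem iterate_eta_zero (k : ℕ) : eta^[k] (0 : SuperFun 𝕜) = 0 :=
  Function.iterate_fixed eta_zero k

theorem etaPowCoeff_eq_sum {m : ℤ} {Q : SPDO 𝕜} {N : ℤ} (hQ : OrdLE Q N) {p : ℤ} {K : ℕ}
    (hK : N < p - m + K) : etaPowCoeff m Q p =
      ∑ k ∈ Finset.range K, superBinom m k • eta^[k] (sigmaPow (m - k) (coeff Q (p - m + k))) := by
  refine finsum_eq_sum_of_support_subset _ fun k hk => ?_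
  simp only [Finset.coe_range, Set.mem_Iio]
  by_contra h
  refine hk ?_
  simp only
  rw [hQ _ (by omega), sigmaPow_zero, iterate_eta_zero, smul_zero]

theorem etaPowCoeff_eq_zero {m : ℤ} {Q : SPDO 𝕜} {N : ℤ} (hQ : OrdLE Q N) {p : ℤ}
    (h : N + m < p) : etaPowCoeff m Q p = 0 := by
  rw [etaPowCoeff_eq_sum hQ (K := 0) (by simp; omega)]
  simp

/-- `η^m ∘ Q`. -/
def etaPowComp (m : ℤ) (Q : SPDO 𝕜) : SPDO 𝕜 :=
  ⟨etaPowCoeff m Q, by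
    obtain ⟨N, hN⟩ := exists_ordLE Q
    exact ⟨N + m, fun k hk => etaPowCoeff_eq_zero hN hk⟩⟩

theorem coeff_etaPowComp (m : ℤ) (Q : SPDO 𝕜) (p : ℤ) :
    coeff (etaPowComp m Q) p = etaPowCoeff m Q p := rfl

/-- `η ∘ Q`. -/
def etaComp (Q : SPDO 𝕜) : SPDO 𝕜 :=
  ⟨fun k => eta (coeff Q k) + sigma (coeff Q (k - 1)), by
    obtain ⟨N, hN⟩ := exists_ordLE Q
    exact ⟨N + 1, fun k hk => by simp [hN k (by omega), hN (k - 1) (by omega)]⟩⟩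

theorem coeff_etaComp (Q : SPDO 𝕜) (k : ℤ) :
    coeff (etaComp Q) k = eta (coeff Q k) + sigma (coeff Q (k - 1)) := rfl

theorem etaComp_sub (Q W : SPDO 𝕜) : etaComp (Q - W) = etaComp Q - etaComp W := by
  apply SPDO.ext
  intro k
  apply SuperFun.ext
  · simp [coeff_etaComp]; abel
  · simp [coeff_etaComp, ddx_sub]; abel

/-- The coefficient of η^(k+1) in η ∘ Q is σ(Q_k) plus a term depending on Q_{k+1} only, so a kernel
element vanishes coefficient by coefficient from the top. Injectivity later reduces statements on
negative powers of η to positive ones. -/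
theorem etaComp_injective : Function.Injective (etaComp : SPDO 𝕜 → SPDO 𝕜) := by
  intro Q W h
  rw [← sub_eq_zero]
  have h0 : etaComp (Q - W) = 0 := by rw [etaComp_sub, h, sub_self]
  obtain ⟨N, hN⟩ := exists_ordLE (Q - W)
  have key : ∀ n : ℕ, coeff (Q - W) (N + 1 - n) = 0 := by
    intro n
    induction n with
    | zero => exact hN _ (by simp)
    | succ n ih =>
      have := congrArg (fun A => coeff A (N + 1 - n)) h0
      simp only [coeff_etaComp, ih, eta_zero, zero_add, coeff_zero] at this
      have h2 := congrArg sigma this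
      rw [sigma_sigma, sigma_zero] at h2
      rw [← h2]
      congr 1
      push_cast
      ring
  apply SPDO.ext
  intro k
  by_cases hk : N < k
  · exact hN k hk
  · have := key (N + 1 - k).toNat
    rwa [show N + 1 - ((N + 1 - k).toNat : ℤ) = k by omega] at this

/-! ### Super binomial coefficients and the powers of η. -/

theorem Ring.choose_zero_of_pos {k : ℕ} (h : 0 < k) : Ring.choose (0 : ℤ) k = 0 := by
  have := Ring.choose_natCast (R := ℤ) 0 k
  rw [Nat.cast_zero] at this
  rw [this, Nat.choose_eq_zero_of_lt h, Nat.cast_zero]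

theorem superBinom_zero (m : ℤ) : superBinom m 0 = 1 := by
  simp [superBinom]

theorem superBinom_zero_succ (k : ℕ) : superBinom 0 (k + 1) = 0 := by
  unfold superBinom
  split_ifs with h
  · refine Ring.choose_zero_of_pos ?_
    rcases h with h | h
    · obtain ⟨j, hj⟩ := h
      omega
    · exact absurd h (by decide)
  · rfl

/-- Pascal's rule in the super setting. The sign is the one produced by moving σ past η^(k+1)
(`sigma_iterate_eta`), up to which the cases are the four parities of `m` and `k`. -/
theorem superBinom_succ (m : ℤ) (k : ℕ) :
    superBinom (m + 1) (k + 1) = superBinom m k + (-1) ^ (k + 1) * superBinom m (k + 1) := by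
  rcases Int.even_or_odd' m with ⟨n, rfl | rfl⟩ <;> rcases Nat.even_or_odd' k with ⟨j, rfl | rfl⟩
  · have h1 : Odd (2 * n + 1) := ⟨n, rfl⟩
    have h2 : Even (2 * j) := ⟨j, by ring⟩
    have h3 : ¬ (Even (2 * j + 1) ∨ Odd (2 * n)) := by
      rintro (h | h)
      · exact Nat.not_even_iff_odd.2 ⟨j, rfl⟩ h
      · exact Int.not_odd_iff_even.2 ⟨n, by ring⟩ h
    simp only [superBinom, h1, h2, h3, or_true, true_or, if_true, if_false, mul_zero, add_zero]
    congr 1 <;> omega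
  · have h1 : Odd (2 * n + 1) := ⟨n, rfl⟩
    have h2 : Even (2 * j + 1 + 1) := ⟨j + 1, by ring⟩
    have h3 : ¬ (Even (2 * j + 1) ∨ Odd (2 * n)) := by
      rintro (h | h)
      · exact Nat.not_even_iff_odd.2 ⟨j, rfl⟩ h
      · exact Int.not_odd_iff_even.2 ⟨n, by ring⟩ h
    simp only [superBinom, h1, h2, h3, or_true, true_or, if_true, if_false, zero_add, h2.neg_one_pow,
      one_mul]
    congr 1
    omega
  · have h1 : Odd (2 * n + 1) := ⟨n, rfl⟩
    have h2 : Odd (2 * j + 1) := ⟨j, rfl⟩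
    have h3 : ¬ (Even (2 * j + 1) ∨ Odd (2 * n + 1 + 1)) := by
      rintro (h | h)
      · exact Nat.not_even_iff_odd.2 ⟨j, rfl⟩ h
      · exact Int.not_odd_iff_even.2 ⟨n + 1, by ring⟩ h
    simp only [superBinom, h1, h3, or_true, if_true, if_false, h2.neg_one_pow]
    rw [show (2 * j + 1) / 2 = 2 * j / 2 by omega]
    ring
  · have h1 : Odd (2 * n + 1) := ⟨n, rfl⟩
    have h2 : Even (2 * j + 1 + 1) := ⟨j + 1, by ring⟩
    simp only [superBinom, h1, h2, or_true, true_or, if_true, h2.neg_one_pow, one_mul]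
    rw [show (2 * n + 1 + 1) / 2 = n + 1 by omega, show (2 * n + 1) / 2 = n by omega,
      show (2 * j + 1 + 1) / 2 = j + 1 by omega, show (2 * j + 1) / 2 = j by omega,
      Ring.choose_succ_succ]

theorem eta_zsmul (n : ℤ) (X : SuperFun 𝕜) : eta (n • X) = n • eta X := map_zsmul (etaL 𝕜) n X

theorem sigma_iterate_eta (k : ℕ) (F : SuperFun 𝕜) :
    sigma (eta^[k] F) = (-1 : ℤ) ^ k • eta^[k] (sigma F) := by
  induction k with
  | zero => simp
  | succ k ih =>
    rw [Function.iterate_succ_apply', Function.iterate_succ_apply', sigma_eta, ih, pow_succ]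
    rw [eta_zsmul, mul_neg_one, neg_smul]

theorem sigma_zsmul (n : ℤ) (X : SuperFun 𝕜) : sigma (n • X) = n • sigma X := map_zsmul (sigmaL 𝕜) n X
theorem eta_sum {ι : Type*} (s : Finset ι) (f : ι → SuperFun 𝕜) :
    eta (∑ i ∈ s, f i) = ∑ i ∈ s, eta (f i) := map_sum (etaL 𝕜) f s
theorem sigma_sum {ι : Type*} (s : Finset ι) (f : ι → SuperFun 𝕜) :
    sigma (∑ i ∈ s, f i) = ∑ i ∈ s, sigma (f i) := map_sum (sigmaL 𝕜) f s

/-- Applying η turns the k-th term of the composition formula into one with index k + 1, whereas σ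
keeps the index and contributes a sign; the two contributions add up by `superBinom_succ`. -/
theorem etaComp_etaPowComp (m : ℤ) (Q : SPDO 𝕜) :
    etaComp (etaPowComp m Q) = etaPowComp (m + 1) Q := by
  obtain ⟨N, hN⟩ := exists_ordLE Q
  apply SPDO.ext
  intro p
  rw [coeff_etaComp, coeff_etaPowComp, coeff_etaPowComp, coeff_etaPowComp]
  set K : ℕ := (N - p + m + 1).toNat with hK
  rw [etaPowCoeff_eq_sum hN (K := K) (by omega), etaPowCoeff_eq_sum hN (K := K + 1 + 1) (by push_cast; omega),
    etaPowCoeff_eq_sum hN (K := K + 1 + 1) (by push_cast; omega), eta_sum, sigma_sum]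
  have h1 : ∀ k : ℕ, eta (superBinom m k • eta^[k] (sigmaPow (m - k) (coeff Q (p - m + k)))) =
      superBinom m k • eta^[k + 1] (sigmaPow (m + 1 - (k + 1 : ℕ))
        (coeff Q (p - (m + 1) + (k + 1 : ℕ)))) := fun k => by
    rw [eta_zsmul, Function.iterate_succ_apply', Nat.cast_succ,
      show m + 1 - ((k : ℤ) + 1) = m - k by ring,
      show p - (m + 1) + ((k : ℤ) + 1) = p - m + k by ring]
  have h2 : ∀ k : ℕ, sigma (superBinom m k • eta^[k] (sigmaPow (m - k) (coeff Q (p - 1 - m + k)))) =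
      ((-1) ^ k * superBinom m k) • eta^[k] (sigmaPow (m + 1 - k) (coeff Q (p - (m + 1) + k))) :=
    fun k => by
    rw [sigma_zsmul, sigma_iterate_eta, ← sigmaPow_add_one, smul_smul, mul_comm,
      show m + 1 - (k : ℤ) = m - k + 1 by ring, show p - (m + 1) + (k : ℤ) = p - 1 - m + k by ring]
  simp only [h1, h2]
  rw [Finset.sum_range_succ', Finset.sum_range_succ' (n := K + 1), ← add_assoc]
  congr 1
  · rw [Finset.sum_range_succ, Finset.sum_range_succ, ← add_assoc, ← Finset.sum_add_distrib]
    congr 1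
    · refine Finset.sum_congr rfl fun k _ => ?_
      rw [superBinom_succ, add_smul]
    · rw [hN _ (by push_cast; omega)]
      simp [iterate_eta_zero]
  · simp [superBinom_zero]

theorem etaPowComp_zero (Q : SPDO 𝕜) : etaPowComp 0 Q = Q := by
  obtain ⟨N, hN⟩ := exists_ordLE Q
  apply SPDO.ext
  intro p
  rw [coeff_etaPowComp, etaPowCoeff_eq_sum hN (K := (N - p + 1).toNat + 1) (by push_cast; omega),
    Finset.sum_range_succ', Finset.sum_eq_zero fun k _ => by
      rw [superBinom_zero_succ, zero_smul]]
  simp [superBinom_zero, sigmaPow]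

theorem etaPowComp_one (Q : SPDO 𝕜) : etaPowComp 1 Q = etaComp Q := by
  rw [← zero_add (1 : ℤ), ← etaComp_etaPowComp, etaPowComp_zero]

theorem iterate_etaComp_etaPowComp (n : ℕ) (m : ℤ) (Q : SPDO 𝕜) :
    etaComp^[n] (etaPowComp m Q) = etaPowComp (m + n) Q := by
  induction n with
  | zero => simp
  | succ n ih =>
    rw [Function.iterate_succ_apply', ih, etaComp_etaPowComp]
    push_cast
    rw [add_assoc]

/-! ### Composition -/

theorem comp_support_finite (A B : SPDO 𝕜) (p : ℤ) :
    (Function.support fun q : ℤ × ℕ => superBinom q.1 q.2 •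
      (coeff A q.1 * eta^[q.2] (sigmaPow (q.1 - q.2) (coeff B (p - q.1 + q.2))))).Finite := by
  obtain ⟨M, hM⟩ := exists_ordLE A
  obtain ⟨N, hN⟩ := exists_ordLE B
  refine ((Finset.Icc (p - N) M ×ˢ Finset.range (M + N - p + 1).toNat).finite_toSet).subset ?_
  rintro ⟨m, k⟩ h
  simp only [Finset.coe_product, Set.mem_prod, Finset.mem_coe, Finset.mem_Icc, Finset.mem_range]
  by_contra hc
  refine h ?_
  simp only
  by_cases h1 : M < m
  · rw [hM _ h1, zero_mul, smul_zero]
  · rw [hN (p - m + k) (by omega), sigmaPow_zero, iterate_eta_zero, mul_zero, smul_zero]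

theorem coeff_comp (A B : SPDO 𝕜) (p : ℤ) :
    coeff (comp A B) p = ∑ᶠ m : ℤ, coeff A m * etaPowCoeff m B p := by
  obtain ⟨N, hN⟩ := exists_ordLE B
  refine (finsum_curry _ (comp_support_finite A B p)).trans (finsum_congr fun m => ?_)
  have hfin : (Function.support fun k : ℕ =>
      superBinom m k • eta^[k] (sigmaPow (m - k) (coeff B (p - m + k)))).Finite := by
    refine (Finset.range (N - p + m + 1).toNat).finite_toSet.subset fun k hk => ?_
    simp only [Finset.coe_range, Set.mem_Iio]
    by_contra h
    refine hk ?_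
    simp only
    rw [hN _ (by omega), sigmaPow_zero, iterate_eta_zero, smul_zero]
  rw [etaPowCoeff]
  refine Eq.trans ?_ ((AddMonoidHom.mulLeft (coeff A m)).map_finsum hfin).symm
  exact finsum_congr fun k => (mul_smul_comm _ _ _).symm

theorem mul_etaPowCoeff_support_finite {X : ℤ → SuperFun 𝕜} {M : ℤ} (hX : ∀ k, M < k → X k = 0)
    (B : SPDO 𝕜) (p : ℤ) : (Function.support fun m : ℤ => X m * etaPowCoeff m B p).Finite := by
  obtain ⟨N, hN⟩ := exists_ordLE B
  refine (Finset.Icc (p - N) M).finite_toSet.subset fun m hm => ?_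
  simp only [Finset.coe_Icc, Set.mem_Icc]
  by_contra h
  refine hm ?_
  simp only
  by_cases h1 : M < m
  · rw [hX m h1, zero_mul]
  · rw [etaPowCoeff_eq_zero hN (by omega), mul_zero]

theorem coeff_comp_eq_sum {A B : SPDO 𝕜} {N M p : ℤ} (hA : OrdLE A M) (hB : OrdLE B N)
    {a b : ℤ} (ha : a ≤ p - N) (hb : M ≤ b) :
    coeff (comp A B) p = ∑ m ∈ Finset.Icc a b, coeff A m * etaPowCoeff m B p := by
  rw [coeff_comp]
  refine finsum_eq_sum_of_support_subset _ fun m hm => ?_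
  simp only [Finset.coe_Icc, Set.mem_Icc]
  by_contra h
  refine hm ?_
  simp only
  by_cases h1 : M < m
  · rw [hA m h1, zero_mul]
  · rw [etaPowCoeff_eq_zero hB (by omega), mul_zero]

theorem OrdLE.comp {A B : SPDO 𝕜} {M N : ℤ} (hA : OrdLE A M) (hB : OrdLE B N) :
    OrdLE (comp A B) (M + N) := fun p hp => by
  rw [coeff_comp_eq_sum hA hB (a := p - N) (b := M) le_rfl le_rfl, Finset.Icc_eq_empty (by omega),
    Finset.sum_empty]

theorem iterate_eta_add (k : ℕ) (F G : SuperFun 𝕜) :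
    eta^[k] (F + G) = eta^[k] F + eta^[k] G := by
  simp only [iterate_eta_eq, map_add]

theorem iterate_eta_smul (k : ℕ) (r : 𝕜) (F : SuperFun 𝕜) : eta^[k] (r • F) = r • eta^[k] F := by
  simp only [iterate_eta_eq, map_smul]

theorem sigmaPow_add (n : ℤ) (F G : SuperFun 𝕜) :
    sigmaPow n (F + G) = sigmaPow n F + sigmaPow n G := by
  simp only [← sigmaPowL_apply, map_add]

theorem sigmaPow_smul (n : ℤ) (r : 𝕜) (F : SuperFun 𝕜) :
    sigmaPow n (r • F) = r • sigmaPow n F := by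
  simp only [← sigmaPowL_apply, map_smul]

theorem etaPowCoeff_add (m : ℤ) (Q W : SPDO 𝕜) (p : ℤ) :
    etaPowCoeff m (Q + W) p = etaPowCoeff m Q p + etaPowCoeff m W p := by
  obtain ⟨N, hN⟩ := exists_ordLE Q
  obtain ⟨N', hN'⟩ := exists_ordLE W
  have h1 := hN.mono (le_max_left N N')
  have h2 := hN'.mono (le_max_right N N')
  have hK : max N N' < p - m + ((max N N' - p + m + 1).toNat : ℤ) := by omega
  rw [etaPowCoeff_eq_sum h1 hK, etaPowCoeff_eq_sum h2 hK, etaPowCoeff_eq_sum (h1.add h2) hK,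
    ← Finset.sum_add_distrib]
  refine Finset.sum_congr rfl fun k _ => ?_
  rw [coeff_add, sigmaPow_add, iterate_eta_add, smul_add]

theorem etaPowCoeff_smul (m : ℤ) (r : 𝕜) (Q : SPDO 𝕜) (p : ℤ) :
    etaPowCoeff m (r • Q) p = r • etaPowCoeff m Q p := by
  obtain ⟨N, hN⟩ := exists_ordLE Q
  have hK : N < p - m + ((N - p + m + 1).toNat : ℤ) := by omega
  rw [etaPowCoeff_eq_sum hN hK, etaPowCoeff_eq_sum (hN.smul r) hK, Finset.smul_sum]
  refine Finset.sum_congr rfl fun k _ => ?_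
  rw [coeff_smul, sigmaPow_smul, iterate_eta_smul, smul_comm]

/-- Composition as a bilinear map. -/
def compL (𝕜 : Type*) [RCLike 𝕜] : SPDO 𝕜 →ₗ[𝕜] SPDO 𝕜 →ₗ[𝕜] SPDO 𝕜 :=
  LinearMap.mk₂ 𝕜 comp
    (fun A A' B => by
      obtain ⟨M, hM⟩ := exists_ordLE A
      obtain ⟨M', hM'⟩ := exists_ordLE A'
      apply SPDO.ext
      intro p
      rw [coeff_add, coeff_comp, coeff_comp, coeff_comp, ← finsum_add_distrib
        (mul_etaPowCoeff_support_finite hM B p) (mul_etaPowCoeff_support_finite hM' B p)]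
      exact finsum_congr fun m => by rw [coeff_add, add_mul])
    (fun r A B => by
      apply SPDO.ext
      intro p
      rw [coeff_smul, coeff_comp, coeff_comp, smul_finsum]
      exact finsum_congr fun m => by rw [coeff_smul, smul_mul_assoc])
    (fun A B B' => by
      obtain ⟨M, hM⟩ := exists_ordLE A
      apply SPDO.ext
      intro p
      rw [coeff_add, coeff_comp, coeff_comp, coeff_comp, ← finsum_add_distrib
        (mul_etaPowCoeff_support_finite hM B p) (mul_etaPowCoeff_support_finite hM B' p)]
      exact finsum_congr fun m => by rw [etaPowCoeff_add, mul_add])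
    (fun r A B => by
      apply SPDO.ext
      intro p
      rw [coeff_smul, coeff_comp, coeff_comp, smul_finsum]
      exact finsum_congr fun m => by rw [etaPowCoeff_smul, mul_smul_comm])

theorem comp_add (A B C : SPDO 𝕜) : comp A (B + C) = comp A B + comp A C := map_add ((compL 𝕜) A) B C
theorem comp_sub (A B C : SPDO 𝕜) : comp A (B - C) = comp A B - comp A C := map_sub ((compL 𝕜) A) B C
theorem comp_smul (r : 𝕜) (A B : SPDO 𝕜) : comp A (r • B) = r • comp A B := map_smul ((compL 𝕜) A) r B
theorem add_comp (A B C : SPDO 𝕜) : comp (A + B) C = comp A C + comp B C :=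
  LinearMap.map_add₂ (compL 𝕜) A B C
theorem sub_comp (A B C : SPDO 𝕜) : comp (A - B) C = comp A C - comp B C :=
  LinearMap.map_sub₂ (compL 𝕜) A B C
theorem smul_comp (r : 𝕜) (A B : SPDO 𝕜) : comp (r • A) B = r • comp A B :=
  LinearMap.map_smul₂ (compL 𝕜) r A B
@[simp] theorem comp_zero (A : SPDO 𝕜) : comp A 0 = 0 := map_zero ((compL 𝕜) A)
@[simp] theorem zero_comp (A : SPDO 𝕜) : comp 0 A = 0 := LinearMap.map_zero₂ (compL 𝕜) A

theorem neg_comp (A B : SPDO 𝕜) : comp (-A) B = -comp A B :=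
  eq_neg_of_add_eq_zero_left (by rw [← add_comp, neg_add_cancel, zero_comp])

theorem comp_sum {ι : Type*} (s : Finset ι) (A : SPDO 𝕜) (B : ι → SPDO 𝕜) :
    comp A (∑ i ∈ s, B i) = ∑ i ∈ s, comp A (B i) := map_sum ((compL 𝕜) A) B s

theorem sum_comp {ι : Type*} (s : Finset ι) (A : ι → SPDO 𝕜) (B : SPDO 𝕜) :
    comp (∑ i ∈ s, A i) B = ∑ i ∈ s, comp (A i) B := LinearMap.map_sum₂ (compL 𝕜) s A B

/-- When the left factor is η, associativity amounts to the Leibniz rule η(FG) = η(F) G + σ(F) η(G).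
The second summand accounts for the shift from m to m + 1. -/
theorem etaComp_comp (Q W : SPDO 𝕜) : comp (etaComp Q) W = etaComp (comp Q W) := by
  obtain ⟨M, hM⟩ := exists_ordLE Q
  apply SPDO.ext
  intro p
  have h1 : ∀ k, M < k → eta (coeff Q k) = 0 := fun k hk => by rw [hM k hk, eta_zero]
  have h2 : ∀ k, M < k → sigma (coeff Q k) = 0 := fun k hk => by rw [hM k hk, sigma_zero]
  have h3 : ∀ k, M + 1 < k → sigma (coeff Q (k - 1)) = 0 := fun k hk => by
    rw [hM (k - 1) (by omega), sigma_zero]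
  have f1 := mul_etaPowCoeff_support_finite h1 W p
  have f2 : (Function.support fun m => sigma (coeff Q m) * etaPowCoeff (m + 1) W p).Finite := by
    have := mul_etaPowCoeff_support_finite h3 W p
    refine (this.preimage (f := fun m : ℤ => m + 1) (fun _ _ _ _ h => by simpa using h)).subset
      fun m hm => ?_
    simpa using hm
  have g0 := mul_etaPowCoeff_support_finite hM W p
  have g1 := mul_etaPowCoeff_support_finite hM W (p - 1)
  have e1 : eta (∑ᶠ m : ℤ, coeff Q m * etaPowCoeff m W p) =
      ∑ᶠ m : ℤ, eta (coeff Q m * etaPowCoeff m W p) :=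
    ((etaL 𝕜).toAddMonoidHom).map_finsum g0
  have e2 : sigma (∑ᶠ m : ℤ, coeff Q m * etaPowCoeff m W (p - 1)) =
      ∑ᶠ m : ℤ, sigma (coeff Q m * etaPowCoeff m W (p - 1)) :=
    ((sigmaL 𝕜).toAddMonoidHom).map_finsum g1
  have r1 : (Function.support fun m => eta (coeff Q m * etaPowCoeff m W p)).Finite :=
    g0.subset fun m hm h => hm (by
      simp only at h ⊢
      rw [h, eta_zero])
  have r2 : (Function.support fun m => sigma (coeff Q m * etaPowCoeff m W (p - 1))).Finite :=
    g1.subset fun m hm h => hm (by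
      simp only at h ⊢
      rw [h, sigma_zero])
  rw [coeff_etaComp, coeff_comp, coeff_comp, coeff_comp, e1, e2, ← finsum_add_distrib r1 r2]
  have : ∑ᶠ m : ℤ, coeff (etaComp Q) m * etaPowCoeff m W p =
      ∑ᶠ m : ℤ, (eta (coeff Q m) * etaPowCoeff m W p
        + sigma (coeff Q m) * etaPowCoeff (m + 1) W p) := by
    rw [finsum_add_distrib f1 f2]
    simp only [coeff_etaComp, add_mul]
    rw [finsum_add_distrib f1 (mul_etaPowCoeff_support_finite h3 W p)]
    congr 1
    rw [← finsum_comp_equiv (Equiv.addRight (1 : ℤ))]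
    refine finsum_congr fun m => ?_
    simp
  rw [this]
  refine finsum_congr fun m => ?_
  rw [eta_mul, sigma_mul, ← coeff_etaPowComp (m + 1), ← etaComp_etaPowComp, coeff_etaComp,
    coeff_etaPowComp, coeff_etaPowComp, mul_add, add_assoc]

/-- Nonnegative powers follow by iterating `etaComp_comp`. For a negative power it suffices, by
injectivity, to compare both sides after applying η often enough. -/
theorem etaPowComp_comp (m : ℤ) (Q W : SPDO 𝕜) :
    comp (etaPowComp m Q) W = etaPowComp m (comp Q W) := by
  have hn : ∀ (n : ℕ) (X Y : SPDO 𝕜), comp (etaComp^[n] X) Y = etaComp^[n] (comp X Y) := by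
    intro n
    induction n with
    | zero => intro X Y; rfl
    | succ n ih =>
      intro X Y
      rw [Function.iterate_succ_apply, Function.iterate_succ_apply, ih, etaComp_comp]
  have hpos : ∀ (n : ℕ) (X : SPDO 𝕜), etaPowComp n X = etaComp^[n] X := fun n X => by
    have := iterate_etaComp_etaPowComp n 0 X
    rw [etaPowComp_zero, zero_add] at this
    exact this.symm
  rcases le_total 0 m with h | h
  · obtain ⟨n, rfl⟩ := Int.eq_ofNat_of_zero_le h
    rw [hpos, hpos, hn]
  · obtain ⟨n, hn'⟩ := Int.eq_ofNat_of_zero_le (neg_nonneg.2 h)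
    refine (etaComp_injective.iterate n) ?_
    rw [← hn, iterate_etaComp_etaPowComp, iterate_etaComp_etaPowComp,
      show m + n = 0 by omega, etaPowComp_zero, etaPowComp_zero]

/-- Left multiplication of an operator by a function. -/
def funMul (F : SuperFun 𝕜) (Q : SPDO 𝕜) : SPDO 𝕜 :=
  ⟨fun k => F * coeff Q k, by
    obtain ⟨N, hN⟩ := exists_ordLE Q
    exact ⟨N, fun k hk => by simp [hN k hk]⟩⟩

theorem coeff_funMul (F : SuperFun 𝕜) (Q : SPDO 𝕜) (k : ℤ) :
    coeff (funMul F Q) k = F * coeff Q k := rfl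

theorem funMul_comp (F : SuperFun 𝕜) (Q W : SPDO 𝕜) :
    comp (funMul F Q) W = funMul F (comp Q W) := by
  obtain ⟨M, hM⟩ := exists_ordLE Q
  apply SPDO.ext
  intro p
  rw [coeff_funMul, coeff_comp, coeff_comp]
  refine Eq.trans ?_ ((AddMonoidHom.mulLeft F).map_finsum
    (mul_etaPowCoeff_support_finite hM W p)).symm
  exact finsum_congr fun m => by rw [coeff_funMul, mul_assoc]; rfl

/-- The monomial `F η^m`. -/
def monomial (F : SuperFun 𝕜) (m : ℤ) : SPDO 𝕜 :=
  ⟨fun k => if k = m then F else 0, m, fun k hk => by simp [hk.ne']⟩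

theorem coeff_monomial (F : SuperFun 𝕜) (m k : ℤ) :
    coeff (monomial F m) k = if k = m then F else 0 := rfl

theorem ordLE_monomial (F : SuperFun 𝕜) (m : ℤ) : OrdLE (monomial F m) m := fun k hk => by
  rw [coeff_monomial, if_neg hk.ne']

theorem monomial_comp (F : SuperFun 𝕜) (m : ℤ) (Q : SPDO 𝕜) :
    comp (monomial F m) Q = funMul F (etaPowComp m Q) := by
  apply SPDO.ext
  intro p
  rw [coeff_comp, finsum_eq_single _ m fun k hk => by rw [coeff_monomial, if_neg hk, zero_mul],
    coeff_monomial, if_pos rfl]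
  rfl

theorem monomial_comp_assoc (F : SuperFun 𝕜) (m : ℤ) (Q W : SPDO 𝕜) :
    comp (comp (monomial F m) Q) W = comp (monomial F m) (comp Q W) := by
  rw [monomial_comp, monomial_comp, funMul_comp, etaPowComp_comp]

/-- The part of `A` of order less than `l`, and the remaining monomials. -/
theorem exists_truncation (A : SPDO 𝕜) (l : ℤ) : ∃ (s : Finset ℤ) (B : SPDO 𝕜),
    A = (∑ m ∈ s, monomial (coeff A m) m) + B ∧ OrdLE B l := by
  obtain ⟨M, hM⟩ := exists_ordLE A
  refine ⟨Finset.Icc (l + 1) M, A - ∑ m ∈ Finset.Icc (l + 1) M, monomial (coeff A m) m,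
    by abel, fun k hk => ?_⟩
  rw [coeff_sub, coeff_sum]
  simp only [coeff_monomial]
  rw [Finset.sum_ite_eq]
  split_ifs with h
  · exact sub_self _
  · rw [sub_zero]
    refine hM k ?_
    simp only [Finset.mem_Icc] at h
    omega

/-- Associativity holds when the left factor is a monomial, and a fixed coefficient of the product
involves only finitely many monomials of `A`. -/
theorem comp_assoc (A B C : SPDO 𝕜) : comp (comp A B) C = comp A (comp B C) := by
  obtain ⟨M, hM⟩ := exists_ordLE B
  obtain ⟨N, hN⟩ := exists_ordLE C
  apply SPDO.ext
  intro p
  -- A tail of order at most p - 1 - M - N stays below degree p after composition with `B` and `C`.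
  obtain ⟨s, A', hA, hA'⟩ := exists_truncation A (p - 1 - M - N)
  rw [hA]
  simp only [add_comp, sum_comp, monomial_comp_assoc, coeff_add]
  rw [(hA'.comp hM).comp hN p (by omega), hA'.comp (hM.comp hN) p (by omega)]

/-! ### Parity -/

theorem coeff_parity (A : SPDO 𝕜) (k : ℤ) :
    coeff (parity A) k = if Even k then sigma (coeff A k) else -sigma (coeff A k) := rfl

theorem coeff_parity' (A : SPDO 𝕜) (k : ℤ) :
    coeff (parity A) k = ((k.negOnePow : ℤˣ) : ℤ) • sigma (coeff A k) := by
  rw [coeff_parity]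
  split_ifs with h
  · rw [Int.negOnePow_even _ h]; simp
  · rw [Int.negOnePow_odd _ (Int.not_even_iff_odd.1 h)]; simp

/-- Parity as a linear map. -/
def parityL (𝕜 : Type*) [RCLike 𝕜] : SPDO 𝕜 →ₗ[𝕜] SPDO 𝕜 where
  toFun := parity
  map_add' A B := by
    apply SPDO.ext
    intro k
    simp only [coeff_add, coeff_parity, sigma_add]
    split_ifs <;> abel
  map_smul' r A := by
    apply SPDO.ext
    intro k
    simp only [coeff_smul, coeff_parity, sigma_smul, RingHom.id_apply]
    split_ifs <;> simp

theorem parity_add (A B : SPDO 𝕜) : parity (A + B) = parity A + parity B := (parityL 𝕜).map_add A B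
theorem parity_sub (A B : SPDO 𝕜) : parity (A - B) = parity A - parity B := (parityL 𝕜).map_sub A B
theorem parity_smul (r : 𝕜) (A : SPDO 𝕜) : parity (r • A) = r • parity A := (parityL 𝕜).map_smul r A

/-- Moving σ past η^k costs (-1)^k. The signs of p and k recombine into those of m and of the
exponent p - m + k that accompanies the coefficient of `Q`, which is what makes parity
multiplicative. -/
theorem sigma_etaPowCoeff (m : ℤ) (Q : SPDO 𝕜) (p : ℤ) :
    ((p.negOnePow : ℤˣ) : ℤ) • sigma (etaPowCoeff m Q p) =
      ((m.negOnePow : ℤˣ) : ℤ) • etaPowCoeff m (parity Q) p := by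
  obtain ⟨N, hN⟩ := exists_ordLE Q
  have hN' : OrdLE (parity Q) N := fun k hk => by rw [coeff_parity', hN k hk]; simp
  have hK : N < p - m + ((N - p + m + 1).toNat : ℤ) := by omega
  rw [etaPowCoeff_eq_sum hN hK, etaPowCoeff_eq_sum hN' hK, sigma_sum, Finset.smul_sum,
    Finset.smul_sum]
  refine Finset.sum_congr rfl fun k _ => ?_
  have hs : ∀ F : SuperFun 𝕜, sigma (sigmaPow (m - k) F) = sigmaPow (m - k) (sigma F) := fun F => by
    unfold sigmaPow; split_ifs <;> rfl
  have hz : ∀ (n : ℤ) (F : SuperFun 𝕜), eta^[k] (sigmaPow (m - k) (n • F)) =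
      n • eta^[k] (sigmaPow (m - k) F) := fun n F => by
    simp only [iterate_eta_eq, ← sigmaPowL_apply, map_zsmul]
  rw [sigma_zsmul, sigma_iterate_eta, hs, coeff_parity', hz, smul_smul, smul_smul, smul_smul,
    smul_smul]
  congr 1
  have : (p.negOnePow : ℤ) * (-1) ^ k = (m.negOnePow : ℤ) * ((p - m + k).negOnePow : ℤ) := by
    have h1 : ((-1 : ℤ) ^ k) = (((k : ℤ).negOnePow : ℤˣ) : ℤ) := by simp [Int.negOnePow]
    rw [h1, ← Units.val_mul, ← Units.val_mul, ← Int.negOnePow_add, ← Int.negOnePow_add]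
    congr 2
    ring
  linear_combination (superBinom m k) * this

theorem parity_comp (A B : SPDO 𝕜) : parity (comp A B) = comp (parity A) (parity B) := by
  obtain ⟨M, hM⟩ := exists_ordLE A
  apply SPDO.ext
  intro p
  rw [coeff_parity', coeff_comp, coeff_comp]
  have g0 := mul_etaPowCoeff_support_finite hM B p
  have e1 : ((p.negOnePow : ℤˣ) : ℤ) • sigma (∑ᶠ m : ℤ, coeff A m * etaPowCoeff m B p) =
      ∑ᶠ m : ℤ, ((p.negOnePow : ℤˣ) : ℤ) • sigma (coeff A m * etaPowCoeff m B p) :=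
    ((((p.negOnePow : ℤˣ) : ℤ) • (sigmaL 𝕜)).toAddMonoidHom).map_finsum g0
  rw [e1]
  refine finsum_congr fun m => ?_
  rw [sigma_mul, ← mul_smul_comm, sigma_etaPowCoeff, coeff_parity', mul_smul_comm, smul_mul_assoc]

theorem OrdLE.parity {A : SPDO 𝕜} {a : ℤ} (h : OrdLE A a) : OrdLE (parity A) a := fun k hk => by
  rw [coeff_parity', h k hk, sigma_zero, smul_zero]

theorem superBracket_of_even {A : SPDO 𝕜} (hA : parity A = A) (B : SPDO 𝕜) :
    superBracket A B = comp A B - comp B A := by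
  have h1 : (1 / 2 : 𝕜) • (A + A) = A := by
    rw [← two_smul 𝕜 A, smul_smul, one_div, inv_mul_cancel₀ two_ne_zero, one_smul]
  rw [superBracket, hA, sub_self, smul_zero, comp_zero, sub_zero, h1]

theorem superBracket_of_odd {A : SPDO 𝕜} (hA : parity A = -A) (B : SPDO 𝕜) :
    superBracket A B = comp A B - comp (parity B) A := by
  have h1 : (1 / 2 : 𝕜) • (A - -A) = A := by
    rw [sub_neg_eq_add, ← two_smul 𝕜 A, smul_smul, one_div, inv_mul_cancel₀ two_ne_zero, one_smul]
  rw [superBracket, hA, add_neg_cancel, smul_zero, comp_zero, sub_zero, h1]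

theorem superBracket_odd_odd {A B : SPDO 𝕜} (hA : parity A = -A) (hB : parity B = -B) :
    superBracket A B = comp A B + comp B A := by
  rw [superBracket_of_odd hA, hB, neg_comp, sub_neg_eq_add]

/-- The supercommutator as a bilinear map. -/
def superBracketL (𝕜 : Type*) [RCLike 𝕜] : SPDO 𝕜 →ₗ[𝕜] SPDO 𝕜 →ₗ[𝕜] SPDO 𝕜 :=
  LinearMap.mk₂ 𝕜 superBracket
    (fun A A' B => by
      simp only [superBracket, add_comp, parity_add, comp_smul, comp_add, comp_sub]
      module)
    (fun r A B => by
      simp only [superBracket, smul_comp, parity_smul, comp_smul, comp_add, comp_sub]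
      module)
    (fun A B B' => by
      simp only [superBracket, add_comp, parity_add, comp_add]
      abel)
    (fun r A B => by
      simp only [superBracket, smul_comp, parity_smul, comp_smul, comp_add, comp_sub]
      module)

/-! ### Leading coefficients of a composition -/

theorem superBinom_one_even (m : ℤ) : superBinom (2 * m) 1 = 0 := by
  unfold superBinom
  rw [if_neg]
  rintro (h | h)
  · exact absurd h (by decide)
  · exact Int.not_odd_iff_even.2 ⟨m, by ring⟩ h

theorem coeff_comp_top {A B : SPDO 𝕜} {M N : ℤ} (hA : OrdLE A M) (hB : OrdLE B N) :
    coeff (comp A B) (M + N) = coeff A M * sigmaPow M (coeff B N) := by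
  rw [coeff_comp_eq_sum hA hB (a := M) (b := M) (by omega) le_rfl, Finset.Icc_self,
    Finset.sum_singleton, etaPowCoeff_eq_sum hB (K := 1) (by simp), Finset.sum_range_one,
    superBinom_zero]
  simp

theorem coeff_comp_top_sub_one {A B : SPDO 𝕜} {M N : ℤ} (hA : OrdLE A M) (hB : OrdLE B N) :
    coeff (comp A B) (M + N - 1) = coeff A (M - 1) * sigmaPow (M - 1) (coeff B N)
      + coeff A M * (sigmaPow M (coeff B (N - 1))
        + superBinom M 1 • eta (sigmaPow (M - 1) (coeff B N))) := by
  have hs : Finset.Icc (M - 1) M = {M - 1, M} := by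
    ext x; simp only [Finset.mem_Icc, Finset.mem_insert, Finset.mem_singleton]; omega
  rw [coeff_comp_eq_sum hA hB (a := M - 1) (b := M) (by omega) le_rfl, hs,
    Finset.sum_pair (by omega), etaPowCoeff_eq_sum hB (K := 1) (by push_cast; omega),
    etaPowCoeff_eq_sum hB (K := 2) (by push_cast; omega), Finset.sum_range_one,
    Finset.sum_range_succ, Finset.sum_range_one, superBinom_zero, superBinom_zero]
  simp only [Nat.cast_zero, sub_zero, add_zero, Function.iterate_zero, id, one_smul, Nat.cast_one,
    Function.iterate_one]
  rw [show M + N - 1 - (M - 1) = N by ring, show M + N - 1 - M = N - 1 by ring,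
    show N - 1 + 1 = N by ring]

theorem eq_zero_of_eq_neg {f : CircleFun 𝕜} (h : f = -f) : f = 0 := CircleFun.ext fun x =>
  self_eq_neg.1 (congrFun (congrArg Subtype.val h) x)

theorem snd_coeff_of_even {A : SPDO 𝕜} (hA : parity A = A) (k : ℤ) : (coeff A (2 * k)).snd = 0 := by
  have h := congrArg (fun X => (coeff X (2 * k)).snd) hA
  simp only [coeff_parity, even_two_mul, if_true, snd_sigma] at h
  exact eq_zero_of_eq_neg h.symm

theorem fst_coeff_of_even {A : SPDO 𝕜} (hA : parity A = A) (k : ℤ) :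
    (coeff A (2 * k + 1)).fst = 0 := by
  have h := congrArg (fun X => (coeff X (2 * k + 1)).fst) hA
  simp only [coeff_parity, Int.not_even_two_mul_add_one, if_false, TrivSqZeroExt.fst_neg,
    fst_sigma] at h
  exact eq_zero_of_eq_neg h.symm

theorem fst_coeff_of_odd {A : SPDO 𝕜} (hA : parity A = -A) (k : ℤ) : (coeff A (2 * k)).fst = 0 := by
  have h := congrArg (fun X => (coeff X (2 * k)).fst) hA
  simp only [coeff_parity, even_two_mul, if_true, fst_sigma, coeff_neg, TrivSqZeroExt.fst_neg] at h
  exact eq_zero_of_eq_neg h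

theorem snd_coeff_of_odd {A : SPDO 𝕜} (hA : parity A = -A) (k : ℤ) :
    (coeff A (2 * k + 1)).snd = 0 := by
  have h := congrArg (fun X => (coeff X (2 * k + 1)).snd) hA
  simp only [coeff_parity, Int.not_even_two_mul_add_one, if_false, TrivSqZeroExt.snd_neg,
    snd_sigma, neg_neg, coeff_neg] at h
  exact eq_zero_of_eq_neg h

theorem even_of_components {A : SPDO 𝕜} (h0 : ∀ k, (coeff A (2 * k)).snd = 0)
    (h1 : ∀ k, (coeff A (2 * k + 1)).fst = 0) : parity A = A := by
  apply SPDO.ext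
  intro k
  rcases Int.even_or_odd' k with ⟨n, rfl | rfl⟩
  · rw [coeff_parity, if_pos (even_two_mul n)]
    apply SuperFun.ext
    · simp
    · simp [h0]
  · rw [coeff_parity, if_neg (Int.not_even_two_mul_add_one n)]
    apply SuperFun.ext
    · simp [h1]
    · simp

/-- The commutator with an even operator lowers the order. -/
theorem ordLE_commutator {G A : SPDO 𝕜} {m a : ℤ} (hG : parity G = G) (hm : OrdLE G (2 * m))
    (ha : OrdLE A (2 * a)) : OrdLE (comp G A - comp A G) (2 * (m + a - 1)) := by
  intro k hk
  have h1 : ∀ k, k = 2 * m - 1 → (coeff G k).fst = 0 := fun k hk' => by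
    have := fst_coeff_of_even hG (m - 1)
    rwa [show 2 * (m - 1) + 1 = k by omega] at this
  have h2 := snd_coeff_of_even hG m
  have e1 : ∀ F : SuperFun 𝕜, sigmaPow (2 * m) F = F := sigmaPow_even (even_two_mul m)
  have e2 : ∀ F : SuperFun 𝕜, sigmaPow (2 * a) F = F := sigmaPow_even (even_two_mul a)
  have o1 : ∀ F : SuperFun 𝕜, sigmaPow (2 * m - 1) F = sigma F :=
    sigmaPow_odd ⟨m - 1, by ring⟩
  have o2 : ∀ F : SuperFun 𝕜, sigmaPow (2 * a - 1) F = sigma F :=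
    sigmaPow_odd ⟨a - 1, by ring⟩
  rw [coeff_sub]
  by_cases hk1 : 2 * m + 2 * a < k
  · rw [hm.comp ha k hk1, ha.comp hm k (by omega), sub_zero]
  by_cases hk2 : k = 2 * m + 2 * a
  · subst hk2
    -- At even exponents σ does not intervene, so the two products of leading coefficients agree.
    rw [coeff_comp_top hm ha, add_comm (2 * m), coeff_comp_top ha hm, e1, e2, mul_comm, sub_self]
  · obtain rfl : k = 2 * m + 2 * a - 1 := by omega
    -- One order lower the derivative terms drop out, because the super binomial (2m choose 1) is
    -- zero. The remaining occurrences of σ are harmless: `G` has no θ in its coefficient at η^(2m)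
    -- and only θ in the one at η^(2m-1). Hence the order drops by two.
    rw [coeff_comp_top_sub_one hm ha, add_comm (2 * m), coeff_comp_top_sub_one ha hm,
      superBinom_one_even, superBinom_one_even, e1, e2, o1, o2]
    simp only [zero_smul, add_zero]
    apply SuperFun.ext
    · simp [h1 _ rfl]; ring
    · simp [h1 _ rfl, h2]; ring

/-! ### Power series of an order-lowering operator -/

/-- A linear operator that lowers the order. -/
def Lowers (T : Module.End 𝕜 (SPDO 𝕜)) : Prop := ∀ (A : SPDO 𝕜) (a : ℤ), OrdLE A a → OrdLE (T A) (a - 1)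

theorem Lowers.pow {T : Module.End 𝕜 (SPDO 𝕜)} (hT : Lowers T) {A : SPDO 𝕜} {a : ℤ}
    (hA : OrdLE A a) (n : ℕ) : OrdLE ((T ^ n) A) (a - n) := by
  induction n with
  | zero =>
    rw [pow_zero, Module.End.one_apply]
    exact hA.mono (by simp)
  | succ n ih =>
    rw [pow_succ', Module.End.mul_apply]
    have := hT _ _ ih
    rwa [show a - n - 1 = a - (n + 1 : ℕ) by push_cast; ring] at this

theorem finsum_pow_eq_sum {T : Module.End 𝕜 (SPDO 𝕜)} (hT : Lowers T) (p : ℕ → 𝕜) {A : SPDO 𝕜}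
    {a : ℤ} (hA : OrdLE A a) {k : ℤ} {N : ℕ} (hN : a < k + N) :
    ∑ᶠ n, p n • coeff ((T ^ n) A) k = ∑ n ∈ Finset.range N, p n • coeff ((T ^ n) A) k := by
  refine finsum_eq_sum_of_support_subset _ fun n hn => ?_
  simp only [Finset.coe_range, Set.mem_Iio]
  by_contra h
  refine hn ?_
  simp only
  rw [hT.pow hA n k (by omega), smul_zero]

/-- The value of the power series `∑ p_n X^n` at an order-lowering operator. -/
def serEval (T : Module.End 𝕜 (SPDO 𝕜)) (hT : Lowers T) (p : ℕ → 𝕜) : Module.End 𝕜 (SPDO 𝕜) where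
  toFun A := ⟨fun k => ∑ᶠ n, p n • coeff ((T ^ n) A) k, by
    obtain ⟨a, ha⟩ := exists_ordLE A
    exact ⟨a, fun k hk =>
      (finsum_pow_eq_sum hT p ha (N := 0) (by simpa using hk)).trans (Finset.sum_range_zero _)⟩⟩
  map_add' A B := by
    obtain ⟨a, ha⟩ := exists_ordLE A
    obtain ⟨b, hb⟩ := exists_ordLE B
    have ha' := ha.mono (le_max_left a b)
    have hb' := hb.mono (le_max_right a b)
    apply SPDO.ext
    intro k
    have hN : max a b < k + ((max a b - k + 1).toNat : ℤ) := by omega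
    change ∑ᶠ n, p n • coeff ((T ^ n) (A + B)) k =
      ∑ᶠ n, p n • coeff ((T ^ n) A) k + ∑ᶠ n, p n • coeff ((T ^ n) B) k
    rw [finsum_pow_eq_sum hT p ha' hN, finsum_pow_eq_sum hT p hb' hN,
      finsum_pow_eq_sum hT p (ha'.add hb') hN, ← Finset.sum_add_distrib]
    refine Finset.sum_congr rfl fun n _ => ?_
    rw [map_add, coeff_add, smul_add]
  map_smul' r A := by
    apply SPDO.ext
    intro k
    change ∑ᶠ n, p n • coeff ((T ^ n) (r • A)) k = r • ∑ᶠ n, p n • coeff ((T ^ n) A) k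
    rw [smul_finsum]
    refine finsum_congr fun n => ?_
    rw [map_smul, coeff_smul, smul_comm]

theorem coeff_serEval {T : Module.End 𝕜 (SPDO 𝕜)} (hT : Lowers T) (p : ℕ → 𝕜) {A : SPDO 𝕜}
    {a : ℤ} (hA : OrdLE A a) {k : ℤ} {N : ℕ} (hN : a < k + N) :
    coeff (serEval T hT p A) k = ∑ n ∈ Finset.range N, p n • coeff ((T ^ n) A) k :=
  finsum_pow_eq_sum hT p hA hN

theorem OrdLE.serEval {T : Module.End 𝕜 (SPDO 𝕜)} (hT : Lowers T) (p : ℕ → 𝕜) {A : SPDO 𝕜}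
    {a : ℤ} (hA : OrdLE A a) : OrdLE (serEval T hT p A) a := fun k hk => by
  rw [coeff_serEval hT p hA (N := 0) (by simpa using hk), Finset.sum_range_zero]

/-- The remainder of the partial sums. -/
theorem ordLE_serEval_sub_sum {T : Module.End 𝕜 (SPDO 𝕜)} (hT : Lowers T) (p : ℕ → 𝕜) {A : SPDO 𝕜}
    {a : ℤ} (hA : OrdLE A a) (N : ℕ) :
    OrdLE (SuperCircle.serEval T hT p A - ∑ n ∈ Finset.range N, p n • (T ^ n) A) (a - N) := by
  intro k hk
  rw [coeff_sub, coeff_serEval hT p hA (N := N) (by omega), coeff_sum]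
  exact sub_self _

/-- The Cauchy product. Each application of `T` lowers the order, so in a given degree both series
can be replaced by finite sums. -/
theorem serEval_mul {T : Module.End 𝕜 (SPDO 𝕜)} (hT : Lowers T) (p q : ℕ → 𝕜) (A : SPDO 𝕜) :
    serEval T hT p (serEval T hT q A) =
      serEval T hT (fun n => ∑ i ∈ Finset.range (n + 1), p i * q (n - i)) A := by
  obtain ⟨a, ha⟩ := exists_ordLE A
  apply SPDO.ext
  intro k
  set N := (a - k + 1).toNat with hNdef
  have hN : a < k + (N : ℤ) := by omega
  rw [coeff_serEval hT p (ha.serEval hT q) hN, coeff_serEval hT _ ha hN]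
  have h1 : ∀ n : ℕ, coeff ((T ^ n) (serEval T hT q A)) k =
      ∑ j ∈ Finset.range N, q j • coeff ((T ^ (n + j)) A) k := fun n => by
    have h2 : coeff ((T ^ n) (serEval T hT q A -
        ∑ j ∈ Finset.range N, q j • (T ^ j) A)) k = 0 :=
      hT.pow (ordLE_serEval_sub_sum hT q ha N) n k (by omega)
    rw [map_sub, coeff_sub, sub_eq_zero] at h2
    rw [h2, map_sum, coeff_sum]
    refine Finset.sum_congr rfl fun j _ => ?_
    rw [map_smul, coeff_smul, pow_add, Module.End.mul_apply]
  have h3 : ∀ n, (∑ i ∈ Finset.range (n + 1), p i * q (n - i)) • coeff ((T ^ n) A) k =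
      ∑ i ∈ Finset.range (n + 1), (p i * q (n - i)) • coeff ((T ^ (i + (n - i))) A) k := fun n => by
    rw [Finset.sum_smul]
    refine Finset.sum_congr rfl fun i hi => ?_
    rw [Finset.mem_range] at hi
    rw [Nat.add_sub_cancel' (by omega)]
  simp only [h1, h3]
  rw [Finset.sum_range_diag_flip N (fun i j => (p i * q j) • coeff ((T ^ (i + j)) A) k)]
  refine Finset.sum_congr rfl fun i _ => ?_
  rw [Finset.smul_sum]
  symm
  simp only [smul_smul]
  refine Finset.sum_subset (fun x hx => by simp only [Finset.mem_range] at hx ⊢; omega)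
    fun j _ hj => ?_
  simp only [Finset.mem_range] at hj
  rw [hT.pow ha (i + j) k (by push_cast; omega), smul_zero]

theorem serEval_one {T : Module.End 𝕜 (SPDO 𝕜)} (hT : Lowers T) (A : SPDO 𝕜) :
    serEval T hT (fun n => if n = 0 then 1 else 0) A = A := by
  obtain ⟨a, ha⟩ := exists_ordLE A
  apply SPDO.ext
  intro k
  rw [coeff_serEval hT _ ha (N := (a - k + 1).toNat + 1) (by push_cast; omega),
    Finset.sum_range_succ']
  simp only [Nat.add_one_ne_zero, if_false, zero_smul, Finset.sum_const_zero, zero_add, if_true,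
    one_smul, pow_zero, Module.End.one_apply]

/-! ### The exponential of an order-lowering derivation -/

/-- The coefficients of the exponential series. -/
def expCoeff (𝕜 : Type*) [RCLike 𝕜] (n : ℕ) : 𝕜 := 1 / (n.factorial : 𝕜)

theorem succ_mul_expCoeff_succ (n : ℕ) : ((n + 1 : ℕ) : 𝕜) * expCoeff 𝕜 (n + 1) = expCoeff 𝕜 n := by
  have h1 : (n.factorial : 𝕜) ≠ 0 := by exact_mod_cast n.factorial_ne_zero
  have h2 : ((n + 1 : ℕ) : 𝕜) ≠ 0 := by exact_mod_cast n.succ_ne_zero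
  rw [expCoeff, expCoeff, Nat.factorial_succ, Nat.cast_mul]
  field_simp

theorem sum_expCoeff_neg (n : ℕ) :
    ∑ i ∈ Finset.range (n + 1), expCoeff 𝕜 i * ((-1) ^ (n - i) * expCoeff 𝕜 (n - i)) =
      if n = 0 then 1 else 0 := by
  have h := congrArg (PowerSeries.coeff n) (PowerSeries.exp_mul_exp_neg_eq_one (A := 𝕜))
  rw [PowerSeries.coeff_mul, Finset.Nat.sum_antidiagonal_eq_sum_range_succ_mk,
    PowerSeries.coeff_one] at h
  rw [← h]
  refine Finset.sum_congr rfl fun i _ => ?_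
  simp [PowerSeries.evalNegHom, PowerSeries.coeff_exp, PowerSeries.coeff_rescale, expCoeff]

theorem sum_neg_expCoeff (n : ℕ) :
    ∑ i ∈ Finset.range (n + 1), ((-1) ^ i * expCoeff 𝕜 i) * expCoeff 𝕜 (n - i) =
      if n = 0 then 1 else 0 := by
  rw [← sum_expCoeff_neg n, ← Finset.sum_range_reflect]
  refine Finset.sum_congr rfl fun i hi => ?_
  rw [Finset.mem_range] at hi
  rw [show n + 1 - 1 - i = n - i by omega, show n - (n - i) = i by omega]
  ring

/-- The exponential of an order-lowering operator, an automorphism of the space of operators. -/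
def expEquiv (T : Module.End 𝕜 (SPDO 𝕜)) (hT : Lowers T) : SPDO 𝕜 ≃ₗ[𝕜] SPDO 𝕜 :=
  LinearEquiv.ofLinearMap (serEval T hT (expCoeff 𝕜)) (serEval T hT fun n => (-1) ^ n * expCoeff 𝕜 n)
    (LinearMap.ext fun A => by
      rw [LinearMap.comp_apply, serEval_mul]
      simp only [sum_expCoeff_neg, serEval_one, LinearMap.id_apply])
    (LinearMap.ext fun A => by
      rw [LinearMap.comp_apply, serEval_mul]
      simp only [sum_neg_expCoeff, serEval_one, LinearMap.id_apply])

theorem expEquiv_apply (T : Module.End 𝕜 (SPDO 𝕜)) (hT : Lowers T) (A : SPDO 𝕜) :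
    expEquiv T hT A = serEval T hT (expCoeff 𝕜) A := rfl

theorem expCoeff_smul_pow_succ (T : Module.End 𝕜 (SPDO 𝕜)) (n : ℕ) (A : SPDO 𝕜) :
    T (expCoeff 𝕜 n • (T ^ n) A) = ((n + 1 : ℕ) : 𝕜) • expCoeff 𝕜 (n + 1) • (T ^ (n + 1)) A := by
  rw [map_smul, smul_smul, succ_mul_expCoeff_succ, pow_succ', Module.End.mul_apply]

/-- For the divided powers T^n / n! of a derivation the Leibniz rule has no binomial coefficients.
In the induction the factor n + 1 is split as i + j over each pair of the antidiagonal. -/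
theorem divided_pow_comp {T : Module.End 𝕜 (SPDO 𝕜)}
    (hd : ∀ A B, T (comp A B) = comp (T A) B + comp A (T B)) (n : ℕ) (A B : SPDO 𝕜) :
    expCoeff 𝕜 n • (T ^ n) (comp A B) = ∑ ij ∈ Finset.HasAntidiagonal.antidiagonal n,
      comp (expCoeff 𝕜 ij.1 • (T ^ ij.1) A) (expCoeff 𝕜 ij.2 • (T ^ ij.2) B) := by
  induction n with
  | zero =>
    rw [Finset.Nat.antidiagonal_zero, Finset.sum_singleton]
    simp only [expCoeff, Nat.factorial_zero, Nat.cast_one, div_one, pow_zero, Module.End.one_apply,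
      one_smul]
  | succ n ih =>
    have hn : ((n + 1 : ℕ) : 𝕜) ≠ 0 := by exact_mod_cast n.succ_ne_zero
    refine smul_right_injective _ hn ?_
    simp only
    rw [← expCoeff_smul_pow_succ, ih, map_sum, Finset.smul_sum]
    have h1 : ∀ ij ∈ Finset.HasAntidiagonal.antidiagonal (n + 1), ((n + 1 : ℕ) : 𝕜) •
        comp (expCoeff 𝕜 ij.1 • (T ^ ij.1) A) (expCoeff 𝕜 ij.2 • (T ^ ij.2) B) =
        (ij.1 : 𝕜) • comp (expCoeff 𝕜 ij.1 • (T ^ ij.1) A) (expCoeff 𝕜 ij.2 • (T ^ ij.2) B) +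
        (ij.2 : 𝕜) • comp (expCoeff 𝕜 ij.1 • (T ^ ij.1) A) (expCoeff 𝕜 ij.2 • (T ^ ij.2) B) :=
      fun ij hij => by
        rw [← add_smul, ← Nat.cast_add, Finset.HasAntidiagonal.mem_antidiagonal.1 hij]
    rw [Finset.sum_congr rfl h1, Finset.sum_add_distrib]
    rw [Finset.Nat.sum_antidiagonal_succ, Finset.Nat.sum_antidiagonal_succ' (f := fun ij : ℕ × ℕ =>
      (ij.2 : 𝕜) • comp (expCoeff 𝕜 ij.1 • (T ^ ij.1) A) (expCoeff 𝕜 ij.2 • (T ^ ij.2) B))]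
    simp only [Nat.cast_zero, zero_smul, zero_add, ← Finset.sum_add_distrib, hd,
      expCoeff_smul_pow_succ]
    refine Finset.sum_congr rfl fun ij _ => ?_
    rw [smul_comp ((ij.1 + 1 : ℕ) : 𝕜), comp_smul ((ij.2 + 1 : ℕ) : 𝕜)]

/-- The exponential of a derivation is multiplicative. Up to operators that do not reach degree `k`,
both exponentials are their first `N` terms, and the square of index pairs differs from the triangle
i + j < N only in terms of too low order. -/
theorem expEquiv_comp {T : Module.End 𝕜 (SPDO 𝕜)} (hT : Lowers T)
    (hd : ∀ A B, T (comp A B) = comp (T A) B + comp A (T B)) (A B : SPDO 𝕜) :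
    expEquiv T hT (comp A B) = comp (expEquiv T hT A) (expEquiv T hT B) := by
  obtain ⟨a, ha⟩ := exists_ordLE A
  obtain ⟨b, hb⟩ := exists_ordLE B
  simp only [expEquiv_apply]
  apply SPDO.ext
  intro k
  set N := (a + b - k + 1).toNat
  have hN : a + b < k + (N : ℤ) := by omega
  set c : ℕ → SPDO 𝕜 := fun n => expCoeff 𝕜 n • (T ^ n) A with hc
  set d : ℕ → SPDO 𝕜 := fun n => expCoeff 𝕜 n • (T ^ n) B with hd'
  have hca : ∀ n, OrdLE (c n) (a - n) := fun n => (hT.pow ha n).smul _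
  have hdb : ∀ n, OrdLE (d n) (b - n) := fun n => (hT.pow hb n).smul _
  have hA := ordLE_serEval_sub_sum hT (expCoeff 𝕜) ha N
  have hB := ordLE_serEval_sub_sum hT (expCoeff 𝕜) hb N
  have hs : OrdLE (∑ n ∈ Finset.range N, c n) a :=
    OrdLE.sum fun n _ => (hca n).mono (by omega)
  have e1 : comp (serEval T hT (expCoeff 𝕜) A) (serEval T hT (expCoeff 𝕜) B) =
      comp (∑ n ∈ Finset.range N, c n) (∑ n ∈ Finset.range N, d n) +
      (comp (serEval T hT (expCoeff 𝕜) A - ∑ n ∈ Finset.range N, c n)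
        (serEval T hT (expCoeff 𝕜) B) +
       comp (∑ n ∈ Finset.range N, c n)
        (serEval T hT (expCoeff 𝕜) B - ∑ n ∈ Finset.range N, d n)) := by
    rw [sub_comp, comp_sub]
    abel
  rw [e1, coeff_add, coeff_add, hA.comp (hb.serEval hT _) k (by omega),
    hs.comp hB k (by omega), add_zero, add_zero, coeff_serEval hT _ (ha.comp hb) hN, sum_comp,
    coeff_sum]
  have e2 : ∀ n, expCoeff 𝕜 n • coeff ((T ^ n) (comp A B)) k =
      ∑ i ∈ Finset.range (n + 1), coeff (comp (c i) (d (n - i))) k := fun n => by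
    rw [← coeff_smul, divided_pow_comp hd, coeff_sum,
      Finset.Nat.sum_antidiagonal_eq_sum_range_succ_mk]
  simp only [e2]
  rw [Finset.sum_range_diag_flip N (fun i j => coeff (comp (c i) (d j)) k)]
  refine Finset.sum_congr rfl fun i _ => ?_
  rw [comp_sum, coeff_sum]
  refine Finset.sum_subset (fun x hx => by simp only [Finset.mem_range] at hx ⊢; omega)
    fun j _ hj => ?_
  simp only [Finset.mem_range] at hj
  exact (hca i).comp (hdb j) k (by omega)

theorem expEquiv_parity {T : Module.End 𝕜 (SPDO 𝕜)} (hT : Lowers T)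
    (hp : ∀ A, T (parity A) = parity (T A)) (A : SPDO 𝕜) :
    expEquiv T hT (parity A) = parity (expEquiv T hT A) := by
  obtain ⟨a, ha⟩ := exists_ordLE A
  simp only [expEquiv_apply]
  have hn : ∀ n : ℕ, (T ^ n) (parity A) = parity ((T ^ n) A) := fun n => by
    induction n with
    | zero => rfl
    | succ n ih => rw [pow_succ', Module.End.mul_apply, ih, hp, Module.End.mul_apply]
  apply SPDO.ext
  intro k
  have hN : a < k + ((a - k + 1).toNat : ℤ) := by omega
  rw [coeff_serEval hT _ ha.parity hN, coeff_parity', coeff_serEval hT _ ha hN, sigma_sum,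
    Finset.smul_sum]
  refine Finset.sum_congr rfl fun n _ => ?_
  rw [hn, coeff_parity', sigma_smul, smul_comm]

/-! ### Conjugation by even operators of nonpositive order. -/

/-- The supercommutator with an operator. -/
def adL (G : SPDO 𝕜) : Module.End 𝕜 (SPDO 𝕜) := superBracketL 𝕜 G

theorem adL_eq {G : SPDO 𝕜} (hG : parity G = G) (A : SPDO 𝕜) : adL G A = comp G A - comp A G :=
  superBracket_of_even hG A

theorem ordLE_adL {G A : SPDO 𝕜} {m a : ℤ} (hG : parity G = G) (hm : OrdLE G (2 * m))
    (ha : OrdLE A (2 * a)) : OrdLE (adL G A) (2 * (m + a - 1)) := by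
  rw [adL_eq hG]
  exact ordLE_commutator hG hm ha

/-- The commutator gains two orders at even order; rounding an odd order up to the next even number
loses one of them, so one order is always gained. -/
theorem lowers_adL {G : SPDO 𝕜} (hG : parity G = G) (h0 : OrdLE G 0) : Lowers (adL G) := by
  intro A a ha
  rcases Int.even_or_odd' a with ⟨n, rfl | rfl⟩
  · exact (ordLE_adL hG (m := 0) (by simpa using h0) ha).mono (by omega)
  · exact (ordLE_adL hG (m := 0) (by simpa using h0)
      (ha.mono (show 2 * n + 1 ≤ 2 * (n + 1) by omega))).mono (by omega)

theorem adL_comp {G : SPDO 𝕜} (hG : parity G = G) (A B : SPDO 𝕜) :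
    adL G (comp A B) = comp (adL G A) B + comp A (adL G B) := by
  simp only [adL_eq hG, comp_sub, sub_comp, comp_assoc]
  abel

theorem adL_parity {G : SPDO 𝕜} (hG : parity G = G) (A : SPDO 𝕜) :
    adL G (parity A) = parity (adL G A) := by
  simp only [adL_eq hG, parity_sub, parity_comp, hG]

/-- The automorphism `exp (ad G)` for an even operator `G` of order at most zero. -/
def expAd (G : SPDO 𝕜) (hG : parity G = G) (h0 : OrdLE G 0) : SPDO 𝕜 ≃ₗ[𝕜] SPDO 𝕜 :=
  expEquiv (adL G) (lowers_adL hG h0)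

theorem expAd_superBracket (G : SPDO 𝕜) (hG : parity G = G) (h0 : OrdLE G 0) (A B : SPDO 𝕜) :
    expAd G hG h0 (superBracket A B) = superBracket (expAd G hG h0 A) (expAd G hG h0 B) := by
  have h1 := expEquiv_comp (lowers_adL hG h0) (adL_comp hG)
  have h2 := expEquiv_parity (lowers_adL hG h0) (adL_parity hG)
  simp only [superBracket, expAd, map_sub, map_add, map_smul, h1, h2]

theorem coeff_expAd (G : SPDO 𝕜) (hG : parity G = G) (h0 : OrdLE G 0) {A : SPDO 𝕜} {a k : ℤ}
    (ha : OrdLE A a) {N : ℕ} (hN : a < k + N) : coeff (expAd G hG h0 A) k =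
      ∑ n ∈ Finset.range N, (1 / (n.factorial : 𝕜)) • coeff ((adL G ^ n) A) k :=
  coeff_serEval (lowers_adL hG h0) _ ha hN

theorem isExpAd_expAd (G : SPDO 𝕜) (hG : parity G = G) (h0 : OrdLE G 0) :
    IsExpAd G (expAd G hG h0) := by
  intro A k
  obtain ⟨a, ha⟩ := exists_ordLE A
  filter_upwards [Filter.eventually_ge_atTop (a - k + 1).toNat] with N hN
  rw [coeff_expAd G hG h0 ha (N := N) (by omega)]
  refine Finset.sum_congr rfl fun n _ => ?_
  rw [Module.End.pow_apply]
  rfl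

theorem expAd_parity (G : SPDO 𝕜) (hG : parity G = G) (h0 : OrdLE G 0) (A : SPDO 𝕜) :
    expAd G hG h0 (parity A) = parity (expAd G hG h0 A) :=
  expEquiv_parity (lowers_adL hG h0) (adL_parity hG) A

theorem ordLE_adL_pow {G A : SPDO 𝕜} {a : ℤ} (hG : parity G = G) (h0 : OrdLE G 0)
    (ha : OrdLE A (2 * a)) (n : ℕ) : OrdLE ((SuperCircle.adL G ^ n) A) (2 * (a - n)) := by
  induction n with
  | zero =>
    rw [pow_zero, Module.End.one_apply]
    exact ha.mono (by simp)
  | succ n ih =>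
    rw [pow_succ', Module.End.mul_apply]
    refine (ordLE_adL hG (m := 0) (by simpa using h0) ih).mono ?_
    push_cast
    omega

/-- The exponential agrees with its first terms up to lower order. -/
theorem ordLE_expAd_sub (G : SPDO 𝕜) (hG : parity G = G) (h0 : OrdLE G 0) {A : SPDO 𝕜} {a : ℤ}
    (ha : OrdLE A (2 * a)) : OrdLE (expAd G hG h0 A - A - adL G A) (2 * (a - 2)) := by
  intro k hk
  obtain ⟨N, hN⟩ : ∃ N : ℕ, 2 * a < k + (N + 2 : ℕ) := ⟨(2 * a - k).toNat, by push_cast; omega⟩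
  rw [coeff_sub, coeff_sub, coeff_expAd G hG h0 ha hN, Finset.sum_range_succ',
    Finset.sum_range_succ', Finset.sum_eq_zero fun n _ => by
      rw [ordLE_adL_pow hG h0 ha (n + 1 + 1) k (by push_cast; omega), smul_zero]]
  simp only [zero_add, pow_one, pow_zero, Module.End.one_apply, Nat.factorial_one,
    Nat.factorial_zero, Nat.cast_one, div_one, one_smul]
  abel

/-- Adding a term of lower order to the exponent. -/
theorem ordLE_expAd_add_sub (G X : SPDO 𝕜) (hG : parity G = G) (h0 : OrdLE G 0)
    (hX : parity X = X) {m : ℤ} (hm : OrdLE X (2 * m)) (hGX : parity (G + X) = G + X)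
    (h0X : OrdLE (G + X) 0) {A : SPDO 𝕜} {a : ℤ} (ha : OrdLE A (2 * a)) :
    OrdLE (expAd (G + X) hGX h0X A - expAd G hG h0 A - adL X A) (2 * (m + a - 2)) := by
  have hlin : ∀ B, adL (G + X) B = adL G B + adL X B := fun B => by
    simp only [adL, map_add, LinearMap.add_apply]
  -- In the difference of the two powers every word in ad G and ad X contains X at least once, and
  -- each further letter lowers the order by two.
  have key : ∀ n : ℕ, OrdLE ((adL (G + X) ^ (n + 1)) A - (adL G ^ (n + 1)) A)
      (2 * (m + a - 1 - n)) := by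
    intro n
    induction n with
    | zero =>
      simp only [zero_add, pow_one, hlin, add_sub_cancel_left]
      exact (ordLE_adL hX hm ha).mono (by push_cast; omega)
    | succ n ih =>
      have h1 : (adL (G + X) ^ (n + 1 + 1)) A - (adL G ^ (n + 1 + 1)) A =
          adL (G + X) ((adL (G + X) ^ (n + 1)) A - (adL G ^ (n + 1)) A) +
          adL X ((adL G ^ (n + 1)) A) := by
        rw [pow_succ', Module.End.mul_apply, pow_succ' (adL G), Module.End.mul_apply, map_sub,
          hlin ((adL G ^ (n + 1)) A)]
        abel
      rw [h1]
      refine OrdLE.add ?_ ?_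
      · exact (ordLE_adL hGX (m := 0) (by simpa using h0X) ih).mono (by push_cast; omega)
      · exact (ordLE_adL hX hm (ordLE_adL_pow hG h0 ha (n + 1))).mono (by push_cast; omega)
  intro k hk
  obtain ⟨N, hN⟩ : ∃ N : ℕ, 2 * a < k + (N + 2 : ℕ) := ⟨(2 * a - k).toNat, by push_cast; omega⟩
  rw [coeff_sub, coeff_sub, coeff_expAd _ hGX h0X ha hN, coeff_expAd G hG h0 ha hN,
    ← Finset.sum_sub_distrib]
  simp only [← smul_sub, ← coeff_sub]
  rw [Finset.sum_range_succ', Finset.sum_range_succ', Finset.sum_eq_zero fun n _ => by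
    rw [key (n + 1) k (by push_cast; omega), smul_zero]]
  simp only [zero_add, pow_one, pow_zero, Module.End.one_apply, Nat.factorial_one,
    Nat.factorial_zero, Nat.cast_one, div_one, one_smul, hlin, coeff_sub, coeff_add]
  abel

/-! ### Products of symbols in one even variable -/

/-- Evaluation at a point. -/
def evalAt (𝕜 : Type*) [RCLike 𝕜] (x : ℝ) : CircleFun 𝕜 →ₗ[𝕜] 𝕜 where
  toFun f := (f : ℝ → 𝕜) x
  map_add' _ _ := rfl
  map_smul' _ _ := rfl

theorem evalAt_apply (x : ℝ) (f : CircleFun 𝕜) : evalAt 𝕜 x f = (f : ℝ → 𝕜) x := rfl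

theorem evalAt_mul (x : ℝ) (f g : CircleFun 𝕜) :
    evalAt 𝕜 x (f * g) = evalAt 𝕜 x f * evalAt 𝕜 x g := rfl

theorem ext_evalAt {f g : CircleFun 𝕜} (h : ∀ x, evalAt 𝕜 x f = evalAt 𝕜 x g) : f = g :=
  CircleFun.ext h

theorem evalAt_algebraMap (x : ℝ) (r : 𝕜) : evalAt 𝕜 x (algebraMap 𝕜 (CircleFun 𝕜) r) = r := rfl

theorem evalAt_one (x : ℝ) : evalAt 𝕜 x 1 = 1 := rfl

/-- The coefficients of `ξ^m ∘ v`, where `v = ∑ v_k ξ^k` and `ξ` stands for `d/dx`. -/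
def xiPowCoeff (m : ℤ) (v : ℤ → CircleFun 𝕜) (p : ℤ) : CircleFun 𝕜 :=
  ∑ᶠ j : ℕ, Ring.choose m j • ddx^[j] (v (p - m + j))

/-- The coefficients of the composition `u ∘ v` of `u = ∑ u_k ξ^k` and `v = ∑ v_k ξ^k`. -/
def star (u v : ℤ → CircleFun 𝕜) (p : ℤ) : CircleFun 𝕜 := ∑ᶠ m : ℤ, u m * xiPowCoeff m v p

theorem xiPowCoeff_eq_sum {m : ℤ} {v : ℤ → CircleFun 𝕜} {N : ℤ} (hv : ∀ k, N < k → v k = 0)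
    {p : ℤ} {K : ℕ} (hK : N < p - m + K) :
    xiPowCoeff m v p = ∑ j ∈ Finset.range K, Ring.choose m j • ddx^[j] (v (p - m + j)) := by
  refine finsum_eq_sum_of_support_subset _ fun k hk => ?_
  simp only [Finset.coe_range, Set.mem_Iio]
  by_contra h
  refine hk ?_
  simp only
  rw [hv _ (by omega), iterate_ddx_zero, smul_zero]

theorem xiPowCoeff_eq_zero {m : ℤ} {v : ℤ → CircleFun 𝕜} {N : ℤ} (hv : ∀ k, N < k → v k = 0)
    {p : ℤ} (h : N + m < p) : xiPowCoeff m v p = 0 := by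
  rw [xiPowCoeff_eq_sum hv (K := 0) (by simp; omega), Finset.sum_range_zero]

theorem xiPowCoeff_top {m : ℤ} {v : ℤ → CircleFun 𝕜} {N : ℤ} (hv : ∀ k, N < k → v k = 0)
    {p : ℤ} (h : p = m + N) : xiPowCoeff m v p = v N := by
  rw [xiPowCoeff_eq_sum hv (K := 1) (by push_cast; omega), Finset.sum_range_one,
    Ring.choose_zero_right, one_smul]
  simp [h]

theorem xiPowCoeff_top_sub_one {m : ℤ} {v : ℤ → CircleFun 𝕜} {N : ℤ} (hv : ∀ k, N < k → v k = 0)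
    {p : ℤ} (h : p = m + N - 1) : xiPowCoeff m v p = v (N - 1) + (m : 𝕜) • ddx (v N) := by
  rw [xiPowCoeff_eq_sum hv (K := 2) (by push_cast; omega), Finset.sum_range_succ,
    Finset.sum_range_one, Ring.choose_zero_right, one_smul, Ring.choose_one_right,
    Int.cast_smul_eq_zsmul]
  subst h
  congr 3
  · simp
    ring_nf
  · rw [Function.iterate_one]
    congr 2
    push_cast
    ring

theorem star_support_finite {u v : ℤ → CircleFun 𝕜} {M N : ℤ} (hu : ∀ k, M < k → u k = 0)
    (hv : ∀ k, N < k → v k = 0) (p : ℤ) :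
    (Function.support fun m : ℤ => u m * xiPowCoeff m v p) ⊆ (Finset.Icc (p - N) M : Finset ℤ) := by
  intro m hm
  simp only [Finset.coe_Icc, Set.mem_Icc]
  by_contra h
  refine hm ?_
  simp only
  by_cases h1 : M < m
  · rw [hu m h1, zero_mul]
  · rw [xiPowCoeff_eq_zero hv (by omega), mul_zero]

theorem star_eq_sum {u v : ℤ → CircleFun 𝕜} {M N : ℤ} (hu : ∀ k, M < k → u k = 0)
    (hv : ∀ k, N < k → v k = 0) (p : ℤ) :
    star u v p = ∑ m ∈ Finset.Icc (p - N) M, u m * xiPowCoeff m v p :=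
  finsum_eq_sum_of_support_subset _ (star_support_finite hu hv p)

theorem star_eq_zero {u v : ℤ → CircleFun 𝕜} {M N : ℤ} (hu : ∀ k, M < k → u k = 0)
    (hv : ∀ k, N < k → v k = 0) {p : ℤ} (hp : M + N < p) : star u v p = 0 := by
  rw [star_eq_sum hu hv, Finset.Icc_eq_empty (by omega), Finset.sum_empty]

theorem star_top {u v : ℤ → CircleFun 𝕜} {M N : ℤ} (hu : ∀ k, M < k → u k = 0)
    (hv : ∀ k, N < k → v k = 0) {p : ℤ} (hp : p = M + N) : star u v p = u M * v N := by
  rw [star_eq_sum hu hv, show p - N = M by omega, Finset.Icc_self, Finset.sum_singleton,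
    xiPowCoeff_top hv hp]

theorem star_top_sub_one {u v : ℤ → CircleFun 𝕜} {M N : ℤ} (hu : ∀ k, M < k → u k = 0)
    (hv : ∀ k, N < k → v k = 0) {p : ℤ} (hp : p = M + N - 1) :
    star u v p = u (M - 1) * v N + u M * v (N - 1) + (M : 𝕜) • (u M * ddx (v N)) := by
  have hs : Finset.Icc (p - N) M = {M - 1, M} := by
    ext x; simp only [Finset.mem_Icc, Finset.mem_insert, Finset.mem_singleton]; omega
  rw [star_eq_sum hu hv, hs, Finset.sum_pair (by omega), xiPowCoeff_top hv (by omega),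
    xiPowCoeff_top_sub_one hv hp, mul_add, mul_smul_comm, add_assoc]

/-- Left composition with an operator whose coefficients other than `u_0` vanish at `x`. -/
theorem evalAt_star_left {u v : ℤ → CircleFun 𝕜} {M N : ℤ} (hu : ∀ k, M < k → u k = 0)
    (hv : ∀ k, N < k → v k = 0) {x : ℝ} (h : ∀ k, k ≠ 0 → evalAt 𝕜 x (u k) = 0) (p : ℤ) :
    evalAt 𝕜 x (star u v p) = evalAt 𝕜 x (u 0) * evalAt 𝕜 x (v p) := by
  have h0 : xiPowCoeff 0 v p = v p := by
    rw [xiPowCoeff_eq_sum hv (K := (N - p + 1).toNat + 1) (by push_cast; omega),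
      Finset.sum_range_succ', Finset.sum_eq_zero fun k _ => by
        rw [Ring.choose_zero_of_pos (Nat.succ_pos k), zero_smul]]
    rw [Ring.choose_zero_right]
    simp
  rw [star_eq_sum hu hv, map_sum]
  simp only [evalAt_mul]
  rw [Finset.sum_eq_single 0, h0]
  · intro k _ hk
    rw [h k hk, zero_mul]
  · intro hk
    simp only [Finset.mem_Icc] at hk
    by_cases h1 : M < 0
    · rw [hu 0 h1, map_zero, zero_mul]
    · rw [h0, hv p (by omega), map_zero, mul_zero]

/-- Right composition with an operator that has the jet of `x ξ + l` at the origin. -/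
theorem evalAt_star_right {u v : ℤ → CircleFun 𝕜} {M N : ℤ} (hu : ∀ k, M < k → u k = 0)
    (hv : ∀ k, N < k → v k = 0) {x : ℝ} {l : 𝕜}
    (h : ∀ (k : ℤ) (j : ℕ), evalAt 𝕜 x (ddx^[j] (u k)) =
      if k = 1 ∧ j = 1 then 1 else if k = 0 ∧ j = 0 then l else 0) (p : ℤ) :
    evalAt 𝕜 x (star v u p) = ((p : 𝕜) + l) * evalAt 𝕜 x (v p) := by
  have h0 : ∀ m, evalAt 𝕜 x (xiPowCoeff m u p) = if m = p then (p : 𝕜) + l else 0 := fun m => by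
    rw [xiPowCoeff_eq_sum hu (K := (M - p + m + 1).toNat + 2) (by push_cast; omega), map_sum,
      Finset.sum_range_succ', Finset.sum_range_succ', Finset.sum_eq_zero, zero_add]
    · simp only [map_zsmul, h, Ring.choose_zero_right, Ring.choose_one_right, zero_add,
        Nat.cast_one, Nat.cast_zero, add_zero, one_smul, and_true]
      split_ifs <;> first | omega | simp_all
    · intro j _
      rw [map_zsmul, h, if_neg (by omega), if_neg (by omega), smul_zero]
  rw [star_eq_sum hv hu, map_sum]
  simp only [evalAt_mul, h0, mul_ite, mul_zero]
  rw [Finset.sum_ite_eq']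
  split_ifs with hp
  · ring
  · rw [Finset.mem_Icc] at hp
    by_cases h1 : N < p
    · rw [hv p h1, map_zero, mul_zero]
    · have hM : M < 0 := by omega
      have h2 := h 1 1
      rw [hu 1 (by omega), iterate_ddx_zero, map_zero] at h2
      simp at h2

/-! ### Matrix entries of an operator -/

/-- The entry at position `(1,1)` of the matrix of operators on the circle given by `P`. -/
def blkA (P : SPDO 𝕜) (k : ℤ) : CircleFun 𝕜 := (coeff P (2 * k)).fst

/-- The entry at position `(1,2)`. -/
def blkB (P : SPDO 𝕜) (k : ℤ) : CircleFun 𝕜 := (coeff P (2 * k + 1)).fst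

/-- The entry at position `(2,1)`. -/
def blkC (P : SPDO 𝕜) : ℤ → CircleFun 𝕜 := blkA (etaComp P)

/-- The entry at position `(2,2)`. -/
def blkD (P : SPDO 𝕜) : ℤ → CircleFun 𝕜 := blkB (etaComp P)

theorem blkC_apply (P : SPDO 𝕜) (k : ℤ) :
    blkC P k = (coeff P (2 * k)).snd + (coeff P (2 * k - 1)).fst := by
  simp [blkC, blkA, coeff_etaComp]

theorem blkD_apply (P : SPDO 𝕜) (k : ℤ) :
    blkD P k = (coeff P (2 * k + 1)).snd + (coeff P (2 * k)).fst := by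
  simp [blkD, blkB, coeff_etaComp]

theorem blkA_sub (P Q : SPDO 𝕜) (k : ℤ) : blkA (P - Q) k = blkA P k - blkA Q k := rfl
theorem blkB_sub (P Q : SPDO 𝕜) (k : ℤ) : blkB (P - Q) k = blkB P k - blkB Q k := rfl
theorem blkC_sub (P Q : SPDO 𝕜) (k : ℤ) : blkC (P - Q) k = blkC P k - blkC Q k := by
  rw [blkC, etaComp_sub, blkA_sub]; rfl
theorem blkD_sub (P Q : SPDO 𝕜) (k : ℤ) : blkD (P - Q) k = blkD P k - blkD Q k := by
  rw [blkD, etaComp_sub, blkB_sub]; rfl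
theorem blkA_add (P Q : SPDO 𝕜) (k : ℤ) : blkA (P + Q) k = blkA P k + blkA Q k := rfl

theorem blkA_of_odd {P : SPDO 𝕜} (hP : parity P = -P) : blkA P = 0 :=
  funext fun k => fst_coeff_of_odd hP k

theorem blkB_of_even {P : SPDO 𝕜} (hP : parity P = P) : blkB P = 0 :=
  funext fun k => fst_coeff_of_even hP k

/-- The identity η^m ∘ η = η^(m+1) is checked on the operator 1, whose coefficients have no
derivatives, and is carried over to every `Q` by associativity. -/
theorem etaPowComp_etaComp (m : ℤ) (Q : SPDO 𝕜) :
    etaPowComp m (etaComp Q) = etaPowComp (m + 1) Q := by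
  have h := etaPowComp_comp m (etaPowComp 1 (monomial 1 0)) Q
  have h1 : comp (monomial 1 0) Q = Q := by
    rw [monomial_comp, etaPowComp_zero]
    exact SPDO.ext fun k => one_mul _
  have h2 : etaPowComp m (etaPowComp 1 (monomial (1 : SuperFun 𝕜) 0)) =
      etaPowComp (m + 1) (monomial 1 0) := by
    have hm : ∀ n : ℤ, etaPowComp n (monomial (1 : SuperFun 𝕜) 0) = monomial 1 n := fun n => by
      apply SPDO.ext
      intro p
      rw [coeff_etaPowComp, etaPowCoeff_eq_sum (ordLE_monomial 1 0)
        (K := (n - p + 1).toNat + 1) (by push_cast; omega), coeff_monomial,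
        Finset.sum_range_succ', Finset.sum_eq_zero, zero_add, superBinom_zero, coeff_monomial]
      · have : sigma (1 : SuperFun 𝕜) = 1 := by apply SuperFun.ext <;> simp
        split_ifs <;> first | omega | simp [sigmaPow, this]
      · intro k _
        rw [coeff_monomial]
        split_ifs with hk
        · have : sigmaPow (n - (k + 1 : ℕ)) (1 : SuperFun 𝕜) = 1 := by
            have : sigma (1 : SuperFun 𝕜) = 1 := by apply SuperFun.ext <;> simp
            simp [sigmaPow, this]
          rw [this, Function.iterate_succ_apply]
          have : eta (1 : SuperFun 𝕜) = 0 := by apply SuperFun.ext <;> simp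
          rw [this, iterate_eta_zero, smul_zero]
        · rw [sigmaPow_zero, iterate_eta_zero, smul_zero]
    have e : ∀ n : ℤ, comp (monomial (1 : SuperFun 𝕜) n) = etaPowComp n := fun n => by
      funext X
      rw [monomial_comp]
      exact SPDO.ext fun k => one_mul _
    rw [hm, hm, ← e]
    apply SPDO.ext
    intro p
    rw [e, ← hm 1, coeff_etaPowComp]
    have hK : (1 : ℤ) < p - m + (((1 - p + m + 1).toNat + 1 : ℕ) : ℤ) := by push_cast; omega
    rw [hm 1, etaPowCoeff_eq_sum (ordLE_monomial 1 1) hK,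
        Finset.sum_range_succ', Finset.sum_eq_zero, zero_add, superBinom_zero, coeff_monomial,
        coeff_monomial]
    · have : sigma (1 : SuperFun 𝕜) = 1 := by apply SuperFun.ext <;> simp
      split_ifs <;> first | omega | simp [sigmaPow, this]
    · intro k _
      rw [coeff_monomial]
      split_ifs with hk
      · have : sigmaPow (m - (k + 1 : ℕ)) (1 : SuperFun 𝕜) = 1 := by
          have : sigma (1 : SuperFun 𝕜) = 1 := by apply SuperFun.ext <;> simp
          simp [sigmaPow, this]
        rw [this, Function.iterate_succ_apply]
        have : eta (1 : SuperFun 𝕜) = 0 := by apply SuperFun.ext <;> simp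
        rw [this, iterate_eta_zero, smul_zero]
      · rw [sigmaPow_zero, iterate_eta_zero, smul_zero]
  rw [h2, etaPowComp_comp, etaPowComp_comp, h1, etaPowComp_one] at h
  exact h.symm

theorem sum_range_two_mul {M : Type*} [AddCommMonoid M] (F : ℕ → M) (n : ℕ) :
    ∑ k ∈ Finset.range (2 * n), F k = ∑ j ∈ Finset.range n, (F (2 * j) + F (2 * j + 1)) := by
  induction n with
  | zero => simp
  | succ n ih =>
    rw [Finset.sum_range_succ, ← ih, mul_add, mul_one, Finset.sum_range_succ,
      Finset.sum_range_succ, add_assoc]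

theorem superBinom_even_odd (m : ℤ) (j : ℕ) : superBinom (2 * m) (2 * j + 1) = 0 := by
  unfold superBinom
  rw [if_neg]
  rintro (h | h)
  · exact Nat.not_even_iff_odd.2 ⟨j, rfl⟩ h
  · exact Int.not_odd_iff_even.2 ⟨m, by ring⟩ h

theorem superBinom_even_even (m : ℤ) (j : ℕ) :
    superBinom (2 * m) (2 * j) = Ring.choose m j := by
  unfold superBinom
  rw [if_pos (Or.inl ⟨j, by ring⟩)]
  congr 1 <;> omega

/-- Over an even exponent the odd super binomials vanish and the even ones are ordinary, as befits
η^(2m) = ∂_x^m. In applications `e` is 0 or 1 and selects the coefficients of even or odd index. -/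
theorem fst_etaPowCoeff_even (m : ℤ) (Q : SPDO 𝕜) (p e : ℤ) :
    (etaPowCoeff (2 * m) Q (2 * p + e)).fst =
      xiPowCoeff m (fun k => (coeff Q (2 * k + e)).fst) p := by
  obtain ⟨N, hN⟩ := exists_ordLE Q
  have hv : ∀ k, |N| + |e| < k → (coeff Q (2 * k + e)).fst = 0 := fun k hk => by
    have h1 := le_abs_self N
    have h2 := neg_abs_le e
    have h3 := abs_nonneg N
    have h4 := abs_nonneg e
    rw [hN _ (by omega), TrivSqZeroExt.fst_zero]
  set K := (|N| + |e| - p + m + 1).toNat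
  have hK : |N| + |e| < p - m + (K : ℤ) := by omega
  have hK2 : N < 2 * p + e - 2 * m + ((2 * K : ℕ) : ℤ) := by
    have h1 := le_abs_self N
    have h2 := neg_abs_le e
    have h3 := abs_nonneg N
    have h4 := abs_nonneg e
    push_cast
    omega
  rw [xiPowCoeff_eq_sum hv hK, etaPowCoeff_eq_sum hN hK2, sum_range_two_mul, TrivSqZeroExt.fst_sum]
  refine Finset.sum_congr rfl fun j _ => ?_
  rw [superBinom_even_odd, zero_smul, add_zero, superBinom_even_even, TrivSqZeroExt.fst_smul,
    iterate_eta_even, fst_mkFun, sigmaPow_even ⟨m - j, by push_cast; ring⟩]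
  rw [show 2 * p + e - 2 * m + ((2 * j : ℕ) : ℤ) = 2 * (p - m + j) + e by push_cast; ring]

theorem finsum_int_even_odd {M : Type*} [AddCommMonoid M] {F : ℤ → M}
    (h : (Function.support F).Finite) :
    ∑ᶠ m, F m = ∑ᶠ m, F (2 * m) + ∑ᶠ m, F (2 * m + 1) := by
  have i0 : Function.Injective fun m : ℤ => 2 * m := fun a b h => by simpa using h
  have i1 : Function.Injective fun m : ℤ => 2 * m + 1 := fun a b h => by simpa using h
  have hu : (Set.univ : Set ℤ) = Set.range (fun m : ℤ => 2 * m) ∪ Set.range fun m : ℤ => 2 * m + 1 := by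
    ext x
    rcases Int.even_or_odd' x with ⟨n, rfl | rfl⟩ <;> simp
  have hd : Disjoint (Set.range fun m : ℤ => 2 * m) (Set.range fun m : ℤ => 2 * m + 1) := by
    rw [Set.disjoint_left]
    rintro _ ⟨a, rfl⟩ ⟨b, hb⟩
    simp only at hb
    omega
  rw [← finsum_mem_univ, hu, finsum_mem_union' hd (h.subset Set.inter_subset_right)
    (h.subset Set.inter_subset_right), finsum_mem_range i0, finsum_mem_range i1]

/-- Even powers of η in `P` act on `Q` as powers of ∂_x, and odd powers η^(2m) ∘ η act as powers of
∂_x on η ∘ Q. This is the first row of a matrix product, the second row of `Q` being the first row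
of η ∘ Q. -/
theorem fst_coeff_comp (P Q : SPDO 𝕜) (p e : ℤ) : (coeff (comp P Q) (2 * p + e)).fst =
    star (blkA P) (fun k => (coeff Q (2 * k + e)).fst) p +
    star (blkB P) (fun k => (coeff (etaComp Q) (2 * k + e)).fst) p := by
  obtain ⟨M, hM⟩ := exists_ordLE P
  have hf := mul_etaPowCoeff_support_finite hM Q (2 * p + e)
  have h1 : (coeff (comp P Q) (2 * p + e)).fst =
      ∑ᶠ m, (coeff P m).fst * (etaPowCoeff m Q (2 * p + e)).fst := by
    rw [coeff_comp]
    exact (TrivSqZeroExt.fstHom 𝕜 (CircleFun 𝕜) (CircleFun 𝕜)).toAddMonoidHom.map_finsum hf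
  rw [h1, finsum_int_even_odd]
  · congr 1
    · refine finsum_congr fun m => ?_
      rw [fst_etaPowCoeff_even]
      rfl
    · refine finsum_congr fun m => ?_
      rw [← fst_etaPowCoeff_even, ← coeff_etaPowComp (2 * m + 1), ← etaPowComp_etaComp]
      rfl
  · refine hf.subset fun m hm h => hm ?_
    simp only at h ⊢
    rw [← SuperFun.fst_mul, h, TrivSqZeroExt.fst_zero]

theorem blkA_comp (P Q : SPDO 𝕜) (p : ℤ) :
    blkA (comp P Q) p = star (blkA P) (blkA Q) p + star (blkB P) (blkC Q) p := by
  have := fst_coeff_comp P Q p 0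
  simp only [add_zero] at this
  exact this

theorem blkB_comp (P Q : SPDO 𝕜) (p : ℤ) :
    blkB (comp P Q) p = star (blkA P) (blkB Q) p + star (blkB P) (blkD Q) p :=
  fst_coeff_comp P Q p 1

theorem blkC_comp (P Q : SPDO 𝕜) (p : ℤ) :
    blkC (comp P Q) p = star (blkC P) (blkA Q) p + star (blkD P) (blkC Q) p := by
  rw [blkC, ← etaComp_comp, blkA_comp]
  rfl

theorem blkD_comp (P Q : SPDO 𝕜) (p : ℤ) :
    blkD (comp P Q) p = star (blkC P) (blkB Q) p + star (blkD P) (blkD Q) p := by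
  rw [blkD, ← etaComp_comp, blkB_comp]
  rfl

theorem star_zero_left (v : ℤ → CircleFun 𝕜) (p : ℤ) : star 0 v p = 0 := by
  simp [star]

theorem parity_etaComp (P : SPDO 𝕜) : parity (etaComp P) = -etaComp (parity P) := by
  have h := parity_comp (monomial (1 : SuperFun 𝕜) 1) P
  have e : ∀ X : SPDO 𝕜, comp (monomial (1 : SuperFun 𝕜) 1) X = etaComp X := fun X => by
    rw [monomial_comp, etaPowComp_one]
    exact SPDO.ext fun k => one_mul _
  have hp : parity (monomial (1 : SuperFun 𝕜) 1) = -monomial 1 1 := by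
    have : sigma (1 : SuperFun 𝕜) = 1 := by apply SuperFun.ext <;> simp
    apply SPDO.ext
    intro k
    rw [coeff_parity, coeff_neg, coeff_monomial]
    by_cases hk : k = 1
    · subst hk
      simp [this]
    · simp [hk]
  rwa [e, hp, neg_comp, e] at h

theorem blkC_of_even {P : SPDO 𝕜} (hP : parity P = P) : blkC P = 0 :=
  blkA_of_odd (by rw [parity_etaComp, hP])

theorem blkD_of_odd {P : SPDO 𝕜} (hP : parity P = -P) : blkD P = 0 := by
  have h0 : etaComp (-P) = -etaComp P := by
    have := etaComp_sub 0 P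
    have e0 : etaComp (0 : SPDO 𝕜) = 0 := by
      apply SPDO.ext; intro k; simp [coeff_etaComp]
    rwa [zero_sub, e0, zero_sub] at this
  exact blkB_of_even (by rw [parity_etaComp, hP, h0, neg_neg])

/-! ### Differential operators on the circle -/

/-- Differential operators `f ↦ ∑_{i < N} a_i f^{(i)}` on the circle. -/
def IsDiffOp (φ : CircleFun 𝕜 → CircleFun 𝕜) : Prop :=
  ∃ (N : ℕ) (a : ℕ → CircleFun 𝕜), ∀ f, φ f = ∑ i ∈ Finset.range N, a i * ddx^[i] f

theorem isDiffOp_of_le {φ : CircleFun 𝕜 → CircleFun 𝕜} {N : ℕ} {a : ℕ → CircleFun 𝕜}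
    (h : ∀ f, φ f = ∑ i ∈ Finset.range N, a i * ddx^[i] f) {M : ℕ} (hM : N ≤ M) :
    ∀ f, φ f = ∑ i ∈ Finset.range M, (if i < N then a i else 0) * ddx^[i] f := by
  intro f
  rw [h f, ← Finset.sum_subset (Finset.range_mono hM)]
  · exact Finset.sum_congr rfl fun i hi => by rw [if_pos (Finset.mem_range.1 hi)]
  · intro i _ hi
    rw [if_neg (by simpa using hi), zero_mul]

theorem isDiffOp_zero : IsDiffOp (fun _ : CircleFun 𝕜 => 0) := ⟨0, 0, fun f => by simp⟩

theorem isDiffOp_id : IsDiffOp (fun f : CircleFun 𝕜 => f) := ⟨1, fun _ => 1, fun f => by simp⟩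

theorem isDiffOp_add {φ ψ : CircleFun 𝕜 → CircleFun 𝕜} (hφ : IsDiffOp φ) (hψ : IsDiffOp ψ) :
    IsDiffOp fun f => φ f + ψ f := by
  obtain ⟨N, a, h⟩ := hφ
  obtain ⟨M, b, h'⟩ := hψ
  refine ⟨max N M, fun i => (if i < N then a i else 0) + (if i < M then b i else 0), fun f => ?_⟩
  beta_reduce
  rw [isDiffOp_of_le h (le_max_left N M), isDiffOp_of_le h' (le_max_right N M),
    ← Finset.sum_add_distrib]
  exact Finset.sum_congr rfl fun i _ => (add_mul _ _ _).symm

theorem isDiffOp_mul {φ : CircleFun 𝕜 → CircleFun 𝕜} (g : CircleFun 𝕜) (hφ : IsDiffOp φ) :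
    IsDiffOp fun f => g * φ f := by
  obtain ⟨N, a, h⟩ := hφ
  refine ⟨N, fun i => g * a i, fun f => ?_⟩
  beta_reduce
  rw [h, Finset.mul_sum]
  exact Finset.sum_congr rfl fun i _ => (mul_assoc _ _ _).symm

theorem isDiffOp_smul {φ : CircleFun 𝕜 → CircleFun 𝕜} (r : 𝕜) (hφ : IsDiffOp φ) :
    IsDiffOp fun f => r • φ f := by
  simpa only [Algebra.smul_def] using isDiffOp_mul (algebraMap 𝕜 (CircleFun 𝕜) r) hφ

theorem isDiffOp_neg {φ : CircleFun 𝕜 → CircleFun 𝕜} (hφ : IsDiffOp φ) :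
    IsDiffOp fun f => -φ f := by
  simpa using isDiffOp_smul (-1 : 𝕜) hφ

theorem isDiffOp_sub {φ ψ : CircleFun 𝕜 → CircleFun 𝕜} (hφ : IsDiffOp φ) (hψ : IsDiffOp ψ) :
    IsDiffOp fun f => φ f - ψ f := by
  simpa only [sub_eq_add_neg] using isDiffOp_add hφ (isDiffOp_neg hψ)

theorem isDiffOp_sum {ι : Type*} {s : Finset ι} {φ : ι → CircleFun 𝕜 → CircleFun 𝕜}
    (h : ∀ i ∈ s, IsDiffOp (φ i)) : IsDiffOp fun f => ∑ i ∈ s, φ i f := by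
  classical
  induction s using Finset.induction_on with
  | empty => simpa using isDiffOp_zero
  | insert i s hi ih =>
    simp only [Finset.sum_insert hi]
    exact isDiffOp_add (h i (Finset.mem_insert_self i s))
      (ih fun j hj => h j (Finset.mem_insert_of_mem hj))

theorem isDiffOp_mul_iterate (a : CircleFun 𝕜) (i : ℕ) : IsDiffOp fun f => a * ddx^[i] f :=
  isDiffOp_mul a ⟨i + 1, fun j => if j = i then 1 else 0, fun f => by
    rw [Finset.sum_range_succ, Finset.sum_eq_zero, zero_add]
    · simp
    intro j hj
    beta_reduce
    rw [if_neg (Finset.mem_range.1 hj).ne, zero_mul]⟩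

theorem isDiffOp_ddx {φ : CircleFun 𝕜 → CircleFun 𝕜} (hφ : IsDiffOp φ) :
    IsDiffOp fun f => ddx (φ f) := by
  obtain ⟨N, a, h⟩ := hφ
  have : (fun f => ddx (φ f)) =
      fun f => ∑ i ∈ Finset.range N, (ddx (a i) * ddx^[i] f + a i * ddx^[i + 1] f) := by
    funext f
    rw [h, ← ddxL_apply, map_sum]
    refine Finset.sum_congr rfl fun i _ => ?_
    rw [ddxL_apply, ddx_mul, Function.iterate_succ_apply']
  rw [this]
  exact isDiffOp_sum fun i _ => isDiffOp_add (isDiffOp_mul_iterate _ _) (isDiffOp_mul_iterate _ _)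

theorem evalAt_iterate_locMon (n i : ℕ) (x : ℝ) :
    evalAt 𝕜 x (ddx^[i] (locMon n x)) = if i = n then 1 else 0 := iterate_ddx_locMon n i x

theorem evalAt_locMon (n : ℕ) (x : ℝ) :
    evalAt 𝕜 x (locMon n x) = if n = 0 then 1 else 0 := locMon_apply n x

theorem evalAt_diffOp_congr {φ : CircleFun 𝕜 → CircleFun 𝕜} (hφ : IsDiffOp φ) {x : ℝ}
    {f g : CircleFun 𝕜} (h : GermEq x f g) : evalAt 𝕜 x (φ f) = evalAt 𝕜 x (φ g) := by
  obtain ⟨N, a, ha⟩ := hφ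
  rw [ha, ha, map_sum, map_sum]
  refine Finset.sum_congr rfl fun i _ => ?_
  rw [evalAt_mul, evalAt_mul]
  congr 1
  exact (h.iterate_ddx i).apply_eq

/-! ### Reading off the coefficients of a differential operator. -/

section Symbol

variable {φ : CircleFun 𝕜 → CircleFun 𝕜} {N : ℕ} {a : ℕ → CircleFun 𝕜}

theorem evalAt_diffOp_locMon (h : ∀ f, φ f = ∑ i ∈ Finset.range N, a i * ddx^[i] f) (p : ℕ)
    (x : ℝ) : evalAt 𝕜 x (φ (locMon p x)) = if p < N then evalAt 𝕜 x (a p) else 0 := by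
  rw [h, map_sum]
  simp only [evalAt_mul, evalAt_iterate_locMon, mul_ite, mul_one, mul_zero, Finset.sum_ite_eq',
    Finset.mem_range]

/-- The commutator of d/dx with a differential operator only differentiates the coefficients. This
is used both to compute derivatives at a point and to show that invariant operators have constant
coefficients. -/
theorem ddx_diffOp (h : ∀ f, φ f = ∑ i ∈ Finset.range N, a i * ddx^[i] f) (f : CircleFun 𝕜) :
    ddx (φ f) = ∑ i ∈ Finset.range N, ddx (a i) * ddx^[i] f + φ (ddx f) := by
  rw [h, h, ← ddxL_apply, map_sum, ← Finset.sum_add_distrib]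
  refine Finset.sum_congr rfl fun i _ => ?_
  rw [ddxL_apply, ddx_mul, ← Function.iterate_succ_apply, Function.iterate_succ_apply']

theorem evalAt_ddx_diffOp_locMon_succ (h : ∀ f, φ f = ∑ i ∈ Finset.range N, a i * ddx^[i] f)
    (p : ℕ) (x : ℝ) : evalAt 𝕜 x (ddx (φ (locMon (p + 1) x))) =
      (if p + 1 < N then evalAt 𝕜 x (ddx (a (p + 1))) else 0) +
        if p < N then evalAt 𝕜 x (a p) else 0 := by
  rw [ddx_diffOp h, map_add, evalAt_diffOp_congr ⟨N, a, h⟩ (ddx_locMon_succ p x),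
    evalAt_diffOp_locMon h, map_sum]
  simp only [evalAt_mul, evalAt_iterate_locMon, mul_ite, mul_one, mul_zero, Finset.sum_ite_eq',
    Finset.mem_range]

theorem evalAt_ddx_diffOp_locMon_zero (h : ∀ f, φ f = ∑ i ∈ Finset.range N, a i * ddx^[i] f)
    (x : ℝ) : evalAt 𝕜 x (ddx (φ (locMon 0 x))) =
      if 0 < N then evalAt 𝕜 x (ddx (a 0)) else 0 := by
  rw [ddx_diffOp h, map_add, evalAt_diffOp_congr ⟨N, a, h⟩ (ddx_locMon_zero x), map_sum]
  have : φ 0 = 0 := by simp [h]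
  rw [this, map_zero, add_zero]
  simp only [evalAt_mul, evalAt_iterate_locMon, mul_ite, mul_one, mul_zero, Finset.sum_ite_eq',
    Finset.mem_range]

end Symbol

theorem isDiffOp_map_zero {φ : CircleFun 𝕜 → CircleFun 𝕜} (hφ : IsDiffOp φ) : φ 0 = 0 := by
  obtain ⟨N, a, h⟩ := hφ
  simp [h]

theorem isDiffOp_map_smul {φ : CircleFun 𝕜 → CircleFun 𝕜} (hφ : IsDiffOp φ) (r : 𝕜)
    (f : CircleFun 𝕜) : φ (r • f) = r • φ f := by
  obtain ⟨N, a, h⟩ := hφ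
  rw [h, h, Finset.smul_sum]
  exact Finset.sum_congr rfl fun i _ => by rw [iterate_ddx_smul, mul_smul_comm]

theorem isDiffOp_map_sub {φ : CircleFun 𝕜 → CircleFun 𝕜} (hφ : IsDiffOp φ)
    (f g : CircleFun 𝕜) : φ (f - g) = φ f - φ g := by
  obtain ⟨N, a, h⟩ := hφ
  rw [h, h, h, ← Finset.sum_sub_distrib]
  exact Finset.sum_congr rfl fun i _ => by rw [iterate_ddx_sub, mul_sub]

/-- A nonzero differential operator has a nonzero leading coefficient. -/
theorem IsDiffOp.exists_top {φ : CircleFun 𝕜 → CircleFun 𝕜} (hφ : IsDiffOp φ)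
    (h0 : ∃ f, φ f ≠ 0) : ∃ (n : ℕ) (a : ℕ → CircleFun 𝕜),
      (∀ f, φ f = ∑ i ∈ Finset.range (n + 1), a i * ddx^[i] f) ∧ a n ≠ 0 := by
  obtain ⟨N, a, h⟩ := hφ
  induction N with
  | zero =>
    obtain ⟨f, hf⟩ := h0
    simp [h] at hf
  | succ n ih =>
    by_cases ha : a n = 0
    · refine ih fun f => ?_
      rw [h, Finset.sum_range_succ, ha, zero_mul, add_zero]
    · exact ⟨n, a, h, ha⟩

theorem exists_evalAt_ne_zero {f : CircleFun 𝕜} (hf : f ≠ 0) : ∃ x, evalAt 𝕜 x f ≠ 0 := by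
  by_contra! h
  exact hf (ext_evalAt fun x => by rw [h x, map_zero])

/-- A differential operator whose values commute for the Poisson bracket of the highest symbols
vanishes. -/
theorem IsDiffOp.eq_zero_of_mul_ddx {φ : CircleFun 𝕜 → CircleFun 𝕜} (hφ : IsDiffOp φ)
    (h : ∀ f g, φ f * ddx (φ g) = ddx (φ f) * φ g) (f : CircleFun 𝕜) : φ f = 0 := by
  by_contra hf
  obtain ⟨n, a, ha, hn⟩ := hφ.exists_top ⟨f, hf⟩
  obtain ⟨x, hx⟩ := exists_evalAt_ne_zero hn
  -- For local monomials of degrees n + 1 and n, the image of the first vanishes at x, while its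
  -- derivative and the image of the second both equal a_n(x). The relation becomes a_n(x)² = 0.
  have := congrArg (evalAt 𝕜 x) (h (locMon (n + 1) x) (locMon n x))
  rw [evalAt_mul, evalAt_mul, evalAt_diffOp_locMon ha, evalAt_diffOp_locMon ha,
    evalAt_ddx_diffOp_locMon_succ ha, if_neg (by omega), if_neg (by omega), if_pos (by omega)] at this
  simp [hx] at this

/-- Local monomials are closed, up to scalars, under f g' - r f' g. The case r = 1 is the bracket of
vector fields and r = 1/2 the action on odd fields. -/
theorem germEq_vect_locMon (p q : ℕ) (r : 𝕜) (x : ℝ) :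
    GermEq x ((locMon (p + 1) x : CircleFun 𝕜) * ddx (locMon (q + 1) x) - r • (ddx (locMon (p + 1) x) *
      locMon (q + 1) x))
      ((((p + 1 + q).choose (p + 1) : 𝕜) - r * ((p + (q + 1)).choose p : 𝕜)) •
        locMon (p + q + 1) x) := by
  have h1 : GermEq x (locMon (p + 1) x * ddx (locMon (q + 1) x) : CircleFun 𝕜) _ :=
    ((GermEq.refl x (locMon (p + 1) x)).mul (ddx_locMon_succ q x)).trans (locMon_mul _ _ x)
  have h2 : GermEq x (ddx (locMon (p + 1) x) * locMon (q + 1) x : CircleFun 𝕜) _ :=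
    ((ddx_locMon_succ p x).mul (GermEq.refl x (locMon (q + 1) x))).trans (locMon_mul _ _ x)
  have h3 := h1.sub (h2.smul r)
  rw [sub_smul, mul_smul]
  rw [show p + 1 + q = p + q + 1 by ring, show p + (q + 1) = p + q + 1 by ring] at *
  exact h3

theorem germEq_locMon_one_vect (q : ℕ) (r : 𝕜) (x : ℝ) :
    GermEq x ((locMon 1 x : CircleFun 𝕜) * ddx (locMon q x) - r • (ddx (locMon 1 x) * locMon q x))
      (((q : 𝕜) - r) • locMon q x) := by
  cases q with
  | zero =>
    have h1 := (GermEq.refl x (locMon 1 x : CircleFun 𝕜)).mul (ddx_locMon_zero x)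
    have h2 := ((ddx_locMon_succ 0 x).mul (GermEq.refl x (locMon 0 x : CircleFun 𝕜))).trans
      (locMon_mul 0 0 x)
    have h3 := h1.sub (h2.smul r)
    refine h3.trans ?_
    simp [GermEq.refl]
  | succ q =>
    have := germEq_vect_locMon 0 q r x
    simpa [add_comm, Nat.choose_one_right] using this

/-- Differential operators `φ` with `φ(f g' - f' g) = φ(f) φ(g)' - φ(f)' φ(g)`. -/
theorem IsDiffOp.eq_mul_of_vect {φ : CircleFun 𝕜 → CircleFun 𝕜} (hφ : IsDiffOp φ)
    (h : ∀ f g, φ (f * ddx g - ddx f * g) = φ f * ddx (φ g) - ddx (φ f) * φ g) :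
    ∃ a : 𝕜, (a = 0 ∨ a = 1) ∧ ∀ f, φ f = a • f := by
  by_cases h0 : ∃ f, φ f ≠ 0
  swap
  · push Not at h0
    exact ⟨0, Or.inl rfl, fun f => by rw [h0, zero_smul]⟩
  obtain ⟨n, a, ha, hn⟩ := hφ.exists_top h0
  obtain ⟨x, hx⟩ := exists_evalAt_ne_zero hn
  have h1 : n = 0 := by
    by_contra hn0
    obtain ⟨m, rfl⟩ := Nat.exists_eq_succ_of_ne_zero hn0
    -- If n = m + 1 > 0, take degrees n and n + 1. Their bracket has degree 2n > n, so its image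
    -- vanishes at x, whereas the right side equals a_n(x)².
    have h2 := congrArg (evalAt 𝕜 x) (h (locMon (m + 1) x) (locMon (m + 2) x))
    have h3 := germEq_vect_locMon (𝕜 := 𝕜) m (m + 1) 1 x
    rw [one_smul] at h3
    rw [evalAt_diffOp_congr hφ h3, isDiffOp_map_smul hφ, map_smul, evalAt_diffOp_locMon ha,
      if_neg (by omega), smul_zero, map_sub, evalAt_mul, evalAt_mul, evalAt_diffOp_locMon ha,
      evalAt_diffOp_locMon ha, evalAt_ddx_diffOp_locMon_succ ha, if_pos (by omega),
      if_neg (by omega), if_neg (by omega)] at h2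
    simp only [zero_add, mul_zero, sub_zero] at h2
    exact hx (mul_self_eq_zero.1 h2.symm)
  subst h1
  have hb : ∀ f, φ f = a 0 * f := fun f => by rw [ha]; simp
  have hsq : a 0 * a 0 = a 0 := by
    refine ext_evalAt fun y => ?_
    have h2 := congrArg (evalAt 𝕜 y) (h 1 (locMon 1 y))
    have h3 : evalAt 𝕜 y (ddx (locMon 1 y)) = 1 := by
      have := evalAt_iterate_locMon (𝕜 := 𝕜) 1 1 y
      simpa using this
    rw [ddx_one, zero_mul, sub_zero, one_mul, hb, hb, hb, mul_one, ddx_mul, map_sub, evalAt_mul,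
      evalAt_mul, evalAt_mul, map_add, evalAt_mul, evalAt_mul, evalAt_mul, h3, evalAt_locMon,
      if_neg one_ne_zero] at h2
    rw [evalAt_mul]
    linear_combination -h2
  have hd : ddx (a 0) = 0 := by
    have h2 := congrArg ddx hsq
    rw [ddx_mul] at h2
    -- Differentiating a₀² = a₀ gives (2a₀ - 1) a₀' = 0, and (2a₀ - 1)² = 1.
    linear_combination (2 * a 0 - 1) * h2 - 4 * ddx (a 0) * hsq
  have h3 := eq_algebraMap_of_ddx_eq_zero hd
  refine ⟨(a 0 : ℝ → 𝕜) 0, ?_, fun f => ?_⟩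
  · have h4 := congrArg (evalAt 𝕜 0) hsq
    rw [evalAt_mul, evalAt_apply] at h4
    have h5 : (a 0 : ℝ → 𝕜) 0 * ((a 0 : ℝ → 𝕜) 0 - 1) = 0 := by rw [mul_sub, h4]; ring
    rcases mul_eq_zero.1 h5 with h | h
    · exact Or.inl h
    · exact Or.inr (sub_eq_zero.1 h)
  · rw [hb, Algebra.smul_def, ← h3]

/-- Solutions of a homogeneous linear equation on the circle vanish nowhere. -/
theorem evalAt_ne_zero_of_ddx_eq {a w : CircleFun 𝕜} (h : ddx a = w * a) (ha : a ≠ 0) (x : ℝ) :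
    evalAt 𝕜 x a ≠ 0 := by
  intro hx
  obtain ⟨y, hy⟩ := exists_evalAt_ne_zero ha
  -- The Grönwall estimate propagates the zero forward from `x`, so `y` is replaced by a later point
  -- congruent to it modulo 2π.
  obtain ⟨k, hk⟩ : ∃ k : ℕ, x - y < k * (2 * Real.pi) := by
    obtain ⟨k, hk⟩ := exists_nat_gt ((x - y) / (2 * Real.pi))
    exact ⟨k, (div_lt_iff₀ (by positivity)).1 hk⟩
  have hp : (a : ℝ → 𝕜) (y + k * (2 * Real.pi)) = (a : ℝ → 𝕜) y := by
    have := a.2.2.nat_mul k y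
    simpa using this
  set b := y + k * (2 * Real.pi) with hb
  have hcont : Continuous (w : ℝ → 𝕜) := w.2.1.continuous
  obtain ⟨K, hK⟩ := (isCompact_Icc (a := x) (b := b)).exists_bound_of_continuousOn
    hcont.continuousOn
  have := eq_zero_of_abs_deriv_le_mul_abs_self_of_eq_zero_right (f := (a : ℝ → 𝕜))
    (f' := (ddx a : ℝ → 𝕜)) (K := K) (a := x) (b := b) a.2.1.continuous.continuousOn
    (fun z _ => (differentiable_circleFun a z).hasDerivAt.hasDerivWithinAt) hx
    (fun z hz => by
      rw [h]
      change ‖(w : ℝ → 𝕜) z * (a : ℝ → 𝕜) z‖ ≤ _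
      rw [norm_mul]
      exact mul_le_mul_of_nonneg_right (hK z ⟨hz.1, hz.2.le⟩) (norm_nonneg _))
    b ⟨by linarith, le_rfl⟩
  rw [hp] at this
  exact hy this

/-- Intertwining differential operators
`φ(f h' - ½ f' h) = f φ(h)' - r f' φ(h) + τ(f) φ(h)` determine `τ`. -/
theorem IsDiffOp.intertwiner {φ τ : CircleFun 𝕜 → CircleFun 𝕜} (hφ : IsDiffOp φ)
    (ht : IsDiffOp τ) (r : 𝕜) (h : ∀ f g, φ (f * ddx g - (1 / 2 : 𝕜) • (ddx f * g)) =
      f * ddx (φ g) - r • (ddx f * φ g) + τ f * φ g) (h0 : ∃ f, φ f ≠ 0) :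
    ∃ (n : ℕ) (a : ℕ → CircleFun 𝕜),
      (∀ f, φ f = ∑ i ∈ Finset.range (n + 1), a i * ddx^[i] f) ∧ (∀ x, evalAt 𝕜 x (a n) ≠ 0) ∧
      ∀ f, τ f = τ 1 * f + ((n : 𝕜) + r - 1 / 2) • ddx f := by
  obtain ⟨n, a, ha, hn⟩ := hφ.exists_top h0
  -- The choice f = 1 with a monomial of degree n gives a_n' = -τ(1) a_n, so the leading
  -- coefficient, being nonzero somewhere, vanishes nowhere.
  have hne : ∀ x, evalAt 𝕜 x (a n) ≠ 0 := by
    refine evalAt_ne_zero_of_ddx_eq (w := -τ 1) (ext_evalAt fun x => ?_) hn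
    have h1 := congrArg (evalAt 𝕜 x) (h 1 (locMon n x))
    rw [ddx_one, zero_mul, smul_zero, sub_zero, zero_mul, smul_zero, sub_zero, one_mul, one_mul, map_add, evalAt_mul, evalAt_diffOp_locMon ha, if_pos (by omega)] at h1
    rw [evalAt_mul, map_neg]
    cases n with
    | zero =>
      rw [evalAt_diffOp_congr hφ (ddx_locMon_zero x), isDiffOp_map_zero hφ, map_zero,
        evalAt_ddx_diffOp_locMon_zero ha, if_pos (by omega)] at h1
      linear_combination -h1
    | succ n =>
      rw [evalAt_diffOp_congr hφ (ddx_locMon_succ n x), evalAt_diffOp_locMon ha,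
        evalAt_ddx_diffOp_locMon_succ ha, if_pos (by omega), if_pos (by omega)] at h1
      linear_combination -h1
  refine ⟨n, a, ha, hne, ?_⟩
  -- The local Euler field multiplies the monomial of degree n by n - 1/2. Dividing by a_n(x) gives
  -- the value of τ on a local coordinate.
  have ht1 : ∀ x, evalAt 𝕜 x (τ (locMon 1 x)) = (n : 𝕜) + r - 1 / 2 := fun x => by
    have h1 := congrArg (evalAt 𝕜 x) (h (locMon 1 x) (locMon n x))
    have h3 : evalAt 𝕜 x (ddx (locMon 1 x)) = 1 := by
      have := evalAt_iterate_locMon (𝕜 := 𝕜) 1 1 x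
      simpa using this
    rw [evalAt_diffOp_congr hφ (germEq_locMon_one_vect n (1 / 2) x), isDiffOp_map_smul hφ,
      map_smul, evalAt_diffOp_locMon ha, if_pos (by omega), map_add, map_sub,
      map_smul, evalAt_mul, evalAt_mul, evalAt_mul, h3, evalAt_diffOp_locMon ha,
      if_pos (by omega), evalAt_locMon, if_neg (by omega), smul_eq_mul, smul_eq_mul] at h1
    apply mul_right_cancel₀ (hne x)
    linear_combination -h1
  -- If f vanishes to order p + 2, the argument of φ on the left has local degree n + p + 1 > n, or
  -- is killed for n = 0 likewise, and on the right only the term with τ(f) survives. Thus τ has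
  -- order at most one.
  have ht2 : ∀ p x, evalAt 𝕜 x (τ (locMon (p + 2) x)) = 0 := fun p x => by
    have h1 := congrArg (evalAt 𝕜 x) (h (locMon (p + 2) x) (locMon n x))
    have h3 : evalAt 𝕜 x (ddx (locMon (p + 2) x)) = 0 := by
      have := evalAt_iterate_locMon (𝕜 := 𝕜) (p + 2) 1 x
      simpa using this
    have h4 : evalAt 𝕜 x (φ (locMon (p + 2) x * ddx (locMon n x) -
        (1 / 2 : 𝕜) • (ddx (locMon (p + 2) x) * locMon n x))) = 0 := by
      cases n with
      | zero =>
        have e1 := (GermEq.refl x (locMon (p + 2) x : CircleFun 𝕜)).mul (ddx_locMon_zero x)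
        have e2 := ((ddx_locMon_succ (p + 1) x).mul
          (GermEq.refl x (locMon 0 x : CircleFun 𝕜))).trans (locMon_mul (p + 1) 0 x)
        have e3 := e1.sub (e2.smul (1 / 2 : 𝕜))
        rw [evalAt_diffOp_congr hφ e3, isDiffOp_map_sub hφ, isDiffOp_map_smul hφ, isDiffOp_map_smul hφ, mul_zero,
          isDiffOp_map_zero hφ, map_sub, map_smul, map_smul, evalAt_diffOp_locMon ha,
          if_neg (by omega)]
        simp
      | succ n =>
        rw [evalAt_diffOp_congr hφ (germEq_vect_locMon (p + 1) n (1 / 2) x), isDiffOp_map_smul hφ,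
          map_smul, evalAt_diffOp_locMon ha, if_neg (by omega), smul_zero]
    rw [h4, map_add, map_sub, map_smul, evalAt_mul, evalAt_mul, evalAt_mul, h3,
      evalAt_diffOp_locMon ha, if_pos (by omega), evalAt_locMon, if_neg (by omega), zero_mul,
      zero_mul, smul_zero, sub_zero, zero_add] at h1
    exact (mul_eq_zero.1 h1.symm).resolve_right (hne x)
  obtain ⟨M, w, hw⟩ := ht
  have hw' : ∀ f, τ f = ∑ i ∈ Finset.range (M + 2), (if i < M then w i else 0) * ddx^[i] f :=
    isDiffOp_of_le hw (by omega)
  set w' : ℕ → CircleFun 𝕜 := fun i => if i < M then w i else 0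
  have k2 : ∀ i, i < M → w' (i + 2) = 0 := fun i hi => ext_evalAt fun x => by
    have := ht2 i x
    rw [evalAt_diffOp_locMon hw', if_pos (by omega)] at this
    rw [map_zero]; exact this
  have k1 : w' 1 = algebraMap 𝕜 (CircleFun 𝕜) ((n : 𝕜) + r - 1 / 2) := ext_evalAt fun x => by
    have := ht1 x
    rw [evalAt_diffOp_locMon hw', if_pos (by omega)] at this
    rw [evalAt_algebraMap]; exact this
  intro f
  have hf : ∀ f, τ f = w' 0 * f + w' 1 * ddx f := fun f => by
    rw [hw', Finset.sum_range_succ', Finset.sum_range_succ', Finset.sum_eq_zero]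
    · simp [w']; ring
    · intro i hi
      change w' (i + 2) * _ = 0
      rw [k2 i (Finset.mem_range.1 hi), zero_mul]
  rw [hf f, hf 1, ddx_one, mul_zero, add_zero, mul_one, k1, Algebra.smul_def]

/-! ### Homogeneous series of degree two -/

/-- The coefficient of `η^j` in the `i`-th term of the homogeneous series of degree two. -/
def homTerm (p : ℕ → 𝕜) (F : SuperFun 𝕜) (j : ℤ) (i : ℕ) : SuperFun 𝕜 :=
  p i • (sigmaPow (i - 2) (etaBar^[i] F) * etaBarPow (2 - i) j)

theorem etaBarPow_eq_zero_of_ne {m j : ℤ} (h1 : j ≠ m) (h2 : ¬(Odd m ∧ j = m + 1)) :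
    etaBarPow (𝕜 := 𝕜) m j = 0 := by
  unfold etaBarPow
  rw [if_neg h1, if_neg h2, add_zero, smul_zero]

theorem homTerm_eq_zero (p : ℕ → 𝕜) (F : SuperFun 𝕜) (j : ℤ) (i : ℕ) (h1 : 2 - (i : ℤ) ≠ j)
    (h2 : 3 - (i : ℤ) ≠ j) : homTerm p F j i = 0 := by
  unfold homTerm
  rw [etaBarPow_eq_zero_of_ne h1.symm (fun h => h2 (by omega)), mul_zero, smul_zero]

theorem coeff_homogeneousSeries_eq_sum (p : ℕ → 𝕜) (F : SuperFun 𝕜) {j : ℤ} {K : ℕ}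
    (hK : 3 - j < K) :
    coeff (homogeneousSeries 2 p F) j = ∑ i ∈ Finset.range K, homTerm p F j i := by
  refine finsum_eq_sum_of_support_subset _ fun i hi => ?_
  simp only [Finset.coe_range, Set.mem_Iio]
  by_contra h
  exact hi (homTerm_eq_zero p F j i (by omega) (by omega))

theorem ite_even_neg (n : ℕ) : (if Even (1 - (n : ℤ)) then (1 : 𝕜) else -1) = -(-1) ^ n := by
  rcases Nat.even_or_odd n with h | h
  · have : ¬ Even (1 - (n : ℤ)) := by
      rw [Int.even_sub]; simp [h]
    rw [if_neg this, h.neg_one_pow]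
  · have : Even (1 - (n : ℤ)) := by
      rw [Int.even_sub]; simp [Nat.not_even_iff_odd.2 h]
    rw [if_pos this, h.neg_one_pow, neg_neg]

theorem ite_even_neg' (n : ℕ) : (if Even (-(n : ℤ)) then (1 : 𝕜) else -1) = (-1) ^ n := by
  rcases Nat.even_or_odd n with h | h
  · rw [if_pos (by simpa using h), h.neg_one_pow]
  · rw [if_neg (by simpa using h), h.neg_one_pow]

theorem homTerm_even (p : ℕ → 𝕜) (F : SuperFun 𝕜) (n : ℕ) :
    homTerm p F (2 - 2 * n) (2 * n) =
      (-p (2 * n)) • mkFun (ddx^[n] F.fst) (ddx^[n] F.snd) := by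
  have e1 : Even (((2 * n : ℕ) : ℤ) - 2) := ⟨n - 1, by push_cast; ring⟩
  have e2 : ¬ Odd (2 - ((2 * n : ℕ) : ℤ)) := Int.not_odd_iff_even.2 ⟨1 - n, by push_cast; ring⟩
  have e3 : (2 - ((2 * n : ℕ) : ℤ)) / 2 = 1 - n := by omega
  unfold homTerm etaBarPow
  rw [sigmaPow_even e1, iterate_etaBar_even, e3, ite_even_neg, if_pos (by push_cast; ring),
    if_neg (by tauto), add_zero]
  rw [smul_mul_smul_comm, mul_one, smul_smul]
  congr 1
  have : ((-1 : 𝕜) ^ n) * (-1) ^ n = 1 := by rw [← mul_pow]; simp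
  linear_combination (-p (2 * n)) * this

theorem homTerm_odd (p : ℕ → 𝕜) (F : SuperFun 𝕜) (n : ℕ) (j : ℤ) :
    homTerm p F j (2 * n + 1) =
      p (2 * n + 1) • (mkFun (ddx^[n] F.snd) (ddx^[n + 1] F.fst) *
        ((if j = 1 - 2 * n then 1 else 0) + if j = 2 - 2 * n then (-2 : 𝕜) • theta else 0)) := by
  have e1 : Odd (((2 * n + 1 : ℕ) : ℤ) - 2) := ⟨n - 1, by push_cast; ring⟩
  have e2 : Odd (2 - ((2 * n + 1 : ℕ) : ℤ)) := ⟨-n, by push_cast; ring⟩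
  have e3 : (2 - ((2 * n + 1 : ℕ) : ℤ)) / 2 = -n := by omega
  unfold homTerm etaBarPow
  rw [sigmaPow_odd e1, iterate_etaBar_odd, e3, ite_even_neg', sigma_smul]
  have e4 : sigma (mkFun (ddx^[n] F.snd) (-ddx^[n + 1] F.fst)) =
      mkFun (ddx^[n] F.snd) (ddx^[n + 1] F.fst) := by
    apply SuperFun.ext <;> simp
  have e5 : (j = 2 - ((2 * n + 1 : ℕ) : ℤ)) = (j = 1 - 2 * n) := by
    apply propext; omega
  have e6 : (Odd (2 - ((2 * n + 1 : ℕ) : ℤ)) ∧ j = 2 - ((2 * n + 1 : ℕ) : ℤ) + 1) =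
      (j = 2 - 2 * n) := by
    apply propext
    rw [and_iff_right e2]
    omega
  rw [e4]
  simp only [e5, e6]
  rw [smul_mul_smul_comm]
  have : ((-1 : 𝕜) ^ n) * (-1) ^ n = 1 := by rw [← mul_pow]; simp
  rw [this, one_smul]

theorem coeff_homogeneousSeries_odd (p : ℕ → 𝕜) (F : SuperFun 𝕜) (n : ℕ) :
    coeff (homogeneousSeries 2 p F) (1 - 2 * n) =
      p (2 * n + 1) • mkFun (ddx^[n] F.snd) (ddx^[n + 1] F.fst) := by
  rw [coeff_homogeneousSeries_eq_sum p F (K := 2 * n + 3) (by push_cast; omega),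
    Finset.sum_eq_single (2 * n + 1), homTerm_odd, if_pos rfl, if_neg (by omega), add_zero, mul_one]
  · intro i _ hi
    by_cases h : i = 2 * n + 2
    · unfold homTerm
      rw [etaBarPow_eq_zero_of_ne (by push_cast [h]; omega), mul_zero, smul_zero]
      rintro ⟨h1, -⟩
      exact Int.not_even_iff_odd.2 h1 ⟨-n, by push_cast [h]; ring⟩
    · exact homTerm_eq_zero p F _ i (by omega) (by omega)
  · intro h
    simp at h

/-- Besides its own term, this coefficient receives the -2θ part of the odd power of η̄ with index
2n + 1; multiplication by θ keeps only the θ-free part of the accompanying function. -/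
theorem coeff_homogeneousSeries_even (p : ℕ → 𝕜) (F : SuperFun 𝕜) (n : ℕ) :
    coeff (homogeneousSeries 2 p F) (2 - 2 * n) =
      mkFun (-p (2 * n) • ddx^[n] F.fst) ((-p (2 * n) - 2 * p (2 * n + 1)) • ddx^[n] F.snd) := by
  rw [coeff_homogeneousSeries_eq_sum p F (K := 2 * n + 2) (by push_cast; omega),
    Finset.sum_range_succ, Finset.sum_range_succ, Finset.sum_eq_zero, homTerm_odd, homTerm_even,
    if_neg (by omega), if_pos rfl]
  · apply SuperFun.ext
    · simp
    · simp only [zero_add, TrivSqZeroExt.snd_add, TrivSqZeroExt.snd_smul, snd_mkFun,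
        SuperFun.snd_mul, fst_mkFun, snd_theta, fst_theta, TrivSqZeroExt.fst_smul, smul_zero,
        mul_zero, add_zero]
      rw [mul_smul_comm, mul_one, smul_smul]
      module
  · intro i hi
    rw [Finset.mem_range] at hi
    exact homTerm_eq_zero p F _ i (by omega) (by omega)

theorem coeff_homogeneousSeries_of_lt (p : ℕ → 𝕜) (F : SuperFun 𝕜) {j : ℤ} (hj : 2 < j) :
    coeff (homogeneousSeries 2 p F) j = 0 := by
  rw [coeff_homogeneousSeries_eq_sum p F (K := 1) (by push_cast; omega), Finset.sum_range_one]
  unfold homTerm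
  have h : ¬(Odd (2 - ((0 : ℕ) : ℤ)) ∧ j = 2 - ((0 : ℕ) : ℤ) + 1) := fun h =>
    Int.not_even_iff_odd.2 h.1 ⟨1, by norm_num⟩
  rw [etaBarPow_eq_zero_of_ne (by omega) h, mul_zero, smul_zero]

theorem int_trichotomy (j : ℤ) :
    2 < j ∨ (∃ n : ℕ, j = 2 - 2 * (n : ℤ)) ∨ ∃ n : ℕ, j = 1 - 2 * (n : ℤ) := by
  by_cases h : 2 < j
  · exact Or.inl h
  rcases Int.even_or_odd j with ⟨r, hr⟩ | ⟨r, hr⟩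
  · exact Or.inr (Or.inl ⟨(1 - r).toNat, by omega⟩)
  · exact Or.inr (Or.inr ⟨(-r).toNat, by omega⟩)

theorem homogeneousSeries_add (p q : ℕ → 𝕜) (F : SuperFun 𝕜) :
    homogeneousSeries 2 (p + q) F = homogeneousSeries 2 p F + homogeneousSeries 2 q F := by
  apply SPDO.ext
  intro j
  rw [coeff_add]
  rcases int_trichotomy j with h | ⟨n, rfl⟩ | ⟨n, rfl⟩
  · simp only [coeff_homogeneousSeries_of_lt _ F h, add_zero]
  · simp only [coeff_homogeneousSeries_even]
    apply SuperFun.ext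
    · simp only [Pi.add_apply, TrivSqZeroExt.fst_add, fst_mkFun]; module
    · simp only [Pi.add_apply, TrivSqZeroExt.snd_add, snd_mkFun]; module
  · simp only [coeff_homogeneousSeries_odd, Pi.add_apply, add_smul]

theorem homogeneousSeries_smul (r : 𝕜) (p : ℕ → 𝕜) (F : SuperFun 𝕜) :
    homogeneousSeries 2 (r • p) F = r • homogeneousSeries 2 p F := by
  apply SPDO.ext
  intro j
  rw [coeff_smul]
  rcases int_trichotomy j with h | ⟨n, rfl⟩ | ⟨n, rfl⟩
  · simp only [coeff_homogeneousSeries_of_lt _ F h, smul_zero]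
  · simp only [coeff_homogeneousSeries_even]
    apply SuperFun.ext
    · simp only [Pi.smul_apply, TrivSqZeroExt.fst_smul, fst_mkFun, smul_eq_mul]; module
    · simp only [Pi.smul_apply, TrivSqZeroExt.snd_smul, snd_mkFun, smul_eq_mul]; module
  · simp only [coeff_homogeneousSeries_odd, Pi.smul_apply, smul_smul, smul_eq_mul]

theorem parity_homogeneousSeries (p : ℕ → 𝕜) (F : SuperFun 𝕜) :
    parity (homogeneousSeries 2 p F) = homogeneousSeries 2 p (sigma F) := by
  apply SPDO.ext
  intro j
  rw [coeff_parity]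
  have hs : ∀ n, ddx^[n] (-F.snd) = -ddx^[n] F.snd := fun n => by
    rw [iterate_ddx_eq, map_neg, iterate_ddx_eq]
  rcases int_trichotomy j with h | ⟨n, rfl⟩ | ⟨n, rfl⟩
  · simp only [coeff_homogeneousSeries_of_lt _ _ h, sigma_zero, neg_zero, ite_self]
  · rw [if_pos ⟨1 - (n : ℤ), by ring⟩, coeff_homogeneousSeries_even, coeff_homogeneousSeries_even]
    apply SuperFun.ext <;> simp [hs]
  · rw [if_neg (Int.not_even_iff_odd.2 ⟨-(n : ℤ), by ring⟩), coeff_homogeneousSeries_odd,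
      coeff_homogeneousSeries_odd]
    apply SuperFun.ext <;> simp [hs]

/-! ### The standard embedding and the cocycles as homogeneous series. -/

/-- The coefficients of `ρ` as a homogeneous series. -/
def rhoSeq (𝕜 : Type*) [RCLike 𝕜] (i : ℕ) : 𝕜 := if i = 0 then -1 else if i = 1 then 1 / 2 else 0

/-- The coefficients of `Θ₁` as a homogeneous series. -/
def thetaSeq1 (𝕜 : Type*) [RCLike 𝕜] (i : ℕ) : 𝕜 := if i = 2 then -1 else 0

/-- The coefficients of `Θ₂` as a homogeneous series. -/
def thetaSeq2 (𝕜 : Type*) [RCLike 𝕜] (i : ℕ) : 𝕜 :=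
  if i < 3 then 0 else if Even i then
    (-1) ^ (i / 2 - 1) * ((((i / 2 - 1 : ℕ) : 𝕜) - 3) / ((i / 2 - 1 : ℕ) + 1))
  else (-1) ^ (i / 2) * ((((i / 2 : ℕ) : 𝕜) - 2) / (i / 2 : ℕ))

/-- The coefficients of `Θ₃` as a homogeneous series. -/
def thetaSeq3 (𝕜 : Type*) [RCLike 𝕜] (i : ℕ) : 𝕜 :=
  if i < 5 then 0 else if Even i then
    (-1) ^ (i / 2 - 1) * ((((i / 2 - 1 : ℕ) : 𝕜) - 1) / ((i / 2 - 1 : ℕ) + 1))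
  else (-1) ^ (i / 2) * ((((i / 2 : ℕ) : 𝕜) - 1) / (i / 2 : ℕ))

theorem coeff_rho_two (F : SuperFun 𝕜) : coeff (rho F) 2 = mkFun F.fst 0 := by
  change (if (2 : ℤ) = 2 then F else 0) + (1 / 2 : 𝕜) • (eta F * etaBarPow 1 2) = _
  unfold etaBarPow
  rw [if_pos rfl, if_pos (by decide), if_neg (by decide), if_pos (by decide)]
  apply SuperFun.ext
  · simp
  · simp

theorem coeff_rho_one (F : SuperFun 𝕜) : coeff (rho F) 1 = (1 / 2 : 𝕜) • eta F := by
  change (if (1 : ℤ) = 2 then F else 0) + (1 / 2 : 𝕜) • (eta F * etaBarPow 1 1) = _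
  unfold etaBarPow
  rw [if_neg (by decide), if_pos (by decide), if_pos (by decide), if_neg (by decide)]
  simp

theorem coeff_rho_of_ne (F : SuperFun 𝕜) {j : ℤ} (h2 : j ≠ 2) (h1 : j ≠ 1) :
    coeff (rho F) j = 0 := by
  change (if j = 2 then F else 0) + (1 / 2 : 𝕜) • (eta F * etaBarPow 1 j) = _
  rw [if_neg h2, etaBarPow_eq_zero_of_ne h1 (fun h => h2 (by omega)), mul_zero, smul_zero,
    add_zero]

theorem rho_eq_homogeneousSeries (F : SuperFun 𝕜) :
    rho F = homogeneousSeries 2 (rhoSeq 𝕜) F := by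
  apply SPDO.ext
  intro j
  rcases int_trichotomy j with h | ⟨n, rfl⟩ | ⟨n, rfl⟩
  · rw [coeff_homogeneousSeries_of_lt _ _ h, coeff_rho_of_ne F (by omega) (by omega)]
  · rw [coeff_homogeneousSeries_even]
    rcases n with _ | n
    · rw [show (2 : ℤ) - 2 * ((0 : ℕ) : ℤ) = 2 by simp, coeff_rho_two]
      apply SuperFun.ext <;> simp [rhoSeq]
    · rw [coeff_rho_of_ne F (by push_cast; omega) (by push_cast; omega)]
      apply SuperFun.ext <;> simp [rhoSeq]
  · rw [coeff_homogeneousSeries_odd]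
    rcases n with _ | n
    · rw [show (1 : ℤ) - 2 * ((0 : ℕ) : ℤ) = 1 by simp, coeff_rho_one]
      apply SuperFun.ext <;> simp [rhoSeq]
    · rw [coeff_rho_of_ne F (by push_cast; omega) (by push_cast; omega)]
      apply SuperFun.ext <;> simp [rhoSeq]

theorem Theta1_eq_homogeneousSeries (F : SuperFun 𝕜) :
    Theta1 F = homogeneousSeries 2 (thetaSeq1 𝕜) F := by
  apply SPDO.ext
  intro j
  change (if j = 0 then eta (eta F) else 0) = _
  rcases int_trichotomy j with h | ⟨n, rfl⟩ | ⟨n, rfl⟩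
  · rw [coeff_homogeneousSeries_of_lt _ _ h, if_neg (by omega)]
  · rw [coeff_homogeneousSeries_even]
    by_cases hn : n = 1
    · subst hn
      rw [if_pos (by norm_num), eta_eta]
      apply SuperFun.ext <;> simp [thetaSeq1]
    · rw [if_neg (by omega)]
      have h1 : 2 * n ≠ 2 := by omega
      have h2 : 2 * n + 1 ≠ 2 := by omega
      apply SuperFun.ext <;> simp [thetaSeq1, hn]
  · rw [coeff_homogeneousSeries_odd, if_neg (by omega)]
    have h2 : 2 * n + 1 ≠ 2 := by omega
    apply SuperFun.ext <;> simp [thetaSeq1, h2]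

/-- The series of Θ₂ and Θ₃ group the indices 2n + 1 and 2n + 2 together; the index 0 is left over,
which explains the hypothesis `h0`. -/
theorem coeff_eq_homogeneousSeries_of_terms (p : ℕ → 𝕜) (F : SuperFun 𝕜) (j : ℤ)
    (T : ℕ → SuperFun 𝕜) (h0 : p 0 = 0)
    (hT : ∀ n, T n = homTerm p F j (2 * n + 1) + homTerm p F j (2 * n + 2)) :
    ∑ᶠ n, T n = coeff (homogeneousSeries 2 p F) j := by
  set K := (3 - j).toNat + 1
  rw [coeff_homogeneousSeries_eq_sum p F (K := 2 * K + 1) (by omega), Finset.sum_range_succ',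
    sum_range_two_mul, finsum_eq_sum_of_support_subset (s := Finset.range K)]
  · simp only [hT]
    rw [show homTerm p F j 0 = 0 by unfold homTerm; rw [h0, zero_smul], add_zero]
  · intro n hn
    simp only [Finset.coe_range, Set.mem_Iio]
    by_contra h
    refine hn ?_
    rw [hT, homTerm_eq_zero _ _ _ _ (by omega) (by omega),
      homTerm_eq_zero _ _ _ _ (by omega) (by omega), add_zero]

theorem homTerm_two_mul_add_one (p : ℕ → 𝕜) (F : SuperFun 𝕜) (j : ℤ) (n : ℕ) :
    homTerm p F j (2 * n + 1) = p (2 * n + 1) •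
      (sigma (etaBar^[2 * n + 1] F) * etaBarPow (-2 * n + 1) j) := by
  unfold homTerm
  rw [sigmaPow_odd ⟨n - 1, by push_cast; ring⟩]
  congr 3
  push_cast
  ring

theorem homTerm_two_mul_add_two (p : ℕ → 𝕜) (F : SuperFun 𝕜) (j : ℤ) (n : ℕ) :
    homTerm p F j (2 * n + 2) = p (2 * n + 2) •
      (etaBar^[2 * n + 2] F * etaBarPow (-2 * n) j) := by
  unfold homTerm
  rw [sigmaPow_even ⟨n, by push_cast; ring⟩]
  congr 3
  push_cast
  ring

theorem thetaSeq2_odd {n : ℕ} (h : 1 ≤ n) :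
    thetaSeq2 𝕜 (2 * n + 1) = (-1) ^ n * (((n : 𝕜) - 2) / n) := by
  rw [thetaSeq2, if_neg (by omega), if_neg (Nat.not_even_iff_odd.2 ⟨n, rfl⟩),
    show (2 * n + 1) / 2 = n by omega]

theorem thetaSeq2_even {n : ℕ} (h : 1 ≤ n) :
    thetaSeq2 𝕜 (2 * n + 2) = (-1) ^ n * (((n : 𝕜) - 3) / (n + 1)) := by
  rw [thetaSeq2, if_neg (by omega), if_pos ⟨n + 1, by ring⟩,
    show (2 * n + 2) / 2 - 1 = n by omega]

theorem thetaSeq2_of_lt {i : ℕ} (h : i < 3) : thetaSeq2 𝕜 i = 0 := if_pos h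

theorem Theta2_eq_homogeneousSeries (F : SuperFun 𝕜) :
    Theta2 F = homogeneousSeries 2 (thetaSeq2 𝕜) F := by
  apply SPDO.ext
  intro j
  refine coeff_eq_homogeneousSeries_of_terms _ _ _ _ (thetaSeq2_of_lt (by omega)) fun n => ?_
  rw [homTerm_two_mul_add_one, homTerm_two_mul_add_two]
  split_ifs with h
  · rw [thetaSeq2_odd h, thetaSeq2_even h]
  · rw [thetaSeq2_of_lt (by omega), thetaSeq2_of_lt (by omega), zero_smul, zero_smul, add_zero]

theorem thetaSeq3_odd {n : ℕ} (h : 2 ≤ n) :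
    thetaSeq3 𝕜 (2 * n + 1) = (-1) ^ n * (((n : 𝕜) - 1) / n) := by
  rw [thetaSeq3, if_neg (by omega), if_neg (Nat.not_even_iff_odd.2 ⟨n, rfl⟩),
    show (2 * n + 1) / 2 = n by omega]

theorem thetaSeq3_even {n : ℕ} (h : 2 ≤ n) :
    thetaSeq3 𝕜 (2 * n + 2) = (-1) ^ n * (((n : 𝕜) - 1) / (n + 1)) := by
  rw [thetaSeq3, if_neg (by omega), if_pos ⟨n + 1, by ring⟩,
    show (2 * n + 2) / 2 - 1 = n by omega]

theorem thetaSeq3_of_lt {i : ℕ} (h : i < 5) : thetaSeq3 𝕜 i = 0 := if_pos h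

theorem Theta3_eq_homogeneousSeries (F : SuperFun 𝕜) :
    Theta3 F = homogeneousSeries 2 (thetaSeq3 𝕜) F := by
  apply SPDO.ext
  intro j
  refine coeff_eq_homogeneousSeries_of_terms _ _ _ _ (thetaSeq3_of_lt (by omega)) fun n => ?_
  rw [homTerm_two_mul_add_one, homTerm_two_mul_add_two]
  split_ifs with h
  · rw [thetaSeq3_odd h, thetaSeq3_even h]
  · rw [thetaSeq3_of_lt (by omega), thetaSeq3_of_lt (by omega), zero_smul, zero_smul, add_zero]

/-- The coefficients of `ρ + c₁ Θ₁ + c₂ Θ₂ + c₃ Θ₃` as a homogeneous series. -/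
def linSeq (𝕜 : Type*) [RCLike 𝕜] (c : Fin 3 → ℝ) : ℕ → 𝕜 :=
  rhoSeq 𝕜 + (c 0 : 𝕜) • thetaSeq1 𝕜 + (c 1 : 𝕜) • thetaSeq2 𝕜 + (c 2 : 𝕜) • thetaSeq3 𝕜

theorem infinitesimal_eq_homogeneousSeries (c : Fin 3 → ℝ) (F : SuperFun 𝕜) :
    rho F + (c 0 : 𝕜) • Theta1 F + (c 1 : 𝕜) • Theta2 F + (c 2 : 𝕜) • Theta3 F =
      homogeneousSeries 2 (linSeq 𝕜 c) F := by
  rw [linSeq, homogeneousSeries_add, homogeneousSeries_add, homogeneousSeries_add,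
    homogeneousSeries_smul, homogeneousSeries_smul, homogeneousSeries_smul,
    rho_eq_homogeneousSeries, Theta1_eq_homogeneousSeries, Theta2_eq_homogeneousSeries,
    Theta3_eq_homogeneousSeries]

/-! ### The leading part of a homomorphism -/

/-- Even homomorphisms from contact vector fields to operators of bounded order, whose coefficients
are differential operators. -/
structure IsRep (φ : SuperFun 𝕜 →ₗ[𝕜] SPDO 𝕜) : Prop where
  map_bracket : ∀ F G, φ (contactBracket F G) = superBracket (φ F) (φ G)
  even : ∀ F, parity (φ F) = φ (sigma F)
  bounded : ∃ N : ℤ, ∀ F, OrdLE (φ F) N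
  fst_even : ∀ k, IsDiffOp fun f => (coeff (φ (mkFun f 0)) k).fst
  snd_even : ∀ k, IsDiffOp fun f => (coeff (φ (mkFun f 0)) k).snd
  fst_odd : ∀ k, IsDiffOp fun h => (coeff (φ (mkFun 0 h)) k).fst
  snd_odd : ∀ k, IsDiffOp fun h => (coeff (φ (mkFun 0 h)) k).snd

theorem contactBracket_even_even (f g : CircleFun 𝕜) :
    contactBracket (mkFun f 0) (mkFun g 0) = mkFun (f * ddx g - ddx f * g) 0 := by
  apply SuperFun.ext <;> simp [contactBracket]

theorem contactBracket_even_odd (f h : CircleFun 𝕜) :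
    contactBracket (mkFun f 0) (mkFun 0 h) = mkFun 0 (f * ddx h - (1 / 2 : 𝕜) • (ddx f * h)) := by
  apply SuperFun.ext <;> simp [contactBracket]

theorem contactBracket_odd_odd (h g : CircleFun 𝕜) :
    contactBracket (mkFun 0 h) (mkFun 0 g) = mkFun ((1 / 2 : 𝕜) • (h * g)) 0 := by
  apply SuperFun.ext <;> simp [contactBracket]

theorem sigma_even (f : CircleFun 𝕜) : sigma (mkFun f 0) = mkFun f 0 := by
  apply SuperFun.ext <;> simp

theorem sigma_odd (h : CircleFun 𝕜) : sigma (mkFun 0 h) = -mkFun 0 h := by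
  apply SuperFun.ext <;> simp

namespace IsRep

variable {φ : SuperFun 𝕜 →ₗ[𝕜] SPDO 𝕜}

theorem parity_even (hφ : IsRep φ) (f : CircleFun 𝕜) : parity (φ (mkFun f 0)) = φ (mkFun f 0) := by
  rw [hφ.even, sigma_even]

theorem parity_odd (hφ : IsRep φ) (h : CircleFun 𝕜) : parity (φ (mkFun 0 h)) = -φ (mkFun 0 h) := by
  rw [hφ.even, sigma_odd, map_neg]

theorem map_even_even (hφ : IsRep φ) (f g : CircleFun 𝕜) : φ (mkFun (f * ddx g - ddx f * g) 0) =
    comp (φ (mkFun f 0)) (φ (mkFun g 0)) - comp (φ (mkFun g 0)) (φ (mkFun f 0)) := by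
  rw [← contactBracket_even_even, hφ.map_bracket, superBracket_of_even (hφ.parity_even f)]

theorem map_even_odd (hφ : IsRep φ) (f h : CircleFun 𝕜) :
    φ (mkFun 0 (f * ddx h - (1 / 2 : 𝕜) • (ddx f * h))) =
      comp (φ (mkFun f 0)) (φ (mkFun 0 h)) - comp (φ (mkFun 0 h)) (φ (mkFun f 0)) := by
  rw [← contactBracket_even_odd, hφ.map_bracket, superBracket_of_even (hφ.parity_even f)]

theorem map_odd_odd (hφ : IsRep φ) (h g : CircleFun 𝕜) : φ (mkFun ((1 / 2 : 𝕜) • (h * g)) 0) =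
    comp (φ (mkFun 0 h)) (φ (mkFun 0 g)) + comp (φ (mkFun 0 g)) (φ (mkFun 0 h)) := by
  rw [← contactBracket_odd_odd, hφ.map_bracket,
    superBracket_odd_odd (hφ.parity_odd h) (hφ.parity_odd g)]

theorem blkA_even_even (hφ : IsRep φ) (f g : CircleFun 𝕜) (p : ℤ) :
    blkA (φ (mkFun (f * ddx g - ddx f * g) 0)) p =
      star (blkA (φ (mkFun f 0))) (blkA (φ (mkFun g 0))) p -
        star (blkA (φ (mkFun g 0))) (blkA (φ (mkFun f 0))) p := by
  rw [hφ.map_even_even, blkA_sub, blkA_comp, blkA_comp, blkB_of_even (hφ.parity_even f),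
    blkB_of_even (hφ.parity_even g), star_zero_left, star_zero_left, add_zero, add_zero]

theorem blkD_even_even (hφ : IsRep φ) (f g : CircleFun 𝕜) (p : ℤ) :
    blkD (φ (mkFun (f * ddx g - ddx f * g) 0)) p =
      star (blkD (φ (mkFun f 0))) (blkD (φ (mkFun g 0))) p -
        star (blkD (φ (mkFun g 0))) (blkD (φ (mkFun f 0))) p := by
  rw [hφ.map_even_even, blkD_sub, blkD_comp, blkD_comp, blkC_of_even (hφ.parity_even f),
    blkC_of_even (hφ.parity_even g), star_zero_left, star_zero_left, zero_add, zero_add]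

theorem blkB_even_odd (hφ : IsRep φ) (f h : CircleFun 𝕜) (p : ℤ) :
    blkB (φ (mkFun 0 (f * ddx h - (1 / 2 : 𝕜) • (ddx f * h)))) p =
      star (blkA (φ (mkFun f 0))) (blkB (φ (mkFun 0 h))) p -
        star (blkB (φ (mkFun 0 h))) (blkD (φ (mkFun f 0))) p := by
  rw [hφ.map_even_odd, blkB_sub, blkB_comp, blkB_comp, blkB_of_even (hφ.parity_even f),
    blkA_of_odd (hφ.parity_odd h), star_zero_left, star_zero_left, add_zero, zero_add]

theorem blkC_even_odd (hφ : IsRep φ) (f h : CircleFun 𝕜) (p : ℤ) :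
    blkC (φ (mkFun 0 (f * ddx h - (1 / 2 : 𝕜) • (ddx f * h)))) p =
      star (blkD (φ (mkFun f 0))) (blkC (φ (mkFun 0 h))) p -
        star (blkC (φ (mkFun 0 h))) (blkA (φ (mkFun f 0))) p := by
  rw [hφ.map_even_odd, blkC_sub, blkC_comp, blkC_comp, blkC_of_even (hφ.parity_even f),
    blkD_of_odd (hφ.parity_odd h), star_zero_left, star_zero_left, add_zero, zero_add]

theorem blkA_odd_odd (hφ : IsRep φ) (h g : CircleFun 𝕜) (p : ℤ) :
    blkA (φ (mkFun ((1 / 2 : 𝕜) • (h * g)) 0)) p =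
      star (blkB (φ (mkFun 0 h))) (blkC (φ (mkFun 0 g))) p +
        star (blkB (φ (mkFun 0 g))) (blkC (φ (mkFun 0 h))) p := by
  rw [hφ.map_odd_odd, blkA_add, blkA_comp, blkA_comp, blkA_of_odd (hφ.parity_odd h),
    blkA_of_odd (hφ.parity_odd g), star_zero_left, zero_add, zero_add]

theorem isDiffOp_blkA (hφ : IsRep φ) (k : ℤ) : IsDiffOp fun f => blkA (φ (mkFun f 0)) k := hφ.fst_even (2 * k)

theorem isDiffOp_blkD (hφ : IsRep φ) (k : ℤ) : IsDiffOp fun f => blkD (φ (mkFun f 0)) k := by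
  simp only [blkD_apply]
  exact isDiffOp_add (hφ.snd_even _) (hφ.fst_even _)

theorem isDiffOp_blkB (hφ : IsRep φ) (k : ℤ) : IsDiffOp fun h => blkB (φ (mkFun 0 h)) k := hφ.fst_odd (2 * k + 1)

theorem isDiffOp_blkC (hφ : IsRep φ) (k : ℤ) : IsDiffOp fun h => blkC (φ (mkFun 0 h)) k := by
  simp only [blkC_apply]
  exact isDiffOp_add (hφ.snd_odd _) (hφ.fst_odd _)

theorem exists_bound (hφ : IsRep φ) : ∃ N : ℤ, ∀ F k, N < k → blkA (φ F) k = 0 ∧ blkB (φ F) k = 0 ∧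
    blkC (φ F) k = 0 ∧ blkD (φ F) k = 0 := by
  obtain ⟨N, hN⟩ := hφ.bounded
  refine ⟨|N| + 1, fun F k hk => ?_⟩
  have h0 := le_abs_self N
  have h1 := abs_nonneg N
  have h : ∀ j, N < j → coeff (φ F) j = 0 := hN F
  refine ⟨?_, ?_, ?_, ?_⟩
  · rw [blkA, h _ (by omega), TrivSqZeroExt.fst_zero]
  · rw [blkB, h _ (by omega), TrivSqZeroExt.fst_zero]
  · rw [blkC_apply, h _ (by omega), h _ (by omega), TrivSqZeroExt.fst_zero,
      TrivSqZeroExt.snd_zero, add_zero]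
  · rw [blkD_apply, h _ (by omega), h _ (by omega), TrivSqZeroExt.fst_zero,
      TrivSqZeroExt.snd_zero, add_zero]

end IsRep

/-- A homomorphism from vector fields to operators on the circle has order at most one, and its
symbol is `0` or that of the standard embedding. -/
theorem vect_hom_symbol {u : CircleFun 𝕜 → ℤ → CircleFun 𝕜} (hd : ∀ k, IsDiffOp fun f => u f k)
    {N : ℤ} (hN : ∀ f k, N < k → u f k = 0)
    (h : ∀ f g p, u (f * ddx g - ddx f * g) p = star (u f) (u g) p - star (u g) (u f) p) :
    (∀ f k, 1 < k → u f k = 0) ∧ ∃ a : 𝕜, (a = 0 ∨ a = 1) ∧ ∀ f, u f 1 = a • f := by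
  -- Descending induction on the order. When k > 1 bounds the order, 2k - 1 > k, so the image of the
  -- bracket has no term of degree 2k - 1, while the commutator has k times the Poisson bracket of
  -- the top symbols there.
  have key : ∀ m : ℕ, ∀ f k, max N 1 - m < k → 1 < k → u f k = 0 := by
    intro m
    induction m with
    | zero =>
      intro f k hk _
      exact hN f k (lt_of_le_of_lt (le_max_left N 1) (by simpa using hk))
    | succ m ih =>
      intro f k hk h1
      by_cases hk' : max N 1 - m < k
      · exact ih f k hk' h1
      have hv : ∀ f j, k < j → u f j = 0 := fun f j hj => ih f j (by push_cast at hk; omega) (by omega)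
      refine (hd k).eq_zero_of_mul_ddx (fun f g => ?_) f
      have h2 := h f g (k + k - 1)
      rw [hv _ _ (by omega), star_top_sub_one (hv f) (hv g) rfl,
        star_top_sub_one (hv g) (hv f) rfl] at h2
      have h3 : (k : 𝕜) • (u f k * ddx (u g k) - ddx (u f k) * u g k) = 0 := by
        rw [smul_sub, mul_comm (ddx (u f k))]
        linear_combination -h2
      have hk0 : (k : 𝕜) ≠ 0 := by exact_mod_cast (by omega : k ≠ 0)
      exact sub_eq_zero.1 ((smul_eq_zero.1 h3).resolve_left hk0)
  have hv : ∀ f k, 1 < k → u f k = 0 := fun f k hk =>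
    key (max N 1).toNat f k (by have := le_max_right N 1; omega) hk
  refine ⟨hv, (hd 1).eq_mul_of_vect fun f g => ?_⟩
  rw [h, star_top_sub_one (hv f) (hv g) (by norm_num), star_top_sub_one (hv g) (hv f) (by norm_num),
    Int.cast_one, one_smul, one_smul]
  ring

theorem exists_top_index {u : CircleFun 𝕜 → ℤ → CircleFun 𝕜} {N : ℤ}
    (hN : ∀ f k, N < k → u f k = 0) (h0 : ∃ f k, u f k ≠ 0) :
    ∃ r, (∀ f k, r < k → u f k = 0) ∧ ∃ f, u f r ≠ 0 := by
  obtain ⟨f, k, hk⟩ := h0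
  obtain ⟨r, hr, hmax⟩ := Int.exists_greatest_of_bdd (P := fun k => ∃ f, u f k ≠ 0)
    ⟨N, fun z ⟨f, hz⟩ => by by_contra h; exact hz (hN f z (by omega))⟩ ⟨k, f, hk⟩
  refine ⟨r, fun f k hk => ?_, hr⟩
  by_contra h
  have := hmax k ⟨f, h⟩
  omega

theorem evalAt_ddx_locMon_one (x : ℝ) : evalAt 𝕜 x (ddx (locMon 1 x)) = 1 := by
  have := evalAt_iterate_locMon (𝕜 := 𝕜) 1 1 x
  simpa using this

/-- The leading coefficients on odd fields of a homomorphism that has the standard symbol on even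
fields. -/
theorem IsRep.odd_symbol {φ : SuperFun 𝕜 →ₗ[𝕜] SPDO 𝕜} (hφ : IsRep φ)
    (hA : ∀ f k, 1 < k → blkA (φ (mkFun f 0)) k = 0) (hA1 : ∀ f, blkA (φ (mkFun f 0)) 1 = f)
    (hD : ∀ f k, 1 < k → blkD (φ (mkFun f 0)) k = 0) (hD1 : ∀ f, blkD (φ (mkFun f 0)) 1 = f) :
    ∃ (r : ℤ) (β κ : CircleFun 𝕜), (∀ h k, r < k → blkB (φ (mkFun 0 h)) k = 0) ∧
      (∀ h k, 1 - r < k → blkC (φ (mkFun 0 h)) k = 0) ∧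
      (∀ h, blkB (φ (mkFun 0 h)) r = β * h) ∧ (∀ h, blkC (φ (mkFun 0 h)) (1 - r) = κ * h) ∧
      β * κ = algebraMap 𝕜 _ (1 / 4) ∧ ∃ w : CircleFun 𝕜, ddx β = -w * β ∧
        ∀ f, blkA (φ (mkFun f 0)) 0 - blkD (φ (mkFun f 0)) 0 = w * f + ((r : 𝕜) - 1 / 2) • ddx f := by
  obtain ⟨N, hN⟩ := hφ.exists_bound
  -- The bracket of v_θ with itself is v_{1/2}, whose image has the symbol ½ ξ in the first block,
  -- so the product of the off-diagonal blocks must reach order one.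
  have hne : ∀ r s : ℤ, (∀ h k, r < k → blkB (φ (mkFun 0 h)) k = 0) →
      (∀ h k, s < k → blkC (φ (mkFun 0 h)) k = 0) → 1 ≤ r + s := by
    intro r s hr hs
    by_contra hlt
    have h1 := hφ.blkA_odd_odd 1 1 1
    rw [star_eq_zero (hr 1) (hs 1) (by omega), hA1, mul_one, add_zero] at h1
    have h2 := congrArg (evalAt 𝕜 0) h1
    rw [map_smul, evalAt_one, map_zero, smul_eq_mul, mul_one] at h2
    norm_num at h2
  have hb0 : ∃ h k, blkB (φ (mkFun 0 h)) k ≠ 0 := by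
    by_contra! hb
    have := hne (-N) N (fun h k _ => hb h k) fun h k hk => (hN _ k hk).2.2.1
    omega
  have hc0 : ∃ h k, blkC (φ (mkFun 0 h)) k ≠ 0 := by
    by_contra! hc
    have := hne N (-N) (fun h k hk => (hN _ k hk).2.1) fun h k _ => hc h k
    omega
  obtain ⟨r, hr, hr0⟩ := exists_top_index (u := fun h => blkB (φ (mkFun 0 h)))
    (fun h k hk => (hN _ k hk).2.1) hb0
  obtain ⟨s, hs, hs0⟩ := exists_top_index (u := fun h => blkC (φ (mkFun 0 h)))
    (fun h k hk => (hN _ k hk).2.2.1) hc0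
  have hrs := hne r s hr hs
  set om : CircleFun 𝕜 → CircleFun 𝕜 := fun f =>
    blkA (φ (mkFun f 0)) 0 - blkD (φ (mkFun f 0)) 0 with hom
  have hod : IsDiffOp om := isDiffOp_sub (hφ.isDiffOp_blkA 0) (hφ.isDiffOp_blkD 0)
  obtain ⟨n, a, ha, -, hωb⟩ := (hφ.isDiffOp_blkB r).intertwiner hod (r : 𝕜) (fun f g => by
    rw [hφ.blkB_even_odd, star_top_sub_one (hA f) (hr g) (by ring),
      star_top_sub_one (hr g) (hD f) (by ring), hA1, hD1, Int.cast_one, one_smul, sub_self,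
      mul_comm (ddx f)]
    simp only [hom]
    ring) hr0
  obtain ⟨n', a', ha', -, hωc⟩ := (hφ.isDiffOp_blkC s).intertwiner (isDiffOp_neg hod) (s : 𝕜)
    (fun f g => by
      rw [hφ.blkC_even_odd, star_top_sub_one (hD f) (hs g) (by ring),
        star_top_sub_one (hs g) (hA f) (by ring), hA1, hD1, Int.cast_one, one_smul, sub_self,
        mul_comm (ddx f)]
      simp only [hom]
      ring) hs0
  -- The operator A₀ - D₀ is determined by either off-diagonal block, with opposite signs: its
  -- coefficient at f' is n + r - 1/2 and also -(n' + s - 1/2).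
  have hsum : (n : ℤ) + n' + r + s = 1 := by
    have h1 := congrArg (evalAt 𝕜 0) (hωb (locMon 1 0))
    have h2 := congrArg (evalAt 𝕜 0) (hωc (locMon 1 0))
    rw [map_add, evalAt_mul, map_smul, evalAt_ddx_locMon_one, evalAt_locMon, if_neg one_ne_zero,
      mul_zero, zero_add, smul_eq_mul, mul_one] at h1 h2
    rw [map_neg, h1] at h2
    have h3 : (((n : ℤ) + n' + r + s : ℤ) : 𝕜) = (1 : ℤ) := by
      push_cast
      linear_combination -h2
    exact_mod_cast h3
  -- Since r + s ≥ 1 and n, n' ≥ 0, the leading coefficients contain no derivatives of h.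
  obtain rfl : n = 0 := by omega
  obtain rfl : n' = 0 := by omega
  obtain rfl : s = 1 - r := by push_cast at hsum; omega
  have hb : ∀ h, blkB (φ (mkFun 0 h)) r = a 0 * h := fun h => by
    have := ha h
    simpa using this
  have hc : ∀ h, blkC (φ (mkFun 0 h)) (1 - r) = a' 0 * h := fun h => by
    have := ha' h
    simpa using this
  refine ⟨r, a 0, a' 0, hr, hs, hb, hc, ?_, om 1, ?_, fun f => ?_⟩
  · have h1 := hφ.blkA_odd_odd 1 1 1
    rw [star_top (hr 1) (hs 1) (by ring), hA1, hb, hc, mul_one, mul_one, mul_one] at h1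
    rw [Algebra.algebraMap_eq_smul_one]
    have h2 : (2 : 𝕜) • (a 0 * a' 0) = (1 / 2 : 𝕜) • 1 := by rw [two_smul, h1]
    calc a 0 * a' 0 = (1 / 2 : 𝕜) • ((2 : 𝕜) • (a 0 * a' 0)) := by
          rw [smul_smul]; norm_num
      _ = (1 / 4 : 𝕜) • 1 := by rw [h2, smul_smul]; norm_num
  -- For f = h = 1 the left side is zero and the terms of order r give β' = -(A₀(1) - D₀(1)) β.
  · have h1 := hφ.blkB_even_odd 1 1 r
    rw [star_top_sub_one (hA 1) (hr 1) (by ring), star_top_sub_one (hr 1) (hD 1) (by ring), hA1,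
      hD1] at h1
    simp only [hb, ddx_one, mul_zero, smul_zero, Int.cast_one, one_smul, mul_one, one_mul,
      sub_self, add_zero] at h1
    simp only [hom]
    linear_combination -h1
  · have := hωb f
    rw [Nat.cast_zero, zero_add] at this
    exact this

/-! ### Rigidity of the leading part along polynomial curves. -/

/-- Polynomial functions on the line. -/
def IsCurvePoly (f : ℝ → 𝕜) : Prop := ∃ q : Polynomial 𝕜, ∀ t : ℝ, f t = q.eval (t : 𝕜)

theorem isCurvePoly_add {f g : ℝ → 𝕜} (hf : IsCurvePoly f) (hg : IsCurvePoly g) :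
    IsCurvePoly fun t => f t + g t := by
  obtain ⟨p, hp⟩ := hf
  obtain ⟨q, hq⟩ := hg
  exact ⟨p + q, fun t => by beta_reduce; rw [hp, hq, Polynomial.eval_add]⟩

theorem isCurvePoly_mul {f g : ℝ → 𝕜} (hf : IsCurvePoly f) (hg : IsCurvePoly g) :
    IsCurvePoly fun t => f t * g t := by
  obtain ⟨p, hp⟩ := hf
  obtain ⟨q, hq⟩ := hg
  exact ⟨p * q, fun t => by beta_reduce; rw [hp, hq, Polynomial.eval_mul]⟩

theorem isCurvePoly_const (r : 𝕜) : IsCurvePoly fun _ => r := ⟨Polynomial.C r, fun t => by simp⟩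

theorem isCurvePoly_sub {f g : ℝ → 𝕜} (hf : IsCurvePoly f) (hg : IsCurvePoly g) :
    IsCurvePoly fun t => f t - g t := by
  simpa [sub_eq_add_neg] using isCurvePoly_add hf (isCurvePoly_mul (isCurvePoly_const (-1)) hg)

theorem isCurvePoly_sum {ι : Type*} {s : Finset ι} {f : ι → ℝ → 𝕜}
    (h : ∀ i ∈ s, IsCurvePoly (f i)) : IsCurvePoly fun t => ∑ i ∈ s, f i t := by
  classical
  induction s using Finset.induction_on with
  | empty => simpa using isCurvePoly_const (0 : 𝕜)
  | insert i s hi ih =>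
    simp only [Finset.sum_insert hi]
    exact isCurvePoly_add (h i (Finset.mem_insert_self i s))
      (ih fun j hj => h j (Finset.mem_insert_of_mem hj))

theorem IsCurvePoly.continuous {f : ℝ → 𝕜} (hf : IsCurvePoly f) : Continuous f := by
  obtain ⟨q, hq⟩ := hf
  rw [show f = fun t : ℝ => q.eval (t : 𝕜) from funext hq]
  exact q.continuous.comp RCLike.continuous_ofReal

/-- An integer valued polynomial function on the line is constant. -/
theorem IsCurvePoly.eq_of_int {n : ℝ → ℤ} (hf : IsCurvePoly fun t => (n t : 𝕜)) (t : ℝ) :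
    n t = n 0 := by
  have h1 : Continuous fun t => (n t : ℝ) := by
    have := RCLike.continuous_re.comp hf.continuous
    refine this.congr fun t => ?_
    simp
  have h2 : Continuous n := Int.isClosedEmbedding_coe_real.isEmbedding.continuous_iff.2 h1
  exact isPreconnected_univ.constant h2.continuousOn (Set.mem_univ t) (Set.mem_univ 0)

/-- A polynomial function on the line that divides a nonzero constant is constant. -/
theorem IsCurvePoly.eq_of_mul_eq {f g : ℝ → 𝕜} (hf : IsCurvePoly f) (hg : IsCurvePoly g) {r : 𝕜}
    (hr : r ≠ 0) (h : ∀ t, f t * g t = r) (t : ℝ) : f t = f 0 := by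
  obtain ⟨p, hp⟩ := hf
  obtain ⟨q, hq⟩ := hg
  have hpq : p * q = Polynomial.C r := by
    refine Polynomial.eq_of_infinite_eval_eq _ _ ?_
    refine (Set.infinite_range_of_injective (RCLike.ofReal_injective (K := 𝕜))).mono ?_
    rintro _ ⟨s, rfl⟩
    simp [← hp, ← hq, h]
  have hu : IsUnit p := isUnit_of_mul_isUnit_left (hpq ▸ (Polynomial.isUnit_C.2 hr.isUnit))
  rw [hp, hp, Polynomial.eq_C_of_degree_eq_zero (Polynomial.degree_eq_zero_of_isUnit hu)]
  simp

theorem blkA_rho (f : CircleFun 𝕜) (k : ℤ) :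
    blkA (rho (mkFun f 0)) k = if k = 1 then f else 0 := by
  rw [blkA]
  split_ifs with h
  · rw [h, mul_one, coeff_rho_two, fst_mkFun, fst_mkFun]
  · rw [coeff_rho_of_ne _ (by omega) (by omega), TrivSqZeroExt.fst_zero]

theorem blkD_rho (f : CircleFun 𝕜) (k : ℤ) :
    blkD (rho (mkFun f 0)) k = if k = 1 then f else if k = 0 then (1 / 2 : 𝕜) • ddx f else 0 := by
  rw [blkD_apply]
  split_ifs with h h0
  · subst h
    rw [coeff_rho_of_ne _ (by omega) (by omega), mul_one, coeff_rho_two]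
    simp
  · subst h0
    rw [coeff_rho_of_ne _ (j := 2 * 0) (by omega) (by omega), mul_zero, zero_add, coeff_rho_one]
    simp
  · rw [coeff_rho_of_ne _ (by omega) (by omega), coeff_rho_of_ne _ (by omega) (by omega)]
    simp

theorem blkB_rho (h : CircleFun 𝕜) (k : ℤ) :
    blkB (rho (mkFun 0 h)) k = if k = 0 then (1 / 2 : 𝕜) • h else 0 := by
  rw [blkB]
  split_ifs with h0
  · subst h0
    rw [mul_zero, zero_add, coeff_rho_one]
    simp
  · rw [coeff_rho_of_ne _ (by omega) (by omega), TrivSqZeroExt.fst_zero]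

section Curve

variable {Φ : ℝ → SuperFun 𝕜 →ₗ[𝕜] SPDO 𝕜}

/-- The symbol on even fields does not change along a polynomial curve of homomorphisms that starts
at the standard embedding. -/
theorem vect_symbol_of_curve {u : ℝ → CircleFun 𝕜 → ℤ → CircleFun 𝕜}
    (hd : ∀ t k, IsDiffOp fun f => u t f k) (hN : ∀ t, ∃ N : ℤ, ∀ f k, N < k → u t f k = 0)
    (h : ∀ t f g p, u t (f * ddx g - ddx f * g) p =
      star (u t f) (u t g) p - star (u t g) (u t f) p)
    (hp : ∀ f k x, IsCurvePoly fun t => evalAt 𝕜 x (u t f k)) (h0 : u 0 1 1 = 1) (t : ℝ) :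
    (∀ f k, 1 < k → u t f k = 0) ∧ ∀ f, u t f 1 = f := by
  -- The factor 0 or 1 is recorded as an integer, so that polynomial dependence on `t` forces it to
  -- be constant.
  have key : ∀ t, (∀ f k, 1 < k → u t f k = 0) ∧
      ∃ n : ℤ, ∀ f, u t f 1 = (n : 𝕜) • f := fun t => by
    obtain ⟨N, hN⟩ := hN t
    obtain ⟨h1, a, ha, ha'⟩ := vect_hom_symbol (hd t) hN (h t)
    refine ⟨h1, ?_⟩
    rcases ha with rfl | rfl
    · exact ⟨0, fun f => by rw [ha', Int.cast_zero]⟩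
    · exact ⟨1, fun f => by rw [ha', Int.cast_one]⟩
  refine ⟨(key t).1, ?_⟩
  choose n hn using fun t => (key t).2
  have e : ∀ t, evalAt 𝕜 0 (u t 1 1) = (n t : 𝕜) := fun t => by
    rw [hn, map_smul, evalAt_one, smul_eq_mul, mul_one]
  have hn0 : n 0 = 1 := by
    have := e 0
    rw [h0, evalAt_one] at this
    exact_mod_cast this.symm
  have := hp 1 1 0
  simp only [e] at this
  intro f
  rw [hn, this.eq_of_int t, hn0, Int.cast_one, one_smul]

/-- The diagonal symbols and the order r are discrete, and β(x) is an invertible polynomial in `t`;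
none of them can change along the curve. With r = 0 and β = κ = 1/2 one gets w = 0, and the four
blocks then agree with those of ρ in all entries that involve coefficients of positive order. -/
theorem ordLE_sub_rho_of_curve (hΦ : ∀ t, IsRep (Φ t)) (h0 : ∀ F, Φ 0 F = rho F)
    (hfst : ∀ F k x, IsCurvePoly fun t => evalAt 𝕜 x (coeff (Φ t F) k).fst)
    (hsnd : ∀ F k x, IsCurvePoly fun t => evalAt 𝕜 x (coeff (Φ t F) k).snd) (t : ℝ)
    (F : SuperFun 𝕜) : OrdLE (Φ t F - rho F) 0 := by
  have pA : ∀ F k x, IsCurvePoly fun t => evalAt 𝕜 x (blkA (Φ t F) k) := fun F k x => hfst F _ x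
  have pB : ∀ F k x, IsCurvePoly fun t => evalAt 𝕜 x (blkB (Φ t F) k) := fun F k x => hfst F _ x
  have pC : ∀ F k x, IsCurvePoly fun t => evalAt 𝕜 x (blkC (Φ t F) k) := fun F k x => by
    simp only [blkC_apply, map_add]
    exact isCurvePoly_add (hsnd _ _ _) (hfst _ _ _)
  have pD : ∀ F k x, IsCurvePoly fun t => evalAt 𝕜 x (blkD (Φ t F) k) := fun F k x => by
    simp only [blkD_apply, map_add]
    exact isCurvePoly_add (hsnd _ _ _) (hfst _ _ _)
  have hA := vect_symbol_of_curve (u := fun t f => blkA (Φ t (mkFun f 0)))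
    (fun t k => (hΦ t).isDiffOp_blkA k)
    (fun t => (hΦ t).exists_bound.imp fun N h f k hk => (h _ k hk).1)
    (fun t => (hΦ t).blkA_even_even) (fun f => pA _) (by rw [h0, blkA_rho, if_pos rfl])
  have hD := vect_symbol_of_curve (u := fun t f => blkD (Φ t (mkFun f 0)))
    (fun t k => (hΦ t).isDiffOp_blkD k)
    (fun t => (hΦ t).exists_bound.imp fun N h f k hk => (h _ k hk).2.2.2)
    (fun t => (hΦ t).blkD_even_even) (fun f => pD _) (by rw [h0, blkD_rho, if_pos rfl])
  choose r β κ hr hs hβ hκ hβκ w hw hom using fun t =>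
    (hΦ t).odd_symbol (hA t).1 (hA t).2 (hD t).1 (hD t).2
  -- The integer r is the coefficient at f' of A₀ - D₀, plus 1/2. Evaluation on a local coordinate
  -- expresses it through coefficients of Φ and shows that it is polynomial in `t`.
  have er : ∀ t, evalAt 𝕜 0 (blkA (Φ t (mkFun (locMon 1 0) 0)) 0) -
      evalAt 𝕜 0 (blkD (Φ t (mkFun (locMon 1 0) 0)) 0) + 1 / 2 = (r t : 𝕜) := fun t => by
    rw [← map_sub, hom, map_add, evalAt_mul, map_smul, evalAt_ddx_locMon_one, evalAt_locMon,
      if_neg one_ne_zero, mul_zero, zero_add, smul_eq_mul, mul_one, sub_add_cancel]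
  have hr00 : r 0 = 0 := by
    have := er 0
    rw [h0, blkA_rho, blkD_rho, if_neg zero_ne_one, if_neg zero_ne_one, if_pos rfl, map_zero,
      map_smul, evalAt_ddx_locMon_one, smul_eq_mul, mul_one, zero_sub, neg_add_cancel] at this
    exact_mod_cast this.symm
  have hr0 : ∀ t, r t = 0 := fun t => by
    have := isCurvePoly_add (isCurvePoly_sub (pA (mkFun (locMon 1 0) 0) 0 0)
      (pD (mkFun (locMon 1 0) 0) 0 0)) (isCurvePoly_const (1 / 2))
    simp only [er] at this
    rw [this.eq_of_int t, hr00]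
  have eβ : ∀ t, β t = blkB (Φ t (mkFun 0 1)) 0 := fun t => by
    have := hβ t 1
    rw [hr0, mul_one] at this
    exact this.symm
  have eκ : ∀ t, κ t = blkC (Φ t (mkFun 0 1)) 1 := fun t => by
    have := hκ t 1
    rw [hr0, mul_one, sub_zero] at this
    exact this.symm
  have hβ0 : β 0 = algebraMap 𝕜 _ (1 / 2) := by
    rw [eβ, h0, blkB_rho, if_pos rfl, Algebra.algebraMap_eq_smul_one]
  have hβt : ∀ t, β t = algebraMap 𝕜 _ (1 / 2) := fun t => by
    rw [← hβ0]
    refine ext_evalAt fun x => ?_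
    have h1 := pB (mkFun 0 1) 0 x
    have h2 := pC (mkFun 0 1) 1 x
    simp only [← eβ, ← eκ] at h1 h2
    refine h1.eq_of_mul_eq h2 (r := 1 / 4) (by norm_num) (fun t => ?_) t
    rw [← evalAt_mul, hβκ, evalAt_algebraMap]
  have hκt : κ t = algebraMap 𝕜 _ (1 / 2) := by
    refine ext_evalAt fun x => ?_
    have h1 := congrArg (evalAt 𝕜 x) (hβκ t)
    rw [evalAt_mul, hβt, evalAt_algebraMap, evalAt_algebraMap] at h1
    rw [evalAt_algebraMap]
    linear_combination 2 * h1
  have hwt : w t = 0 := by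
    have h1 := hw t
    rw [hβt, ddx_algebraMap] at h1
    refine ext_evalAt fun x => ?_
    have h2 := congrArg (evalAt 𝕜 x) h1
    rw [evalAt_mul, evalAt_algebraMap, map_zero, map_neg] at h2
    rw [map_zero]
    linear_combination 2 * h2
  -- The entry D₀ involves the θ-component of the coefficient of η, so this relation says that this
  -- component is ½ f', as for ρ.
  have hAD : ∀ f, blkD (Φ t (mkFun f 0)) 0 = blkA (Φ t (mkFun f 0)) 0 + (1 / 2 : 𝕜) • ddx f :=
    fun f => by
      have := hom t f
      rw [hwt, zero_mul, zero_add, hr0, Int.cast_zero, zero_sub, neg_smul] at this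
      linear_combination -this
  have hB0 : ∀ h, blkB (Φ t (mkFun 0 h)) 0 = (1 / 2 : 𝕜) • h := fun h => by
    rw [Algebra.smul_def, ← hβt t, ← hβ t, hr0]
  have hC1 : ∀ h, blkC (Φ t (mkFun 0 h)) 1 = (1 / 2 : 𝕜) • h := fun h => by
    rw [Algebra.smul_def, ← hκt, ← hκ t, hr0, sub_zero]
  have hBz : ∀ h k, 0 < k → blkB (Φ t (mkFun 0 h)) k = 0 := fun h k hk => hr t h k (by rwa [hr0])
  have hCz : ∀ h k, 1 < k → blkC (Φ t (mkFun 0 h)) k = 0 := fun h k hk =>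
    hs t h k (by rwa [hr0, sub_zero])
  have ev : ∀ f, OrdLE (Φ t (mkFun f 0) - rho (mkFun f 0)) 0 := fun f k hk => by
    rw [coeff_sub]
    rcases Int.even_or_odd' k with ⟨n, rfl | rfl⟩
    · have e1 := (hA t).1 f n
      have e2 := (hA t).2 f
      rw [blkA] at e1 e2
      apply SuperFun.ext
      · by_cases hn : n = 1
        · subst hn
          rw [TrivSqZeroExt.fst_sub, e2, mul_one, coeff_rho_two]
          simp
        · rw [TrivSqZeroExt.fst_sub, e1 (by omega), coeff_rho_of_ne _ (by omega) (by omega)]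
          simp
      · rw [TrivSqZeroExt.snd_sub, snd_coeff_of_even ((hΦ t).parity_even f)]
        by_cases hn : n = 1
        · subst hn
          rw [mul_one, coeff_rho_two]
          simp
        · rw [coeff_rho_of_ne _ (by omega) (by omega)]
          simp
    · have e1 := (hA t).1 f n
      have e3 := (hD t).1 f n
      have e5 := hAD f
      rw [blkD_apply, blkA, mul_zero, zero_add, add_comm] at e5
      rw [blkA] at e1
      rw [blkD_apply] at e3
      apply SuperFun.ext
      · rw [TrivSqZeroExt.fst_sub, fst_coeff_of_even ((hΦ t).parity_even f)]
        by_cases hn : n = 0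
        · subst hn
          rw [mul_zero, zero_add, coeff_rho_one]
          simp
        · rw [coeff_rho_of_ne _ (by omega) (by omega)]
          simp
      · rw [TrivSqZeroExt.snd_sub]
        by_cases hn : n = 0
        · subst hn
          rw [mul_zero, zero_add, coeff_rho_one, add_left_cancel e5]
          simp
        · rw [coeff_rho_of_ne _ (by omega) (by omega)]
          by_cases hn1 : n = 1
          -- Since A₁ = D₁ = f, no θ-component is left at η³.
          · subst hn1
            have e6 := (hA t).2 f
            have e7 := (hD t).2 f
            rw [blkA] at e6
            rw [blkD_apply, e6, add_eq_right] at e7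
            rw [e7]
            simp
          · have e7 := e3 (by omega)
            rw [e1 (by omega), add_zero] at e7
            rw [e7]
            simp
  have od : ∀ h, OrdLE (Φ t (mkFun 0 h) - rho (mkFun 0 h)) 0 := fun h k hk => by
    rw [coeff_sub]
    have e1 := hBz h
    have e2 := hB0 h
    have e3 := hCz h
    have e4 := hC1 h
    simp only [blkB, blkC_apply] at e1 e2 e3 e4
    rcases Int.even_or_odd' k with ⟨n, rfl | rfl⟩
    · apply SuperFun.ext
      · rw [TrivSqZeroExt.fst_sub, fst_coeff_of_odd ((hΦ t).parity_odd h)]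
        by_cases hn : n = 1
        · subst hn
          rw [mul_one, coeff_rho_two]
          simp
        · rw [coeff_rho_of_ne _ (by omega) (by omega)]
          simp
      · rw [TrivSqZeroExt.snd_sub]
        by_cases hn : n = 1
        · subst hn
          rw [show (2 : ℤ) * 1 - 1 = 2 * 0 + 1 by norm_num, e2, add_eq_right] at e4
          rw [e4, mul_one, coeff_rho_two]
          simp
        · have e5 := e3 n (by omega)
          rw [show 2 * n - 1 = 2 * (n - 1) + 1 by ring, e1 (n - 1) (by omega), add_zero] at e5
          rw [e5, coeff_rho_of_ne _ (by omega) (by omega)]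
          simp
    · apply SuperFun.ext
      · rw [TrivSqZeroExt.fst_sub]
        by_cases hn : n = 0
        · subst hn
          rw [e2, mul_zero, zero_add, coeff_rho_one]
          simp
        · rw [e1 n (by omega), coeff_rho_of_ne _ (by omega) (by omega)]
          simp
      · rw [TrivSqZeroExt.snd_sub, snd_coeff_of_odd ((hΦ t).parity_odd h)]
        by_cases hn : n = 0
        · subst hn
          rw [mul_zero, zero_add, coeff_rho_one]
          simp
        · rw [coeff_rho_of_ne _ (by omega) (by omega)]
          simp
  have hF : F = mkFun F.fst 0 + mkFun 0 F.snd := by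
    apply SuperFun.ext <;> simp
  have hrho : rho F = rho (mkFun F.fst 0) + rho (mkFun 0 F.snd) := by
    simp only [rho_eq_homogeneousSeries]
    apply SPDO.ext
    intro j
    rw [coeff_add]
    rcases int_trichotomy j with h | ⟨n, rfl⟩ | ⟨n, rfl⟩
    · simp only [coeff_homogeneousSeries_of_lt _ _ h, add_zero]
    · simp only [coeff_homogeneousSeries_even]
      apply SuperFun.ext <;> simp
    · simp only [coeff_homogeneousSeries_odd]
      apply SuperFun.ext <;> simp
  rw [hrho, hF, map_add, ← hF, add_sub_add_comm]
  exact (ev _).add (od _)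

end Curve

/-! ### Families of operators -/

section Families

variable {ι : Type*}

/-- Coefficients of a composition of two families of operators of bounded order. -/
theorem coeff_comp_mem {W₁ W₂ W₃ : AddSubgroup (ι → SuperFun 𝕜)}
    (hmul : ∀ u ∈ W₁, ∀ v ∈ W₂, (fun i => u i * v i) ∈ W₃)
    (heta : ∀ v ∈ W₂, (fun i => eta (v i)) ∈ W₂)
    (hsigma : ∀ v ∈ W₂, (fun i => sigma (v i)) ∈ W₂) {A B : ι → SPDO 𝕜} {M N : ℤ}
    (hM : ∀ i, OrdLE (A i) M) (hN : ∀ i, OrdLE (B i) N)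
    (hA : ∀ k, (fun i => coeff (A i) k) ∈ W₁) (hB : ∀ k, (fun i => coeff (B i) k) ∈ W₂) (p : ℤ) :
    (fun i => coeff (comp (A i) (B i)) p) ∈ W₃ := by
  have hpow : ∀ n : ℤ, ∀ v ∈ W₂, (fun i => sigmaPow n (v i)) ∈ W₂ := fun n v hv => by
    rcases Int.even_or_odd n with h | h
    · simpa only [sigmaPow_even h] using hv
    · simpa only [sigmaPow_odd h] using hsigma v hv
  have hiter : ∀ n : ℕ, ∀ v ∈ W₂, (fun i => eta^[n] (v i)) ∈ W₂ := fun n => by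
    induction n with
    | zero => exact fun v hv => hv
    | succ n ih =>
      intro v hv
      simp only [Function.iterate_succ_apply']
      exact heta _ (ih v hv)
  have hq : ∀ m, (fun i => etaPowCoeff m (B i) p) ∈ W₂ := fun m => by
    have hK : N < p - m + ((N - p + m + 1).toNat : ℤ) := by omega
    have : (fun i => etaPowCoeff m (B i) p) = ∑ k ∈ Finset.range (N - p + m + 1).toNat,
        superBinom m k • fun i => eta^[k] (sigmaPow (m - k) (coeff (B i) (p - m + k))) := by
      funext i
      rw [etaPowCoeff_eq_sum (hN i) hK, Finset.sum_apply]
      rfl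
    rw [this]
    exact sum_mem fun k _ => zsmul_mem (hiter _ _ (hpow _ _ (hB _))) _
  have : (fun i => coeff (comp (A i) (B i)) p) =
      ∑ m ∈ Finset.Icc (p - N) M, fun i => coeff (A i) m * etaPowCoeff m (B i) p := by
    funext i
    rw [coeff_comp_eq_sum (hM i) (hN i) le_rfl le_rfl, Finset.sum_apply]
  rw [this]
  exact sum_mem fun m _ => hmul _ (hA m) _ (hq m)

/-- Coefficients of `exp(ad G) A - A` for families of operators. -/
theorem coeff_expAd_sub_mem {W₁ W W' : AddSubgroup (ι → SuperFun 𝕜)} (hW : W' ≤ W)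
    (hmul : ∀ u ∈ W₁, ∀ v ∈ W, (fun i => u i * v i) ∈ W')
    (heta₁ : ∀ v ∈ W₁, (fun i => eta (v i)) ∈ W₁)
    (hsigma₁ : ∀ v ∈ W₁, (fun i => sigma (v i)) ∈ W₁)
    (heta : ∀ v ∈ W, (fun i => eta (v i)) ∈ W)
    (hsigma : ∀ v ∈ W, (fun i => sigma (v i)) ∈ W)
    (hsmul : ∀ r : 𝕜, ∀ v ∈ W', (fun i => r • v i) ∈ W')
    {G A : ι → SPDO 𝕜} (hG : ∀ i, parity (G i) = G i) (h0 : ∀ i, OrdLE (G i) 0) {N : ℤ}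
    (hN : ∀ i, OrdLE (A i) N) (hGW : ∀ k, (fun i => coeff (G i) k) ∈ W₁)
    (hA : ∀ k, (fun i => coeff (A i) k) ∈ W) (p : ℤ) :
    (fun i => coeff (expAd (G i) (hG i) (h0 i) (A i) - A i) p) ∈ W' := by
  have hN' : ∀ i, OrdLE (A i) (2 * |N|) := fun i => (hN i).mono (by
    have := le_abs_self N
    have := abs_nonneg N
    omega)
  -- One application of ad G already takes coefficients in `W` to the smaller class `W'`, and every
  -- term of the exponential series beyond the first contains such an application.
  have had : ∀ B : ι → SPDO 𝕜, (∀ i, OrdLE (B i) (2 * |N|)) → (∀ k, (fun i => coeff (B i) k) ∈ W) →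
      ∀ k, (fun i => coeff (adL (G i) (B i)) k) ∈ W' := fun B hB hBW k => by
    simp only [adL_eq (hG _), coeff_sub]
    refine sub_mem (coeff_comp_mem hmul heta hsigma h0 hB hGW hBW k)
      (coeff_comp_mem (fun u hu v hv => ?_) heta₁ hsigma₁ hB h0 hBW hGW k)
    simp only [mul_comm (u _)]
    exact hmul v hv u hu
  have hle : ∀ n i, OrdLE ((adL (G i) ^ n) (A i)) (2 * |N|) := fun n i =>
    (ordLE_adL_pow (hG i) (h0 i) (hN' i) n).mono (by omega)
  have hpow : ∀ n k, (fun i => coeff ((adL (G i) ^ (n + 1)) (A i)) k) ∈ W' := by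
    intro n
    induction n with
    | zero =>
      simp only [zero_add, pow_one]
      exact had A hN' hA
    | succ n ih =>
      simp only [pow_succ' (adL (G _)) (n + 1), Module.End.mul_apply]
      exact had _ (hle (n + 1)) fun k => hW (ih k)
  obtain ⟨K, hK⟩ : ∃ K : ℕ, N < p + (K + 1 : ℕ) := ⟨(N - p).toNat, by push_cast; omega⟩
  have : (fun i => coeff (expAd (G i) (hG i) (h0 i) (A i) - A i) p) =
      ∑ n ∈ Finset.range K, fun i => (1 / ((n + 1).factorial : 𝕜)) •
        coeff ((adL (G i) ^ (n + 1)) (A i)) p := by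
    funext i
    rw [coeff_sub, coeff_expAd _ _ _ (hN i) hK, Finset.sum_range_succ', Finset.sum_apply, pow_zero,
      Module.End.one_apply, Nat.factorial_zero, Nat.cast_one, div_one, one_smul, add_sub_cancel_right]
  rw [this]
  exact sum_mem fun n _ => hsmul _ _ (hpow n p)

end Families

/-- Differential operators with values in functions on the supercircle. -/
def superDiffOps (𝕜 : Type*) [RCLike 𝕜] : AddSubgroup (CircleFun 𝕜 → SuperFun 𝕜) where
  carrier := {u | IsDiffOp (fun f => (u f).fst) ∧ IsDiffOp fun f => (u f).snd}
  zero_mem' := ⟨isDiffOp_zero, isDiffOp_zero⟩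
  add_mem' hu hv := ⟨isDiffOp_add hu.1 hv.1, isDiffOp_add hu.2 hv.2⟩
  neg_mem' hu := ⟨isDiffOp_neg hu.1, isDiffOp_neg hu.2⟩

/-- Constant families. -/
def constFamilies (ι 𝕜 : Type*) [RCLike 𝕜] : AddSubgroup (ι → SuperFun 𝕜) where
  carrier := {u | ∃ F, ∀ i, u i = F}
  zero_mem' := ⟨0, fun _ => rfl⟩
  add_mem' := by
    rintro u v ⟨F, hF⟩ ⟨G, hG⟩
    exact ⟨F + G, fun i => by rw [Pi.add_apply, hF, hG]⟩
  neg_mem' := by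
    rintro u ⟨F, hF⟩
    exact ⟨-F, fun i => by rw [Pi.neg_apply, hF]⟩

theorem coeff_expAd_mem_superDiffOps {G : SPDO 𝕜} (hG : parity G = G) (h0 : OrdLE G 0)
    {A : CircleFun 𝕜 → SPDO 𝕜} {N : ℤ} (hN : ∀ f, OrdLE (A f) N)
    (hA : ∀ k, (fun f => coeff (A f) k) ∈ superDiffOps 𝕜) (k : ℤ) :
    (fun f => coeff (expAd G hG h0 (A f)) k) ∈ superDiffOps 𝕜 := by
  have := coeff_expAd_sub_mem (W₁ := constFamilies (CircleFun 𝕜) 𝕜) (W := superDiffOps 𝕜)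
    (W' := superDiffOps 𝕜) le_rfl ?_ ?_ ?_ ?_ ?_ ?_ (fun _ => hG) (fun _ => h0) hN
    (fun k => ⟨coeff G k, fun _ => rfl⟩) hA k
  · have := add_mem this (hA k)
    convert this using 1
    funext f
    rw [Pi.add_apply, coeff_sub, sub_add_cancel]
  · rintro u ⟨F, hF⟩ v ⟨hv1, hv2⟩
    constructor
    · simp only [hF, SuperFun.fst_mul]
      exact isDiffOp_mul _ hv1
    · simp only [hF, SuperFun.snd_mul]
      exact isDiffOp_add (isDiffOp_mul _ hv2) (isDiffOp_mul _ hv1)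
  · rintro u ⟨F, hF⟩
    exact ⟨eta F, fun i => congrArg eta (hF i)⟩
  · rintro u ⟨F, hF⟩
    exact ⟨sigma F, fun i => congrArg sigma (hF i)⟩
  · rintro v ⟨hv1, hv2⟩
    constructor
    · simpa only [fst_eta] using hv2
    · simpa only [snd_eta] using isDiffOp_ddx hv1
  · rintro v ⟨hv1, hv2⟩
    constructor
    · simpa only [fst_sigma] using hv1
    · simpa only [snd_sigma] using isDiffOp_neg hv2
  · rintro r v ⟨hv1, hv2⟩
    exact ⟨isDiffOp_smul r hv1, isDiffOp_smul r hv2⟩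

theorem ordLE_expAd {G : SPDO 𝕜} (hG : parity G = G) (h0 : OrdLE G 0) {A : SPDO 𝕜} {a : ℤ}
    (ha : OrdLE A a) : OrdLE (expAd G hG h0 A) a := fun k hk => by
  rw [coeff_expAd G hG h0 ha (N := 0) (by simpa using hk), Finset.sum_range_zero]

/-- Conjugation of a homomorphism. -/
theorem IsRep.expAd_comp {φ : SuperFun 𝕜 →ₗ[𝕜] SPDO 𝕜} (hφ : IsRep φ) {G : SPDO 𝕜}
    (hG : parity G = G) (h0 : OrdLE G 0) :
    IsRep ((expAd G hG h0).toLinearMap ∘ₗ φ) := by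
  obtain ⟨N, hN⟩ := hφ.bounded
  have he := coeff_expAd_mem_superDiffOps hG h0 (A := fun f => φ (mkFun f 0)) (fun f => hN _)
    fun k => ⟨hφ.fst_even k, hφ.snd_even k⟩
  have ho := coeff_expAd_mem_superDiffOps hG h0 (A := fun f => φ (mkFun 0 f)) (fun f => hN _)
    fun k => ⟨hφ.fst_odd k, hφ.snd_odd k⟩
  exact
    { map_bracket := fun F G => by
        simp only [LinearMap.comp_apply, LinearEquiv.coe_coe, hφ.map_bracket, expAd_superBracket]
      even := fun F => by
        simp only [LinearMap.comp_apply, LinearEquiv.coe_coe, ← hφ.even, expAd_parity]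
      bounded := ⟨N, fun F => ordLE_expAd hG h0 (hN F)⟩
      fst_even := fun k => (he k).1
      snd_even := fun k => (he k).2
      fst_odd := fun k => (ho k).1
      snd_odd := fun k => (ho k).2 }

/-! ### Normalization by conjugation -/

theorem etaPowComp_monomial_one (m n : ℤ) :
    etaPowComp m (monomial (1 : SuperFun 𝕜) n) = monomial 1 (m + n) := by
  have hs : sigma (1 : SuperFun 𝕜) = 1 := by apply SuperFun.ext <;> simp
  have he : eta (1 : SuperFun 𝕜) = 0 := by apply SuperFun.ext <;> simp
  have hp : ∀ k : ℤ, sigmaPow k (1 : SuperFun 𝕜) = 1 := fun k => by simp [sigmaPow, hs]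
  apply SPDO.ext
  intro p
  rw [coeff_etaPowComp, etaPowCoeff_eq_sum (ordLE_monomial 1 n)
    (K := (n - p + m).toNat + 1) (by push_cast; omega), coeff_monomial, Finset.sum_range_succ',
    Finset.sum_eq_zero, zero_add, superBinom_zero, coeff_monomial]
  · split_ifs <;> first | omega | simp [hp]
  · intro k _
    rw [coeff_monomial]
    split_ifs with hk
    · rw [hp, Function.iterate_succ_apply, he, iterate_eta_zero, smul_zero]
    · rw [sigmaPow_zero, iterate_eta_zero, smul_zero]

theorem coeff_comp_monomial_one (X : SPDO 𝕜) (n k : ℤ) :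
    coeff (comp X (monomial 1 n)) k = coeff X (k - n) := by
  have h : ∀ m, etaPowCoeff m (monomial (1 : SuperFun 𝕜) n) k = if m = k - n then 1 else 0 :=
    fun m => by
      rw [← coeff_etaPowComp, etaPowComp_monomial_one, coeff_monomial]
      split_ifs <;> first | omega | rfl
  rw [coeff_comp, finsum_eq_single _ (k - n) fun m hm => by rw [h, if_neg hm, mul_zero], h,
    if_pos rfl, mul_one]

theorem monomial_one_comp (X : SPDO 𝕜) : comp (monomial 1 1) X = etaComp X := by
  rw [monomial_comp, etaPowComp_one]
  exact SPDO.ext fun k => one_mul _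

/-- In the commutator with η the θ-free part of X_{k-1} cancels and its θ-part doubles, while the
θ-free part of X_k enters through its derivative. These are the two parameters that normalize the
image of v_θ. -/
theorem coeff_adL_eta {X : SPDO 𝕜} (hX : parity X = X) (k : ℤ) :
    coeff (adL X (monomial 1 1)) k = coeff X (k - 1) - (eta (coeff X k) + sigma (coeff X (k - 1))) := by
  rw [adL_eq hX, coeff_sub, coeff_comp_monomial_one, monomial_one_comp, coeff_etaComp]

theorem rho_theta : rho (theta : SuperFun 𝕜) = (1 / 2 : 𝕜) • monomial 1 1 := by
  apply SPDO.ext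
  intro k
  rw [coeff_smul, coeff_monomial]
  by_cases h1 : k = 1
  · subst h1
    rw [coeff_rho_one, if_pos rfl]
    congr 1
    apply SuperFun.ext <;> simp
  · rw [if_neg h1, smul_zero]
    by_cases h2 : k = 2
    · subst h2
      rw [coeff_rho_two]
      apply SuperFun.ext <;> simp
    · exact coeff_rho_of_ne _ h2 h1

theorem ordLE_rho (F : SuperFun 𝕜) : OrdLE (rho F) 2 := fun _ hk =>
  coeff_rho_of_ne F (by omega) (by omega)

/-- The leading coefficient of the commutator with an operator that has the standard leading part. -/
theorem blkA_adL {X P : SPDO 𝕜} {f : CircleFun 𝕜} {M : ℤ} (hX : parity X = X)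
    (hM : OrdLE X (2 * M)) (hP : parity P = P) (hPf : OrdLE (P - rho (mkFun f 0)) 0) :
    blkA (adL X P) M = (M : 𝕜) • (blkA X M * ddx f) - f * ddx (blkA X M) := by
  have h1 : ∀ k, M < k → blkA X k = 0 := fun k hk => by
    rw [blkA, hM _ (by omega), TrivSqZeroExt.fst_zero]
  have h2 : ∀ k, 0 < k → blkA P k = blkA (rho (mkFun f 0)) k := fun k hk => by
    have := congrArg TrivSqZeroExt.fst (hPf (2 * k) (by omega))
    rw [coeff_sub, TrivSqZeroExt.fst_sub, TrivSqZeroExt.fst_zero] at this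
    exact sub_eq_zero.1 this
  have h3 : ∀ k, 1 < k → blkA P k = 0 := fun k hk => by
    rw [h2 k (by omega), blkA_rho, if_neg (by omega)]
  have h4 : blkA P 1 = f := by rw [h2 1 one_pos, blkA_rho, if_pos rfl]
  rw [adL_eq hX, blkA_sub, blkA_comp, blkA_comp, blkB_of_even hX, blkB_of_even hP, star_zero_left,
    star_zero_left, star_top_sub_one h1 h3 (by ring), star_top_sub_one h3 h1 (by ring), h4,
    Int.cast_one, one_smul]
  ring

/-- A homogeneous pair of terms of an even operator. -/
def evenPair (m : ℕ) (g q : CircleFun 𝕜) : SPDO 𝕜 :=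
  monomial (mkFun g 0) (2 * -(m : ℤ)) + monomial (mkFun 0 q) (2 * -(m : ℤ) - 1)

theorem coeff_evenPair_even (m : ℕ) (g q : CircleFun 𝕜) :
    coeff (evenPair m g q) (2 * -(m : ℤ)) = mkFun g 0 := by
  rw [evenPair, coeff_add, coeff_monomial, coeff_monomial, if_pos rfl, if_neg (by omega), add_zero]

theorem coeff_evenPair_odd (m : ℕ) (g q : CircleFun 𝕜) :
    coeff (evenPair m g q) (2 * -(m : ℤ) - 1) = mkFun 0 q := by
  rw [evenPair, coeff_add, coeff_monomial, coeff_monomial, if_pos rfl, if_neg (by omega), zero_add]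

theorem coeff_evenPair_of_ne (m : ℕ) (g q : CircleFun 𝕜) {k : ℤ} (h1 : k ≠ 2 * -(m : ℤ))
    (h2 : k ≠ 2 * -(m : ℤ) - 1) : coeff (evenPair m g q) k = 0 := by
  rw [evenPair, coeff_add, coeff_monomial, coeff_monomial, if_neg h1, if_neg h2, add_zero]

theorem ordLE_evenPair (m : ℕ) (g q : CircleFun 𝕜) : OrdLE (evenPair m g q) (2 * -(m : ℤ)) :=
  fun k hk => coeff_evenPair_of_ne m g q (by omega) (by omega)

theorem parity_evenPair (m : ℕ) (g q : CircleFun 𝕜) :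
    parity (evenPair m g q) = evenPair m g q := by
  apply SPDO.ext
  intro k
  rw [coeff_parity]
  by_cases h1 : k = 2 * -(m : ℤ)
  · rw [if_pos ⟨-m, by omega⟩, h1, coeff_evenPair_even, sigma_even]
  by_cases h2 : k = 2 * -(m : ℤ) - 1
  · rw [if_neg (Int.not_even_iff_odd.2 ⟨-m - 1, by omega⟩), h2, coeff_evenPair_odd, sigma_odd,
      neg_neg]
  · rw [coeff_evenPair_of_ne m g q h1 h2]
    simp

/-- Even operators of nonpositive order. -/
def EvenLE (𝕜 : Type*) [RCLike 𝕜] : Type _ := {G : SPDO 𝕜 // parity G = G ∧ OrdLE G 0}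

/-- Conjugation by the exponential. -/
def EvenLE.conj (G : EvenLE 𝕜) : SPDO 𝕜 ≃ₗ[𝕜] SPDO 𝕜 := expAd G.1 G.2.1 G.2.2

/-- Adding a pair of terms. -/
def EvenLE.addPair (G : EvenLE 𝕜) (m : ℕ) (g q : CircleFun 𝕜) : EvenLE 𝕜 :=
  ⟨G.1 + evenPair m g q, by rw [parity_add, G.2.1, parity_evenPair],
    G.2.2.add ((ordLE_evenPair m g q).mono (by omega))⟩

/-- In the two orders -2m and -2m - 1 the new pair acts only through its commutator with `A` itself:
conjugation by the previous exponent and higher powers interfere from order -2m - 2 on. -/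
theorem ordLE_conj_addPair_sub (G : EvenLE 𝕜) (m : ℕ) (g q : CircleFun 𝕜) {A : SPDO 𝕜}
    (hA : OrdLE A 2) : OrdLE ((G.addPair m g q).conj A - G.conj A - adL (evenPair m g q) A)
      (2 * -(m : ℤ) - 2) :=
  (ordLE_expAd_add_sub G.1 (evenPair m g q) G.2.1 G.2.2 (parity_evenPair m g q)
    (ordLE_evenPair m g q) (G.addPair m g q).2.1 (G.addPair m g q).2.2 (a := 1) hA).mono (by omega)

/-! ### Effect of one more pair of terms in the exponent. -/

section Step

variable {φ : SuperFun 𝕜 →ₗ[𝕜] SPDO 𝕜}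

theorem ordLE_of_sub_rho (hρ : ∀ F, OrdLE (φ F - rho F) 0) (F : SuperFun 𝕜) : OrdLE (φ F) 2 := by
  have := ((hρ F).mono (b := 2) (by omega)).add (ordLE_rho F)
  rwa [sub_add_cancel] at this

/-- In these degrees the image of v_θ can be replaced by its leading part ½ η, since the rest has
order at most zero and its commutator with the pair is too low. -/
theorem coeff_conj_addPair_theta (hρ : ∀ F, OrdLE (φ F - rho F) 0) (G : EvenLE 𝕜) (m : ℕ)
    (g q : CircleFun 𝕜) {k : ℤ} (hk : 2 * -(m : ℤ) - 2 < k) :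
    coeff ((G.addPair m g q).conj (φ theta)) k = coeff (G.conj (φ theta)) k +
      (1 / 2 : 𝕜) • coeff (adL (evenPair m g q) (monomial 1 1)) k := by
  have h1 := ordLE_conj_addPair_sub G m g q (ordLE_of_sub_rho hρ theta) k hk
  have h2 := ordLE_adL (parity_evenPair m g q) (ordLE_evenPair m g q) (a := 0)
    ((hρ theta).mono (by omega)) k (by omega)
  rw [map_sub, rho_theta, map_smul, coeff_sub, coeff_smul, sub_eq_zero] at h2
  rw [coeff_sub, coeff_sub, h2] at h1
  linear_combination h1

theorem fst_conj_addPair_theta (hρ : ∀ F, OrdLE (φ F - rho F) 0) (G : EvenLE 𝕜) (m : ℕ)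
    (g q : CircleFun 𝕜) :
    (coeff ((G.addPair m g q).conj (φ theta)) (2 * -(m : ℤ) - 1)).fst =
      (coeff (G.conj (φ theta)) (2 * -(m : ℤ) - 1)).fst - (1 / 2 : 𝕜) • q := by
  rw [coeff_conj_addPair_theta hρ G m g q (by omega), coeff_adL_eta (parity_evenPair m g q),
    coeff_evenPair_odd, coeff_evenPair_of_ne m g q (by omega) (by omega)]
  simp [sub_eq_add_neg]

theorem snd_conj_addPair_theta (hρ : ∀ F, OrdLE (φ F - rho F) 0) (G : EvenLE 𝕜) (m : ℕ)
    (g q : CircleFun 𝕜) :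
    (coeff ((G.addPair m g q).conj (φ theta)) (2 * -(m : ℤ))).snd =
      (coeff (G.conj (φ theta)) (2 * -(m : ℤ))).snd + q - (1 / 2 : 𝕜) • ddx g := by
  rw [coeff_conj_addPair_theta hρ G m g q (by omega), coeff_adL_eta (parity_evenPair m g q),
    coeff_evenPair_odd, coeff_evenPair_even]
  simp only [TrivSqZeroExt.snd_add, TrivSqZeroExt.snd_smul, TrivSqZeroExt.snd_sub, snd_mkFun,
    snd_eta, snd_sigma, fst_mkFun]
  module

/-- For a local coordinate at the origin the value at the origin moves by -m g(0). When m ≠ 0, the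
constant term of g is therefore available for a further normalization that does not disturb the
image of v_θ in these degrees. -/
theorem blkA_conj_addPair (hρ : ∀ F, OrdLE (φ F - rho F) 0)
    (he : ∀ F, parity (φ F) = φ (sigma F)) (G : EvenLE 𝕜) (m : ℕ) (g q f : CircleFun 𝕜) :
    blkA ((G.addPair m g q).conj (φ (mkFun f 0))) (-m) =
      blkA (G.conj (φ (mkFun f 0))) (-m) - (m : 𝕜) • (g * ddx f) - f * ddx g := by
  have h1 := congrArg TrivSqZeroExt.fst (ordLE_conj_addPair_sub G m g q
    (ordLE_of_sub_rho hρ (mkFun f 0)) (2 * -(m : ℤ)) (by omega))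
  have h2 := blkA_adL (parity_evenPair m g q) (ordLE_evenPair m g q)
    (P := φ (mkFun f 0)) (by rw [he, sigma_even]) (hρ _)
  have h3 : blkA (evenPair m g q) (-(m : ℤ)) = g := by
    rw [blkA, coeff_evenPair_even, fst_mkFun]
  rw [h3] at h2
  change blkA ((G.addPair m g q).conj (φ (mkFun f 0))) (-m) -
      blkA (G.conj (φ (mkFun f 0))) (-m) - blkA (adL (evenPair m g q) (φ (mkFun f 0))) (-m) = 0 at h1
  rw [h2] at h1
  push_cast at h1
  rw [neg_smul] at h1
  linear_combination h1

end Step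

/-! ### Construction of the conjugating operator. -/

section Gauge

variable (φ : SuperFun 𝕜 →ₗ[𝕜] SPDO 𝕜)

/-- The correction of `fst` type in step `m`. -/
def gaugeEven (m : ℕ) (G : EvenLE 𝕜) : CircleFun 𝕜 :=
  -- By `snd_conj_addPair_theta`, with q twice the coefficient at η^(-2m-1), the θ-component becomes
  -- constant when g' is this function minus its mean. The mean cannot be removed and remains as a
  -- constant multiple of θ.
  antideriv ((2 : 𝕜) • (coeff (G.conj (φ theta)) (2 * -(m : ℤ))).snd +
      (4 : 𝕜) • (coeff (G.conj (φ theta)) (2 * -(m : ℤ) - 1)).fst) +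
    -- As `antideriv` vanishes at the origin, this constant is g(0), chosen to cancel the value at
    -- the origin in `blkA_conj_addPair`. For m = 0 nothing can be cancelled and division by zero
    -- makes the constant zero.
    algebraMap 𝕜 _ (evalAt 𝕜 0 (blkA (G.conj (φ (mkFun (locMon 1 0) 0))) (-m)) / m)

/-- The correction of `snd` type in step `m`. -/
def gaugeOdd (m : ℕ) (G : EvenLE 𝕜) : CircleFun 𝕜 :=
  (2 : 𝕜) • (coeff (G.conj (φ theta)) (2 * -(m : ℤ) - 1)).fst

/-- The approximations of the conjugating operator. -/
def gaugeSeq : ℕ → EvenLE 𝕜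
  | 0 => ⟨0, (parityL 𝕜).map_zero, OrdLE.zero 0⟩
  | m + 1 => (gaugeSeq m).addPair m (gaugeEven φ m (gaugeSeq m)) (gaugeOdd φ m (gaugeSeq m))

theorem ordLE_gaugeSeq_sub {m n : ℕ} (h : m ≤ n) :
    OrdLE ((gaugeSeq φ n).1 - (gaugeSeq φ m).1) (2 * -(m : ℤ)) := by
  induction n, h using Nat.le_induction with
  | base => rw [sub_self]; exact OrdLE.zero _
  | succ n hn ih =>
    have := ih.add ((ordLE_evenPair n (gaugeEven φ n (gaugeSeq φ n))
      (gaugeOdd φ n (gaugeSeq φ n))).mono (b := 2 * -(m : ℤ)) (by omega))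
    rwa [sub_add_eq_add_sub] at this

/-- The conjugating operator. -/
def gaugeOp : SPDO 𝕜 :=
  -- From step 1 - k on, the added pairs have order at most -2(1 - k), which is below k when k ≤ 0,
  -- so the coefficient at η^k is final.
  ⟨fun k => coeff (gaugeSeq φ (1 - k).toNat).1 k, 0, fun k hk => (gaugeSeq φ _).2.2 k hk⟩

theorem coeff_gaugeOp (k : ℤ) : coeff (gaugeOp φ) k = coeff (gaugeSeq φ (1 - k).toNat).1 k := rfl

theorem parity_gaugeOp : parity (gaugeOp φ) = gaugeOp φ := by
  apply SPDO.ext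
  intro k
  have h := congrArg (fun X => coeff X k) (gaugeSeq φ (1 - k).toNat).2.1
  simp only [coeff_parity] at h
  rw [coeff_parity, coeff_gaugeOp, h]

/-- The conjugating operator, as an even operator of nonpositive order. -/
def gauge : EvenLE 𝕜 :=
  ⟨gaugeOp φ, parity_gaugeOp φ, fun k hk => (gaugeSeq φ (1 - k).toNat).2.2 k hk⟩

theorem coeff_gauge (k : ℤ) : coeff (gauge φ).1 k = coeff (gaugeSeq φ (1 - k).toNat).1 k := rfl

theorem ordLE_gauge_sub (m : ℕ) : OrdLE ((gauge φ).1 - (gaugeSeq φ m).1) (2 * -(m : ℤ)) := by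
  intro k hk
  rw [coeff_sub, coeff_gauge]
  by_cases h0 : 0 < k
  · rw [(gaugeSeq φ _).2.2 k h0, (gaugeSeq φ _).2.2 k h0, sub_zero]
  rcases le_total m (1 - k).toNat with h | h
  · rw [← coeff_sub]
    exact ordLE_gaugeSeq_sub φ h k hk
  · rw [← neg_sub, ← coeff_sub, ordLE_gaugeSeq_sub φ h k (by omega), neg_zero]

/-- The part of the exponent added from step m on has order at most -2m, and ad of it sends order
two to at most -2m. Hence the normalization achieved in degrees -2m and -2m - 1 is final after step
m + 1. -/
theorem ordLE_conj_gauge_sub (m : ℕ) {A : SPDO 𝕜} (hA : OrdLE A 2) :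
    OrdLE ((gauge φ).conj A - (gaugeSeq φ m).conj A) (2 * -(m : ℤ)) := by
  have hX : parity ((gauge φ).1 - (gaugeSeq φ m).1) = (gauge φ).1 - (gaugeSeq φ m).1 := by
    rw [parity_sub, (gauge φ).2.1, (gaugeSeq φ m).2.1]
  have e : (gaugeSeq φ m).1 + ((gauge φ).1 - (gaugeSeq φ m).1) = (gauge φ).1 := by abel
  have h1 := ordLE_expAd_add_sub (gaugeSeq φ m).1 ((gauge φ).1 - (gaugeSeq φ m).1)
    (gaugeSeq φ m).2.1 (gaugeSeq φ m).2.2 hX (ordLE_gauge_sub φ m)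
    (by rw [e]; exact (gauge φ).2.1) (by rw [e]; exact (gauge φ).2.2) (a := 1) hA
  have h2 := ordLE_adL hX (ordLE_gauge_sub φ m) (a := 1) hA
  have h3 := (h1.mono (b := 2 * -(m : ℤ)) (by omega)).add (h2.mono (b := 2 * -(m : ℤ)) (by omega))
  rw [sub_add_cancel] at h3
  simp only [e] at h3
  exact h3

variable {φ}

theorem fst_conj_gauge_theta (hρ : ∀ F, OrdLE (φ F - rho F) 0) (m : ℕ) :
    (coeff ((gauge φ).conj (φ theta)) (2 * -(m : ℤ) - 1)).fst = 0 := by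
  have h := ordLE_conj_gauge_sub φ (m + 1) (ordLE_of_sub_rho hρ theta) (2 * -(m : ℤ) - 1)
    (by push_cast; omega)
  rw [coeff_sub, sub_eq_zero] at h
  rw [h, gaugeSeq, fst_conj_addPair_theta hρ, gaugeOdd, smul_smul]
  norm_num

theorem snd_conj_gauge_theta (hρ : ∀ F, OrdLE (φ F - rho F) 0) (m : ℕ) :
    ∃ μ : 𝕜, (coeff ((gauge φ).conj (φ theta)) (2 * -(m : ℤ))).snd = algebraMap 𝕜 _ μ := by
  have h := ordLE_conj_gauge_sub φ (m + 1) (ordLE_of_sub_rho hρ theta) (2 * -(m : ℤ))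
    (by push_cast; omega)
  rw [coeff_sub, sub_eq_zero] at h
  rw [h, gaugeSeq, snd_conj_addPair_theta hρ, gaugeOdd, gaugeEven, ddx_add, ddx_algebraMap,
    ddx_antideriv, add_zero]
  refine ⟨(1 / 2 : 𝕜) * mean ((2 : 𝕜) •
    (coeff ((gaugeSeq φ m).conj (φ theta)) (2 * -(m : ℤ))).snd +
      (4 : 𝕜) • (coeff ((gaugeSeq φ m).conj (φ theta)) (2 * -(m : ℤ) - 1)).fst), ?_⟩
  rw [map_mul, ← Algebra.smul_def]
  module

theorem evalAt_conj_gauge (hρ : ∀ F, OrdLE (φ F - rho F) 0)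
    (he : ∀ F, parity (φ F) = φ (sigma F)) {m : ℕ} (hm : m ≠ 0) :
    evalAt 𝕜 0 (blkA ((gauge φ).conj (φ (mkFun (locMon 1 0) 0))) (-m)) = 0 := by
  have h := ordLE_conj_gauge_sub φ (m + 1) (ordLE_of_sub_rho hρ (mkFun (locMon 1 0) 0))
    (2 * -(m : ℤ)) (by push_cast; omega)
  rw [coeff_sub, sub_eq_zero] at h
  have hm0 : (m : 𝕜) ≠ 0 := by exact_mod_cast hm
  have h2 := congrArg (fun F => evalAt 𝕜 0 (TrivSqZeroExt.fst F)) h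
  have h3 := congrArg (evalAt 𝕜 0) (blkA_conj_addPair hρ he (gaugeSeq φ m) m
    (gaugeEven φ m (gaugeSeq φ m)) (gaugeOdd φ m (gaugeSeq φ m)) (locMon 1 0))
  refine (h2.trans h3).trans ?_
  rw [map_sub, map_sub, map_smul, evalAt_mul, evalAt_mul, evalAt_ddx_locMon_one, evalAt_locMon,
    if_neg one_ne_zero, zero_mul, sub_zero, mul_one, gaugeEven, map_add, evalAt_algebraMap,
    evalAt_apply 0 (antideriv _), antideriv_apply_zero, zero_add, smul_eq_mul, mul_div_cancel₀ _ hm0,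
    sub_self]

theorem ordLE_conj_gauge_sub_rho (hρ : ∀ F, OrdLE (φ F - rho F) 0) (F : SuperFun 𝕜) :
    OrdLE ((gauge φ).conj (φ F) - rho F) 0 := by
  have h := (ordLE_conj_gauge_sub φ 0 (ordLE_of_sub_rho hρ F)).add
    (((ordLE_expAd_sub (gaugeSeq φ 0).1 (gaugeSeq φ 0).2.1 (gaugeSeq φ 0).2.2 (a := 1)
      (ordLE_of_sub_rho hρ F)).mono (b := 0) (by omega)).add
      ((ordLE_adL (gaugeSeq φ 0).2.1 (m := 0) (gaugeSeq φ 0).2.2 (a := 1)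
        (ordLE_of_sub_rho hρ F)).mono (b := 0) (by omega)))
  have h' := h.add (hρ F)
  convert h' using 1
  · change _ = (gauge φ).conj (φ F) - (gaugeSeq φ 0).conj (φ F) + ((gaugeSeq φ 0).conj (φ F) -
      φ F - adL (gaugeSeq φ 0).1 (φ F) + adL (gaugeSeq φ 0).1 (φ F)) + (φ F - rho F)
    abel
  · simp

end Gauge

/-! ### The odd generator after normalization -/

theorem one_eq_mkFun : (1 : SuperFun 𝕜) = mkFun 1 0 := by
  apply SuperFun.ext <;> simp

/-- The contact bracket of θ with itself is 1/2, and the supercommutator of an odd operator with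
itself is twice its square. -/
theorem IsRep.map_one {φ : SuperFun 𝕜 →ₗ[𝕜] SPDO 𝕜} (hφ : IsRep φ) :
    φ (mkFun 1 0) = (4 : 𝕜) • comp (φ theta) (φ theta) := by
  have h := hφ.map_odd_odd 1 1
  have h1 : mkFun ((1 / 2 : 𝕜) • (1 * 1 : CircleFun 𝕜)) 0 = (1 / 2 : 𝕜) • mkFun 1 0 := by
    apply SuperFun.ext <;> simp
  rw [h1, map_smul, ← theta.eq_1] at h
  calc φ (mkFun 1 0) = (2 : 𝕜) • ((1 / 2 : 𝕜) • φ (mkFun 1 0)) := by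
        rw [smul_smul]; norm_num
    _ = _ := by rw [h]; module

theorem coeff_comp_eta_square (X : SPDO 𝕜) (k : ℤ) :
    coeff (comp (monomial 1 2) X - comp X (monomial 1 2)) k =
      mkFun (ddx (coeff X k).fst) (ddx (coeff X k).snd) := by
  have h2 : etaComp (etaComp X) = comp (monomial 1 2) X := by
    rw [← monomial_one_comp, ← monomial_one_comp, ← comp_assoc, monomial_one_comp]
    congr 1
    have := etaPowComp_monomial_one (𝕜 := 𝕜) 1 1
    rw [etaPowComp_one] at this
    exact this
  rw [← h2, coeff_sub, coeff_comp_monomial_one, coeff_etaComp, coeff_etaComp, coeff_etaComp,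
    show k - 1 - 1 = k - 2 by ring]
  apply SuperFun.ext
  · simp
  · simp [ddx_add]; ring

theorem blkA_comp_eta_square (X : SPDO 𝕜) (k : ℤ) :
    blkA (comp (monomial 1 2) X - comp X (monomial 1 2)) k = ddx (blkA X k) := by
  rw [blkA, coeff_comp_eta_square, fst_mkFun]
  rfl

/-- The square of an odd operator `½ η + Y`. -/
theorem square_eta_add {T : SPDO 𝕜} : (4 : 𝕜) • comp T T = monomial 1 2 +
    ((2 : 𝕜) • (comp (monomial 1 1) (T - (1 / 2 : 𝕜) • monomial 1 1) +
      comp (T - (1 / 2 : 𝕜) • monomial 1 1) (monomial 1 1)) +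
    (4 : 𝕜) • comp (T - (1 / 2 : 𝕜) • monomial 1 1) (T - (1 / 2 : 𝕜) • monomial 1 1)) := by
  have h : comp (monomial (1 : SuperFun 𝕜) 1) (monomial 1 1) = monomial 1 2 := by
    rw [monomial_one_comp, ← etaPowComp_one]
    exact etaPowComp_monomial_one 1 1
  simp only [comp_sub, sub_comp, comp_smul, smul_comp, h]
  module

/-- Conjugated homomorphisms in normal form up to order `-2m`: the next coefficient of the odd
generator vanishes. -/
theorem IsRep.square_coeff {φ : SuperFun 𝕜 →ₗ[𝕜] SPDO 𝕜} (hφ : IsRep φ) {m : ℕ} {μ : 𝕜}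
    (hm : OrdLE (φ theta - (1 / 2 : 𝕜) • monomial 1 1) (2 * -(m : ℤ)))
    (h0 : coeff (φ theta) (2 * -(m : ℤ)) = mkFun 0 (algebraMap 𝕜 _ μ))
    (h1 : coeff (φ theta) (2 * -(m : ℤ) - 1) = 0) :
    OrdLE (φ (mkFun 1 0) - monomial 1 2) (2 * -(m : ℤ)) ∧
      (coeff (φ (mkFun 1 0) - monomial 1 2) (2 * -(m : ℤ))).fst = algebraMap 𝕜 _ (2 * μ) := by
  rw [hφ.map_one, square_eta_add, add_sub_cancel_left]
  set Y := φ theta - (1 / 2 : 𝕜) • monomial 1 1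
  have y0 : coeff Y (2 * -(m : ℤ)) = mkFun 0 (algebraMap 𝕜 _ μ) := by
    rw [coeff_sub, h0, coeff_smul, coeff_monomial, if_neg (by omega), smul_zero, sub_zero]
  have y1 : coeff Y (2 * -(m : ℤ) - 1) = 0 := by
    rw [coeff_sub, h1, coeff_smul, coeff_monomial, if_neg (by omega), smul_zero, sub_zero]
  have hs : ∀ k, coeff (comp (monomial 1 1) Y + comp Y (monomial 1 1)) k =
      eta (coeff Y k) + sigma (coeff Y (k - 1)) + coeff Y (k - 1) := fun k => by
    rw [coeff_add, coeff_comp_monomial_one, monomial_one_comp, coeff_etaComp]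
  have hYY : OrdLE (comp Y Y) (2 * -(m : ℤ)) := (hm.comp hm).mono (by omega)
  -- The square of `Y` does not contribute at order -2m: for m = 0 its top coefficient is a product
  -- of two multiples of θ, and for m > 0 its order is at most -4m.
  have hYY0 : coeff (comp Y Y) (2 * -(m : ℤ)) = 0 := by
    rcases Nat.eq_zero_or_pos m with rfl | hpos
    · have := coeff_comp_top hm hm
      rw [show (2 : ℤ) * -((0 : ℕ) : ℤ) = 0 by simp] at *
      rw [add_zero] at this
      rw [this, y0]
      apply SuperFun.ext <;> simp [sigmaPow]
    · exact hm.comp hm _ (by omega)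
  constructor
  -- The only possible term above order -2m is at -2m + 1, where σ(Y) and Y cancel because the
  -- coefficient of `Y` is the odd function μ θ.
  · refine OrdLE.add (OrdLE.smul _ fun k hk => ?_) (hYY.smul _)
    rw [hs, hm k hk, eta_zero, zero_add]
    by_cases hk1 : k - 1 = 2 * -(m : ℤ)
    · rw [hk1, y0, sigma_odd, neg_add_cancel]
    · rw [hm _ (by omega), sigma_zero, add_zero]
  · rw [coeff_add, coeff_smul, coeff_smul, hYY0, smul_zero, add_zero, hs, y1, y0]
    simp only [sigma_zero, add_zero, TrivSqZeroExt.fst_smul, fst_eta, snd_mkFun]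
    rw [map_mul, ← Algebra.smul_def]

/-- In negative order the next coefficient vanishes. -/
theorem IsRep.eq_zero_of_square {φ : SuperFun 𝕜 →ₗ[𝕜] SPDO 𝕜} (hφ : IsRep φ)
    (hρ : ∀ F, OrdLE (φ F - rho F) 0) {m : ℕ} (hm0 : m ≠ 0) {μ : 𝕜}
    (hW : OrdLE (φ (mkFun 1 0) - monomial 1 2) (2 * -(m : ℤ)))
    (hW0 : (coeff (φ (mkFun 1 0) - monomial 1 2) (2 * -(m : ℤ))).fst = algebraMap 𝕜 _ (2 * μ)) :
    μ = 0 := by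
  set W := φ (mkFun 1 0) - monomial 1 2 with hWdef
  have hpar : parity W = W := by
    rw [parity_sub, hφ.parity_even]
    congr 1
    apply even_of_components
    · intro k
      rw [coeff_monomial]
      split_ifs <;> simp
    · intro k
      rw [coeff_monomial, if_neg (by omega), TrivSqZeroExt.fst_zero]
  -- The image of v_1 is η² + W. In [v_1, v_f] = v_{f'} the part η² contributes the derivative of
  -- the coefficient, and the leading coefficient 2μ of W contributes -2μm f'.
  have key : ∀ f : CircleFun 𝕜, blkA (φ (mkFun (ddx f) 0)) (-m) =
      ddx (blkA (φ (mkFun f 0)) (-m)) - (2 * μ * m) • ddx f := fun f => by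
    have h1 := hφ.map_even_even 1 f
    rw [ddx_one, zero_mul, sub_zero, one_mul] at h1
    have h2 : comp (φ (mkFun 1 0)) (φ (mkFun f 0)) - comp (φ (mkFun f 0)) (φ (mkFun 1 0)) =
        (comp (monomial 1 2) (φ (mkFun f 0)) - comp (φ (mkFun f 0)) (monomial 1 2)) +
          adL W (φ (mkFun f 0)) := by
      rw [adL_eq hpar, hWdef, sub_comp, comp_sub]
      abel
    have h3 := blkA_adL hpar hW (hφ.parity_even f) (hρ _)
    have h4 : blkA W (-m) = algebraMap 𝕜 _ (2 * μ) := hW0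
    rw [h4, ddx_algebraMap, mul_zero, sub_zero, ← Algebra.smul_def, smul_smul] at h3
    rw [h1, h2, blkA_add, blkA_comp_eta_square, h3]
    push_cast
    module
  obtain ⟨N, a, ha⟩ := hφ.isDiffOp_blkA (-m)
  have ha' := isDiffOp_of_le ha (show N ≤ N + 2 by omega)
  set a' : ℕ → CircleFun 𝕜 := fun i => if i < N then a i else 0
  -- Comparison of the coefficients at f': a periodic function would have the constant derivative
  -- 2μm, which must then be zero.
  have h1 : ddx (a' 1) = algebraMap 𝕜 _ (2 * μ * m) := by
    refine ext_evalAt fun x => ?_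
    have h2 := ddx_diffOp ha' (locMon 1 x)
    beta_reduce at h2
    rw [key] at h2
    have h3 := congrArg (evalAt 𝕜 x) h2
    simp only [map_add, map_sub, map_smul, map_sum, evalAt_mul, evalAt_iterate_locMon, mul_ite,
      mul_one, mul_zero, Finset.sum_ite_eq', Finset.mem_range, evalAt_ddx_locMon_one] at h3
    rw [if_pos (by omega), smul_eq_mul, mul_one] at h3
    rw [evalAt_algebraMap]
    linear_combination -h3
  have h2 := eq_zero_of_ddx_eq_algebraMap h1
  have h3 : (m : 𝕜) ≠ 0 := by exact_mod_cast hm0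
  simpa [h3] using h2

theorem ordLE_gauge_conj (φ : SuperFun 𝕜 →ₗ[𝕜] SPDO 𝕜) : OrdLE (gauge φ).1 (2 * 0) := (gauge φ).2.2

/-- The `Θ₀`-component does not change under normalization. -/
theorem mean_blkA_conj_gauge {φ : SuperFun 𝕜 →ₗ[𝕜] SPDO 𝕜}
    (he : ∀ F, parity (φ F) = φ (sigma F)) (hρ : ∀ F, OrdLE (φ F - rho F) 0) :
    mean (blkA ((gauge φ).conj (φ (mkFun 1 0))) 0) = mean (blkA (φ (mkFun 1 0)) 0) := by
  have h1 := ordLE_expAd_sub (gauge φ).1 (gauge φ).2.1 (gauge φ).2.2 (a := 1)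
    (ordLE_of_sub_rho hρ (mkFun 1 0)) (2 * 0) (by omega)
  -- At order zero conjugation subtracts the derivative of the leading coefficient of the exponent,
  -- and a derivative has mean zero.
  have h2 := blkA_adL (gauge φ).2.1 (ordLE_gauge_conj φ) (P := φ (mkFun 1 0))
    (by rw [he, sigma_even]) (hρ _)
  have h3 := congrArg TrivSqZeroExt.fst h1
  change blkA ((gauge φ).conj (φ (mkFun 1 0))) 0 - blkA (φ (mkFun 1 0)) 0 -
    blkA (adL (gauge φ).1 (φ (mkFun 1 0))) 0 = 0 at h3
  rw [h2, Int.cast_zero, zero_smul, zero_sub, one_mul, sub_neg_eq_add] at h3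
  have h4 := congrArg (meanL 𝕜) h3
  rw [map_add, map_sub, map_zero] at h4
  have h5 : (meanL 𝕜) (ddx (blkA (gauge φ).1 0)) = 0 := mean_ddx _
  rw [h5, add_zero] at h4
  exact sub_eq_zero.1 h4

/-- After normalization the odd generator is that of the standard embedding. -/
theorem IsRep.conj_gauge_theta {φ : SuperFun 𝕜 →ₗ[𝕜] SPDO 𝕜} (hφ : IsRep φ)
    (hρ : ∀ F, OrdLE (φ F - rho F) 0) (h0 : mean (blkA (φ (mkFun 1 0)) 0) = 0) :
    (gauge φ).conj (φ theta) = (1 / 2 : 𝕜) • monomial 1 1 := by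
  have hψ := hφ.expAd_comp (gauge φ).2.1 (gauge φ).2.2
  set ψ := (expAd (gauge φ).1 (gauge φ).2.1 (gauge φ).2.2).toLinearMap ∘ₗ φ
  have hψρ : ∀ F, OrdLE (ψ F - rho F) 0 := ordLE_conj_gauge_sub_rho hρ
  change ψ theta = _
  have hodd : parity (ψ theta) = -ψ theta := hψ.parity_odd 1
  have c1 : ∀ m : ℕ, coeff (ψ theta) (2 * -(m : ℤ) - 1) = 0 := fun m => by
    apply SuperFun.ext
    · exact fst_conj_gauge_theta hρ m
    · rw [show 2 * -(m : ℤ) - 1 = 2 * (-(m : ℤ) - 1) + 1 by ring]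
      exact snd_coeff_of_odd hodd _
  have c0 : ∀ m : ℕ, ∃ μ : 𝕜, coeff (ψ theta) (2 * -(m : ℤ)) = mkFun 0 (algebraMap 𝕜 _ μ) :=
    fun m => by
      obtain ⟨μ, hμ⟩ := snd_conj_gauge_theta hρ m
      refine ⟨μ, SuperFun.ext ?_ ?_⟩
      · rw [fst_mkFun]
        exact fst_coeff_of_odd hodd _
      · rw [snd_mkFun]
        exact hμ
  have key : ∀ m : ℕ, OrdLE (ψ theta - (1 / 2 : 𝕜) • monomial 1 1) (2 * -(m : ℤ)) := by
    intro m
    induction m with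
    | zero =>
      have := hψρ theta
      rw [rho_theta] at this
      simpa using this
    | succ m ih =>
      obtain ⟨μ, hμ⟩ := c0 m
      obtain ⟨hW, hW0⟩ := hψ.square_coeff ih hμ (c1 m)
      have hμ0 : μ = 0 := by
        -- At order zero the constant 2μ is the Θ₀-component, zero by hypothesis; at negative order
        -- `IsRep.eq_zero_of_square` applies.
        rcases Nat.eq_zero_or_pos m with rfl | hpos
        · have h1 : blkA (ψ (mkFun 1 0)) 0 = algebraMap 𝕜 _ (2 * μ) := by
            rw [← hW0, coeff_sub, coeff_monomial, if_neg (by simp), sub_zero]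
            rfl
          have h2 := mean_blkA_conj_gauge hφ.even hρ
          rw [h0] at h2
          change mean (blkA (ψ (mkFun 1 0)) 0) = 0 at h2
          rw [h1, mean_algebraMap] at h2
          simpa using h2
        · exact hψ.eq_zero_of_square hψρ hpos.ne' hW hW0
      intro k hk
      by_cases hk0 : 2 * -(m : ℤ) < k
      · exact ih k hk0
      push_cast at hk
      rcases (by omega : k = 2 * -(m : ℤ) ∨ k = 2 * -(m : ℤ) - 1) with rfl | rfl
      · rw [coeff_sub, hμ, hμ0, coeff_smul, coeff_monomial, if_neg (by omega)]
        apply SuperFun.ext <;> simp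
      · rw [coeff_sub, c1, coeff_smul, coeff_monomial, if_neg (by omega), smul_zero, sub_zero]
  refine sub_eq_zero.1 (SPDO.ext fun k => ?_)
  exact key (1 - k).toNat k (by omega)

/-! ### Homomorphisms with the standard odd generator -/

theorem isDiffOp_ddx_iterate {φ : CircleFun 𝕜 → CircleFun 𝕜} (hφ : IsDiffOp φ) (j : ℕ) :
    IsDiffOp fun f => ddx^[j] (φ f) := by
  induction j with
  | zero => exact hφ
  | succ j ih =>
    simp only [Function.iterate_succ_apply']
    exact isDiffOp_ddx ih

theorem germEq_locMon_zero (x : ℝ) : GermEq x (locMon 0 x : CircleFun 𝕜) 1 := by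
  refine (locMon_eventuallyEq (𝕜 := 𝕜) 0 x).trans (Filter.Eventually.of_forall fun y => ?_)
  simp

theorem germEq_ddx_locMon_one (x : ℝ) : GermEq x (ddx (locMon 1 x : CircleFun 𝕜)) 1 :=
  (ddx_locMon_succ 0 x).trans (germEq_locMon_zero x)

/-- A translation invariant differential operator that kills constants maps a local coordinate to
a local constant. -/
theorem evalAt_iterate_invariant {φ : CircleFun 𝕜 → CircleFun 𝕜} (hφ : IsDiffOp φ)
    (hc : ∀ f, φ (ddx f) = ddx (φ f)) (h1 : φ 1 = 0) (j : ℕ) :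
    evalAt 𝕜 0 (ddx^[j] (φ (locMon 1 0))) =
      if j = 0 then evalAt 𝕜 0 (φ (locMon 1 0)) else 0 := by
  cases j with
  | zero => rfl
  | succ j =>
    rw [if_neg j.succ_ne_zero, Function.iterate_succ_apply, ← hc,
      evalAt_diffOp_congr (isDiffOp_ddx_iterate hφ j) (germEq_ddx_locMon_one 0), h1,
      iterate_ddx_zero, map_zero]

/-- Translation invariant differential operators that are homogeneous at the origin. -/
theorem eq_smul_iterate_of_invariant {φ : CircleFun 𝕜 → CircleFun 𝕜} (hφ : IsDiffOp φ)
    (hc : ∀ f, φ (ddx f) = ddx (φ f)) {n : ℕ}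
    (h : ∀ i, i ≠ n → evalAt 𝕜 0 (φ (locMon i 0)) = 0) (f : CircleFun 𝕜) :
    φ f = evalAt 𝕜 0 (φ (locMon n 0)) • ddx^[n] f := by
  obtain ⟨N, a, ha⟩ := hφ
  -- By `ddx_diffOp`, commuting with d/dx means that every coefficient has derivative zero; its
  -- value is then read off at the origin.
  have hconst : ∀ i < N, a i = algebraMap 𝕜 _ (evalAt 𝕜 0 (φ (locMon i 0))) := fun i hi => by
    have hd : ddx (a i) = 0 := ext_evalAt fun x => by
      have h2 := ddx_diffOp ha (locMon i x)
      rw [hc, right_eq_add] at h2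
      have h3 := congrArg (evalAt 𝕜 x) h2
      simpa only [map_sum, evalAt_mul, evalAt_iterate_locMon, mul_ite, mul_one, mul_zero,
        Finset.sum_ite_eq', Finset.mem_range, if_pos hi] using h3
    rw [evalAt_diffOp_locMon ha, if_pos hi]
    exact eq_algebraMap_of_ddx_eq_zero hd
  by_cases hn : n < N
  · rw [ha, Finset.sum_eq_single n, hconst n hn, ← Algebra.smul_def]
    · intro i hi hin
      rw [hconst i (Finset.mem_range.1 hi), h i hin, map_zero, zero_mul]
    · intro h
      exact absurd (Finset.mem_range.2 hn) h
  · rw [evalAt_diffOp_locMon ha, if_neg hn, zero_smul, ha]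
    refine Finset.sum_eq_zero fun i hi => ?_
    have hi' := Finset.mem_range.1 hi
    rw [hconst i hi', h i (by omega), map_zero, zero_mul]

/-- The coefficients of a homogeneous homomorphism of degree two. -/
def seqOf (ψ : SuperFun 𝕜 →ₗ[𝕜] SPDO 𝕜) (i : ℕ) : 𝕜 :=
  if Even i then -evalAt 𝕜 0 (blkA (ψ (mkFun (locMon (i / 2) 0) 0)) (1 - (i / 2 : ℕ)))
  else evalAt 𝕜 0 (blkB (ψ (mkFun 0 (locMon (i / 2) 0))) (-(i / 2 : ℕ)))

theorem seqOf_even (ψ : SuperFun 𝕜 →ₗ[𝕜] SPDO 𝕜) (n : ℕ) :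
    seqOf ψ (2 * n) = -evalAt 𝕜 0 (blkA (ψ (mkFun (locMon n 0) 0)) (1 - n)) := by
  rw [seqOf, if_pos (even_two_mul n), show 2 * n / 2 = n by omega]

theorem seqOf_odd (ψ : SuperFun 𝕜 →ₗ[𝕜] SPDO 𝕜) (n : ℕ) :
    seqOf ψ (2 * n + 1) = evalAt 𝕜 0 (blkB (ψ (mkFun 0 (locMon n 0))) (-n)) := by
  rw [seqOf, if_neg (Nat.not_even_iff_odd.2 ⟨n, rfl⟩), show (2 * n + 1) / 2 = n by omega]

/-! ### Homomorphisms that send v_θ to ½ η. -/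

section Rigid

variable {ψ : SuperFun 𝕜 →ₗ[𝕜] SPDO 𝕜}

/-- Comes from {f, θ} = -½ f' θ: values on odd fields with coefficient f' are determined by values
on even fields. -/
theorem IsRep.coeff_odd_ddx (hψ : IsRep ψ) (hθ : ψ theta = (1 / 2 : 𝕜) • monomial 1 1)
    (f : CircleFun 𝕜) (k : ℤ) : coeff (ψ (mkFun 0 (ddx f))) k =
      eta (coeff (ψ (mkFun f 0)) k) + sigma (coeff (ψ (mkFun f 0)) (k - 1)) -
        coeff (ψ (mkFun f 0)) (k - 1) := by
  have h := hψ.map_even_odd f 1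
  have h1 : mkFun 0 (f * ddx 1 - (1 / 2 : 𝕜) • (ddx f * 1)) = (-(1 / 2) : 𝕜) • mkFun 0 (ddx f) := by
    apply SuperFun.ext <;> simp
  rw [h1, map_smul, ← theta.eq_1, hθ, comp_smul, smul_comp, monomial_one_comp] at h
  have h2 := congrArg (fun X => coeff X k) h
  simp only [coeff_smul, coeff_sub, coeff_comp_monomial_one, coeff_etaComp] at h2
  calc coeff (ψ (mkFun 0 (ddx f))) k
      = (-2 : 𝕜) • ((-(1 / 2) : 𝕜) • coeff (ψ (mkFun 0 (ddx f))) k) := by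
        rw [smul_smul]; norm_num
    _ = _ := by rw [h2]; module

/-- Comes from {θ, h θ} = ½ h: values on even fields are determined by values on odd fields. -/
theorem IsRep.coeff_even (hψ : IsRep ψ) (hθ : ψ theta = (1 / 2 : 𝕜) • monomial 1 1)
    (h : CircleFun 𝕜) (k : ℤ) : coeff (ψ (mkFun h 0)) k =
      eta (coeff (ψ (mkFun 0 h)) k) + sigma (coeff (ψ (mkFun 0 h)) (k - 1)) +
        coeff (ψ (mkFun 0 h)) (k - 1) := by
  have h0 := hψ.map_odd_odd 1 h
  have h1 : mkFun ((1 / 2 : 𝕜) • (1 * h)) 0 = (1 / 2 : 𝕜) • mkFun h 0 := by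
    apply SuperFun.ext <;> simp
  rw [h1, map_smul, ← theta.eq_1, hθ, comp_smul, smul_comp, monomial_one_comp] at h0
  have h2 := congrArg (fun X => coeff X k) h0
  simp only [coeff_smul, coeff_add, coeff_comp_monomial_one, coeff_etaComp] at h2
  calc coeff (ψ (mkFun h 0)) k
      = (2 : 𝕜) • ((1 / 2 : 𝕜) • coeff (ψ (mkFun h 0)) k) := by
        rw [smul_smul]; norm_num
    _ = _ := by rw [h2]; module

theorem IsRep.snd_even_eq (hψ : IsRep ψ) (hθ : ψ theta = (1 / 2 : 𝕜) • monomial 1 1)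
    (f : CircleFun 𝕜) (k : ℤ) :
    (coeff (ψ (mkFun f 0)) (2 * k + 1)).snd = blkB (ψ (mkFun 0 (ddx f))) k := by
  rw [blkB, hψ.coeff_odd_ddx hθ]
  simp

/-- Two successive brackets with v_θ amount, up to a factor, to the bracket with v_1, so both steps
together give compatibility with d/dx. -/
theorem IsRep.blkB_ddx (hψ : IsRep ψ) (hθ : ψ theta = (1 / 2 : 𝕜) • monomial 1 1)
    (f : CircleFun 𝕜) (k : ℤ) : blkB (ψ (mkFun 0 (ddx f))) k = ddx (blkB (ψ (mkFun 0 f)) k) := by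
  rw [← hψ.snd_even_eq hθ, hψ.coeff_even hθ]
  simp [blkB]

theorem IsRep.snd_odd_eq (hψ : IsRep ψ) (hθ : ψ theta = (1 / 2 : 𝕜) • monomial 1 1)
    (h : CircleFun 𝕜) (k : ℤ) : (coeff (ψ (mkFun 0 h)) (2 * k)).snd =
      blkA (ψ (mkFun h 0)) k - (2 : 𝕜) • blkB (ψ (mkFun 0 h)) (k - 1) := by
  rw [blkA, hψ.coeff_even hθ, blkB, show 2 * (k - 1) + 1 = 2 * k - 1 by ring]
  simp only [TrivSqZeroExt.fst_add, fst_eta, fst_sigma]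
  module

theorem IsRep.blkA_ddx (hψ : IsRep ψ) (hθ : ψ theta = (1 / 2 : 𝕜) • monomial 1 1)
    (f : CircleFun 𝕜) (k : ℤ) : blkA (ψ (mkFun (ddx f) 0)) k = ddx (blkA (ψ (mkFun f 0)) k) := by
  have h1 := hψ.snd_odd_eq hθ (ddx f) k
  have h2 := congrArg TrivSqZeroExt.snd (hψ.coeff_odd_ddx hθ f (2 * k))
  have h3 := hψ.snd_even_eq hθ f (k - 1)
  rw [show 2 * (k - 1) + 1 = 2 * k - 1 by ring] at h3
  simp only [TrivSqZeroExt.snd_add, TrivSqZeroExt.snd_sub, snd_eta, snd_sigma, h3] at h2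
  rw [h1] at h2
  rw [two_smul] at h2
  change _ = ddx (blkA (ψ (mkFun f 0)) k) + _ - _ at h2
  linear_combination h2

theorem IsRep.map_one_of_theta (hψ : IsRep ψ) (hθ : ψ theta = (1 / 2 : 𝕜) • monomial 1 1) :
    ψ (mkFun 1 0) = monomial 1 2 := by
  rw [hψ.map_one, hθ, comp_smul, smul_comp, smul_smul, smul_smul, monomial_one_comp,
    ← etaPowComp_one, etaPowComp_monomial_one]
  norm_num

theorem IsRep.blkA_one (hψ : IsRep ψ) (hθ : ψ theta = (1 / 2 : 𝕜) • monomial 1 1) {k : ℤ}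
    (hk : k ≠ 1) : blkA (ψ (mkFun 1 0)) k = 0 := by
  rw [hψ.map_one_of_theta hθ, blkA, coeff_monomial, if_neg (by omega), TrivSqZeroExt.fst_zero]

theorem blkB_one_of_theta (hθ : ψ theta = (1 / 2 : 𝕜) • monomial 1 1) {k : ℤ} (hk : k ≠ 0) :
    blkB (ψ (mkFun 0 1)) k = 0 := by
  rw [← theta.eq_1, hθ, blkB, coeff_smul, coeff_monomial, if_neg (by omega), smul_zero,
    TrivSqZeroExt.fst_zero]

theorem blkA_of_sub_rho (hρ : ∀ F, OrdLE (ψ F - rho F) 0) (f : CircleFun 𝕜) {k : ℤ} (hk : 0 < k) :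
    blkA (ψ (mkFun f 0)) k = if k = 1 then f else 0 := by
  have := congrArg TrivSqZeroExt.fst (hρ (mkFun f 0) (2 * k) (by omega))
  rw [coeff_sub, TrivSqZeroExt.fst_sub, TrivSqZeroExt.fst_zero, sub_eq_zero] at this
  rw [← blkA_rho]
  exact this

theorem blkB_of_sub_rho (hρ : ∀ F, OrdLE (ψ F - rho F) 0) (h : CircleFun 𝕜) {k : ℤ} (hk : 0 ≤ k) :
    blkB (ψ (mkFun 0 h)) k = if k = 0 then (1 / 2 : 𝕜) • h else 0 := by
  have := congrArg TrivSqZeroExt.fst (hρ (mkFun 0 h) (2 * k + 1) (by omega))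
  rw [coeff_sub, TrivSqZeroExt.fst_sub, TrivSqZeroExt.fst_zero, sub_eq_zero] at this
  rw [← blkB_rho]
  exact this

/-- Homomorphisms with the standard odd generator and the normalization at the origin are
homogeneous. -/
theorem IsRep.eq_homogeneousSeries (hψ : IsRep ψ) (hρ : ∀ F, OrdLE (ψ F - rho F) 0)
    (hθ : ψ theta = (1 / 2 : 𝕜) • monomial 1 1)
    (hn : ∀ m : ℕ, m ≠ 0 → evalAt 𝕜 0 (blkA (ψ (mkFun (locMon 1 0) 0)) (-m)) = 0)
    (F : SuperFun 𝕜) : ψ F = homogeneousSeries 2 (seqOf ψ) F := by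
  set e : CircleFun 𝕜 := locMon 1 0 with he
  set l : 𝕜 := evalAt 𝕜 0 (blkA (ψ (mkFun e 0)) 0) with hl
  have hA1 : ∀ f k, 1 < k → blkA (ψ (mkFun f 0)) k = 0 := fun f k hk => by
    rw [blkA_of_sub_rho hρ f (by omega), if_neg (by omega)]
  have hB1 : ∀ f k, 0 < k → blkB (ψ (mkFun 0 f)) k = 0 := fun f k hk => by
    rw [blkB_of_sub_rho hρ f (by omega), if_neg (by omega)]
  have hD : ∀ f k, blkD (ψ (mkFun f 0)) k =
      ddx (blkB (ψ (mkFun 0 f)) k) + blkA (ψ (mkFun f 0)) k := fun f k => by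
    rw [blkD_apply, hψ.snd_even_eq hθ, hψ.blkB_ddx hθ]
    rfl
  have hD1 : ∀ f k, 1 < k → blkD (ψ (mkFun f 0)) k = 0 := fun f k hk => by
    rw [hD, hA1 f k hk, hB1 f k (by omega), ddx_zero, add_zero]
  -- At the origin block A of the image of the local Euler field has the jet of x ξ + l. Positive
  -- orders are those of ρ; in orders k ≤ 0 translation invariance leaves only the value at the
  -- origin, and for k < 0 the normalization `hn` removes it.
  have jetA : ∀ (k : ℤ) (j : ℕ), evalAt 𝕜 0 (ddx^[j] (blkA (ψ (mkFun e 0)) k)) =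
      if k = 1 ∧ j = 1 then 1 else if k = 0 ∧ j = 0 then l else 0 := fun k j => by
    by_cases hk : 0 < k
    · rw [blkA_of_sub_rho hρ e hk]
      by_cases hk1 : k = 1
      · rw [if_pos hk1, he, evalAt_iterate_locMon]
        split_ifs <;> first | omega | rfl
      · rw [if_neg hk1, iterate_ddx_zero, map_zero, if_neg (by omega), if_neg (by omega)]
    · rw [if_neg (by omega), he, evalAt_iterate_invariant (hψ.isDiffOp_blkA k)
        (fun f => hψ.blkA_ddx hθ f k) (hψ.blkA_one hθ (by omega))]
      by_cases hj : j = 0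
      · rw [if_pos hj]
        by_cases hk0 : k = 0
        · rw [if_pos ⟨hk0, hj⟩, hk0]
        · rw [if_neg (by omega)]
          have := hn (-k).toNat (by omega)
          rwa [show -((-k).toNat : ℤ) = k by omega] at this
      · rw [if_neg hj, if_neg (by omega)]
  -- The additional 1/2 comes from D₀ = A₀ + B₀', where B₀ is half the local coordinate near the
  -- origin.
  have jetD : ∀ (k : ℤ) (j : ℕ), evalAt 𝕜 0 (ddx^[j] (blkD (ψ (mkFun e 0)) k)) =
      if k = 1 ∧ j = 1 then 1 else if k = 0 ∧ j = 0 then l + 1 / 2 else 0 := fun k j => by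
    rw [hD, iterate_ddx_add, map_add, jetA, ← Function.iterate_succ_apply]
    by_cases hk : 0 ≤ k
    · rw [blkB_of_sub_rho hρ e hk]
      by_cases hk0 : k = 0
      · rw [if_pos hk0, iterate_ddx_smul, map_smul, he, evalAt_iterate_locMon, smul_eq_mul]
        by_cases hj : j = 0
        · simp [hj, hk0, add_comm]
        · simp [hj, hk0]
      · rw [if_neg hk0, iterate_ddx_zero, map_zero, zero_add]
        split_ifs <;> first | omega | rfl
    · rw [he, evalAt_iterate_invariant (hψ.isDiffOp_blkB k) (fun f => hψ.blkB_ddx hθ f k)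
        (blkB_one_of_theta hθ (by omega)), if_neg j.succ_ne_zero, zero_add]
      split_ifs <;> first | omega | rfl
  have hleft : ∀ k, k ≠ 0 → evalAt 𝕜 0 (blkA (ψ (mkFun e 0)) k) = 0 := fun k hk => by
    have := jetA k 0
    rwa [if_neg (by omega), if_neg (by omega)] at this
  have hA : ∀ (p : ℤ) (n : ℕ), p = 1 - n → ∀ f, blkA (ψ (mkFun f 0)) p =
      evalAt 𝕜 0 (blkA (ψ (mkFun (locMon n 0) 0)) p) • ddx^[n] f := fun p n hp => by
    refine eq_smul_iterate_of_invariant (hψ.isDiffOp_blkA p) (fun f => hψ.blkA_ddx hθ f p)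
      fun i hi => ?_
    -- A weight count: the Euler field multiplies the monomial of degree i by i - 1, and at the
    -- origin the commutator multiplies the coefficient by l - (p + l) = -p. Only i = 1 - p
    -- survives.
    have h1 := congrArg (evalAt 𝕜 0) (hψ.blkA_even_even e (locMon i 0) p)
    rw [map_sub, evalAt_star_left (hA1 e) (hA1 (locMon i 0)) hleft,
      evalAt_star_right (hA1 e) (hA1 (locMon i 0)) jetA] at h1
    have hg := germEq_locMon_one_vect (𝕜 := 𝕜) i 1 0
    rw [one_smul] at hg
    have h2 := evalAt_diffOp_congr (hψ.isDiffOp_blkA p) hg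
    rw [isDiffOp_map_smul (hψ.isDiffOp_blkA p), map_smul, smul_eq_mul] at h2
    rw [h2] at h1
    have h3 : (((i : ℤ) - 1 + p : ℤ) : 𝕜) * evalAt 𝕜 0 (blkA (ψ (mkFun (locMon i 0) 0)) p) = 0 := by
      push_cast
      linear_combination h1
    have h4 : (((i : ℤ) - 1 + p : ℤ) : 𝕜) ≠ 0 := by
      exact_mod_cast (by omega : (i : ℤ) - 1 + p ≠ 0)
    exact (mul_eq_zero.1 h3).resolve_left h4
  have hB : ∀ (p : ℤ) (n : ℕ), p = -n → ∀ f, blkB (ψ (mkFun 0 f)) p =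
      evalAt 𝕜 0 (blkB (ψ (mkFun 0 (locMon n 0))) p) • ddx^[n] f := fun p n hp => by
    refine eq_smul_iterate_of_invariant (hψ.isDiffOp_blkB p) (fun f => hψ.blkB_ddx hθ f p)
      fun i hi => ?_
    -- Here the weights are i - 1/2 and l - (p + l + 1/2) = -p - 1/2, so only i = -p survives.
    have h1 := congrArg (evalAt 𝕜 0) (hψ.blkB_even_odd e (locMon i 0) p)
    rw [map_sub, evalAt_star_left (hA1 e) (hB1 (locMon i 0)) hleft,
      evalAt_star_right (hD1 e) (hB1 (locMon i 0)) jetD] at h1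
    have h2 := evalAt_diffOp_congr (hψ.isDiffOp_blkB p)
      (germEq_locMon_one_vect (𝕜 := 𝕜) i (1 / 2) 0)
    rw [isDiffOp_map_smul (hψ.isDiffOp_blkB p), map_smul, smul_eq_mul] at h2
    rw [h2] at h1
    have h3 : (((i : ℤ) + p : ℤ) : 𝕜) * evalAt 𝕜 0 (blkB (ψ (mkFun 0 (locMon i 0))) p) = 0 := by
      push_cast
      linear_combination h1
    have h4 : (((i : ℤ) + p : ℤ) : 𝕜) ≠ 0 := by
      exact_mod_cast (by omega : (i : ℤ) + p ≠ 0)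
    exact (mul_eq_zero.1 h3).resolve_left h4
  have hF : ψ F = ψ (mkFun F.fst 0) + ψ (mkFun 0 F.snd) := by
    rw [← map_add]
    congr 1
    apply SuperFun.ext <;> simp
  have ho := fun h => hψ.parity_odd h
  have hev := fun f => hψ.parity_even f
  apply SPDO.ext
  intro j
  rcases int_trichotomy j with h | ⟨n, rfl⟩ | ⟨n, rfl⟩
  · rw [coeff_homogeneousSeries_of_lt _ _ h, ordLE_of_sub_rho hρ F j h]
  · rw [coeff_homogeneousSeries_even, hF, coeff_add, seqOf_even, seqOf_odd,
      show 2 - 2 * (n : ℤ) = 2 * (1 - n) by ring]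
    apply SuperFun.ext
    · rw [TrivSqZeroExt.fst_add, fst_coeff_of_odd (ho _), add_zero, fst_mkFun, neg_neg]
      exact hA (1 - n) n rfl _
    · rw [TrivSqZeroExt.snd_add, snd_coeff_of_even (hev _), zero_add, snd_mkFun,
        hψ.snd_odd_eq hθ, hA (1 - n) n rfl, show (1 : ℤ) - n - 1 = -n by ring, hB (-n) n rfl]
      module
  · rw [coeff_homogeneousSeries_odd, hF, coeff_add, seqOf_odd,
      show 1 - 2 * (n : ℤ) = 2 * (-n) + 1 by ring]
    apply SuperFun.ext
    · rw [TrivSqZeroExt.fst_add, fst_coeff_of_even (hev _), zero_add, TrivSqZeroExt.fst_smul,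
        fst_mkFun]
      exact hB (-n) n rfl _
    · rw [TrivSqZeroExt.snd_add, snd_coeff_of_odd (ho _), add_zero, TrivSqZeroExt.snd_smul,
        snd_mkFun, hψ.snd_even_eq hθ, hB (-n) n rfl, Function.iterate_succ_apply]

end Rigid

/-! ### Polynomials in the parameters -/

section ParamPoly

variable {M M' : Type*} [AddCommGroup M] [Module 𝕜 M] [AddCommGroup M'] [Module 𝕜 M']

/-- The monomial `c^α`. -/
def paramMonomial (𝕜 : Type*) [RCLike 𝕜] (α : Fin 3 →₀ ℕ) (c : Fin 3 → ℝ) : 𝕜 :=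
  ((∏ i, c i ^ α i : ℝ) : 𝕜)

theorem paramMonomial_add (α β : Fin 3 →₀ ℕ) (c : Fin 3 → ℝ) :
    paramMonomial 𝕜 (α + β) c = paramMonomial 𝕜 α c * paramMonomial 𝕜 β c := by
  simp only [paramMonomial, Finsupp.add_apply, pow_add, Finset.prod_mul_distrib,
    RCLike.ofReal_mul]

theorem paramMonomial_apply_zero {α : Fin 3 →₀ ℕ} (h : 1 ≤ α.degree) :
    paramMonomial 𝕜 α 0 = 0 := by
  have hα : α ≠ 0 := by
    rintro rfl
    simp at h
  obtain ⟨i, hi⟩ := Finsupp.ne_iff.1 hα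
  rw [paramMonomial, Finset.prod_eq_zero (Finset.mem_univ i), RCLike.ofReal_zero]
  exact zero_pow hi

theorem ParamPoly.orderGE_iff {d : ℕ} {P : ParamPoly M} :
    P.OrderGE d ↔ ∀ α : Fin 3 →₀ ℕ, α.degree < d → P α = 0 := by
  simp only [ParamPoly.OrderGE, Finsupp.mem_support_iff]
  exact forall_congr' fun α => by rw [not_imp_comm, not_le]

theorem ParamPoly.eval_eq_sum (c : Fin 3 → ℝ) (P : ParamPoly M) :
    ParamPoly.eval (𝕜 := 𝕜) c P = ∑ α ∈ P.support, paramMonomial 𝕜 α c • P α := rfl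

theorem ParamPoly.eval_add (c : Fin 3 → ℝ) (P Q : ParamPoly M) :
    ParamPoly.eval (𝕜 := 𝕜) c (P + Q) =
      ParamPoly.eval (𝕜 := 𝕜) c P + ParamPoly.eval (𝕜 := 𝕜) c Q :=
  Finsupp.sum_add_index' (fun _ => smul_zero _) fun _ _ _ => smul_add _ _ _

theorem ParamPoly.eval_zero (c : Fin 3 → ℝ) :
    ParamPoly.eval (𝕜 := 𝕜) c (0 : ParamPoly M) = 0 := Finsupp.sum_zero_index

theorem ParamPoly.eval_single (c : Fin 3 → ℝ) (α : Fin 3 →₀ ℕ) (m : M) :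
    ParamPoly.eval (𝕜 := 𝕜) c (Finsupp.single α m) = paramMonomial 𝕜 α c • m :=
  Finsupp.sum_single_index (smul_zero _)

theorem ParamPoly.eval_sum {ι : Type*} (s : Finset ι) (c : Fin 3 → ℝ) (P : ι → ParamPoly M) :
    ParamPoly.eval (𝕜 := 𝕜) c (∑ i ∈ s, P i) = ∑ i ∈ s, ParamPoly.eval (𝕜 := 𝕜) c (P i) := by
  classical
  induction s using Finset.induction_on with
  | empty => rw [Finset.sum_empty, Finset.sum_empty, ParamPoly.eval_zero]
  | insert a s ha ih => rw [Finset.sum_insert ha, Finset.sum_insert ha, ParamPoly.eval_add, ih]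

/-- The image of a polynomial under a linear map of the coefficients. -/
def ParamPoly.map (L : M →ₗ[𝕜] M') (P : ParamPoly M) : ParamPoly M' :=
  P.mapRange L (LinearMap.map_zero L)

theorem ParamPoly.map_apply (L : M →ₗ[𝕜] M') (P : ParamPoly M) (α : Fin 3 →₀ ℕ) :
    ParamPoly.map L P α = L (P α) := rfl

theorem ParamPoly.eval_map (L : M →ₗ[𝕜] M') (P : ParamPoly M) (c : Fin 3 → ℝ) :
    ParamPoly.eval (𝕜 := 𝕜) c (ParamPoly.map L P) = L (ParamPoly.eval (𝕜 := 𝕜) c P) := by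
  rw [ParamPoly.eval_eq_sum c P, map_sum]
  refine (Finsupp.sum_mapRange_index (h := fun α m => paramMonomial 𝕜 α c • m)
    fun α => smul_zero _).trans ?_
  exact Finset.sum_congr rfl fun α _ => (LinearMap.map_smul L _ _).symm

theorem ParamPoly.eval_mem (N : Submodule 𝕜 M) {P : ParamPoly M} (h : ∀ α, P α ∈ N)
    (c : Fin 3 → ℝ) : ParamPoly.eval (𝕜 := 𝕜) c P ∈ N :=
  Submodule.sum_mem _ fun α _ => Submodule.smul_mem _ _ (h α)

theorem ParamPoly.eval_apply_zero {d : ℕ} (hd : 1 ≤ d) {P : ParamPoly M} (h : P.OrderGE d) :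
    ParamPoly.eval (𝕜 := 𝕜) 0 P = 0 :=
  Finset.sum_eq_zero fun α hα => by
    change paramMonomial 𝕜 α 0 • P α = 0
    rw [paramMonomial_apply_zero (hd.trans (h α hα)), zero_smul]

/-- Functions on `V` given by polynomials without terms of degree less than `d`. -/
def polyFamilies (𝕜 : Type*) [RCLike 𝕜] (V : Set (Fin 3 → ℝ)) (M : Type*) [AddCommGroup M]
    [Module 𝕜 M] (d : ℕ) : Submodule 𝕜 (V → M) :=
  Submodule.span 𝕜 {u | ∃ α : Fin 3 →₀ ℕ, d ≤ α.degree ∧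
    ∃ m, u = fun c : V => paramMonomial 𝕜 α c.1 • m}

variable {V : Set (Fin 3 → ℝ)} {d e : ℕ}

theorem polyFamilies_mono (h : d ≤ e) : polyFamilies 𝕜 V M e ≤ polyFamilies 𝕜 V M d :=
  Submodule.span_mono fun _ ⟨α, hα, hm⟩ => ⟨α, h.trans hα, hm⟩

/-- A polynomial need not be determined by its values on `V`, so families are functions on `V` that
some polynomial represents. The span description gives the closure properties; this equivalence
provides a polynomial when one is needed. -/
theorem mem_polyFamilies_iff {u : V → M} : u ∈ polyFamilies 𝕜 V M d ↔
    ∃ P : ParamPoly M, P.OrderGE d ∧ ∀ c : V, u c = ParamPoly.eval (𝕜 := 𝕜) c.1 P := by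
  constructor
  · intro h
    induction h using Submodule.span_induction with
    | mem u hu =>
      obtain ⟨α, hα, m, rfl⟩ := hu
      refine ⟨Finsupp.single α m, fun β hβ => ?_, fun c => (ParamPoly.eval_single _ _ _).symm⟩
      rwa [Finset.mem_singleton.1 (Finsupp.support_single_subset hβ)]
    | zero => exact ⟨0, fun α hα => by simp at hα, fun c => (ParamPoly.eval_zero _).symm⟩
    | add u v _ _ hu hv =>
      obtain ⟨P, hP, hu⟩ := hu
      obtain ⟨Q, hQ, hv⟩ := hv
      rw [ParamPoly.orderGE_iff] at hP hQ
      refine ⟨P + Q, ParamPoly.orderGE_iff.2 fun α hα => ?_, fun c => ?_⟩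
      · rw [Finsupp.add_apply, hP α hα, hQ α hα, add_zero]
      · rw [Pi.add_apply, hu, hv, ParamPoly.eval_add]
    | smul r u _ hu =>
      obtain ⟨P, hP, hu⟩ := hu
      rw [ParamPoly.orderGE_iff] at hP
      refine ⟨ParamPoly.map (LinearMap.lsmul 𝕜 M r) P, ParamPoly.orderGE_iff.2 fun α hα => ?_,
        fun c => ?_⟩
      · rw [ParamPoly.map_apply, hP α hα, LinearMap.map_zero]
      · rw [Pi.smul_apply, hu, ParamPoly.eval_map, LinearMap.lsmul_apply]
  · rintro ⟨P, hP, hu⟩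
    have : u = ∑ α ∈ P.support, fun c : V => paramMonomial 𝕜 α c.1 • P α := by
      funext c
      rw [hu, Finset.sum_apply, ParamPoly.eval_eq_sum]
    rw [this]
    exact Submodule.sum_mem _ fun α hα => Submodule.subset_span ⟨α, hP α hα, _, rfl⟩

theorem map_mem_polyFamilies (L : M →ₗ[𝕜] M') {u : V → M} (hu : u ∈ polyFamilies 𝕜 V M d) :
    (fun c => L (u c)) ∈ polyFamilies 𝕜 V M' d := by
  obtain ⟨P, hP, hu⟩ := mem_polyFamilies_iff.1 hu
  rw [ParamPoly.orderGE_iff] at hP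
  exact mem_polyFamilies_iff.2 ⟨ParamPoly.map L P, ParamPoly.orderGE_iff.2 fun α hα => by
    rw [ParamPoly.map_apply, hP α hα, LinearMap.map_zero], fun c => by
    rw [hu, ParamPoly.eval_map]⟩

/-- Degrees add under products. Therefore an exponent without terms of degree less than two changes
polynomial families only in degree at least two. -/
theorem bilin_mem_polyFamilies {M'' : Type*} [AddCommGroup M''] [Module 𝕜 M'']
    (B : M →ₗ[𝕜] M' →ₗ[𝕜] M'') {u : V → M} {v : V → M'} (hu : u ∈ polyFamilies 𝕜 V M d)
    (hv : v ∈ polyFamilies 𝕜 V M' e) : (fun c => B (u c) (v c)) ∈ polyFamilies 𝕜 V M'' (d + e) := by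
  induction hu using Submodule.span_induction with
  | mem u hu =>
    obtain ⟨α, hα, m, rfl⟩ := hu
    induction hv using Submodule.span_induction with
    | mem v hv =>
      obtain ⟨β, hβ, n, rfl⟩ := hv
      refine Submodule.subset_span ⟨α + β, ?_, B m n, funext fun c => ?_⟩
      · rw [map_add]
        exact add_le_add hα hβ
      · rw [map_smul, LinearMap.map_smul, LinearMap.smul_apply, smul_smul, mul_comm,
          paramMonomial_add]
    | zero =>
      simp only [Pi.zero_apply, map_zero]
      exact Submodule.zero_mem _
    | add v w _ _ hv hw =>
      simp only [Pi.add_apply, map_add]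
      exact Submodule.add_mem _ hv hw
    | smul r v _ hv =>
      convert Submodule.smul_mem _ r hv using 1
      funext c
      simp only [Pi.smul_apply, LinearMap.map_smul]
  | zero =>
    simp only [Pi.zero_apply, map_zero, LinearMap.zero_apply]
    exact Submodule.zero_mem _
  | add u w _ _ hu hw =>
    simp only [Pi.add_apply, map_add, LinearMap.add_apply]
    exact Submodule.add_mem _ hu hw
  | smul r u _ hu =>
    simp only [Pi.smul_apply, map_smul, LinearMap.smul_apply]
    exact Submodule.smul_mem _ r hu

theorem const_mem_polyFamilies (m : M) : (fun _ : V => m) ∈ polyFamilies 𝕜 V M 0 :=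
  Submodule.subset_span ⟨0, Nat.zero_le _, m, funext fun c => by simp [paramMonomial]⟩

theorem coord_mem_polyFamilies (i : Fin 3) :
    (fun c : V => (c.1 i : 𝕜)) ∈ polyFamilies 𝕜 V 𝕜 1 :=
  Submodule.subset_span ⟨Finsupp.single i 1, by simp, 1, funext fun c => by
    rw [paramMonomial, Finset.prod_eq_single i, Finsupp.single_eq_same, pow_one, smul_eq_mul,
      mul_one]
    · intro j _ hj
      rw [Finsupp.single_eq_of_ne hj, pow_zero]
    · intro h
      exact absurd (Finset.mem_univ i) h⟩

theorem isCurvePoly_pow {f : ℝ → 𝕜} (hf : IsCurvePoly f) (n : ℕ) : IsCurvePoly fun t => f t ^ n := by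
  obtain ⟨p, hp⟩ := hf
  exact ⟨p ^ n, fun t => by beta_reduce; rw [hp, Polynomial.eval_pow]⟩

theorem isCurvePoly_eval (p : Polynomial ℝ) : IsCurvePoly fun t => ((p.eval t : ℝ) : 𝕜) :=
  ⟨p.map (algebraMap ℝ 𝕜), fun t => by
    change algebraMap ℝ 𝕜 _ = Polynomial.eval (algebraMap ℝ 𝕜 t) _
    rw [Polynomial.eval_map, Polynomial.eval₂_at_apply]⟩

/-- Restriction of a polynomial family to a polynomial curve. -/
theorem isCurvePoly_of_mem_polyFamilies {u : V → 𝕜} (hu : u ∈ polyFamilies 𝕜 V 𝕜 d)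
    (γ : Fin 3 → Polynomial ℝ) (hγ : ∀ t : ℝ, (fun i => (γ i).eval t) ∈ V) :
    IsCurvePoly fun t => u ⟨_, hγ t⟩ := by
  obtain ⟨P, -, hu⟩ := mem_polyFamilies_iff.1 hu
  simp only [hu, ParamPoly.eval_eq_sum, smul_eq_mul]
  refine isCurvePoly_sum fun α _ => isCurvePoly_mul ?_ (isCurvePoly_const _)
  simp only [paramMonomial, Fin.prod_univ_three, RCLike.ofReal_mul, RCLike.ofReal_pow]
  exact isCurvePoly_mul (isCurvePoly_mul (isCurvePoly_pow (isCurvePoly_eval _) _)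
    (isCurvePoly_pow (isCurvePoly_eval _) _)) (isCurvePoly_pow (isCurvePoly_eval _) _)

end ParamPoly

/-! ### Differential operators on the supercircle -/

/-- Differential operators `F ↦ ∑_{i < N} a_i η̄^i(F)`. -/
def etaBarOps (𝕜 : Type*) [RCLike 𝕜] : AddSubgroup (SuperFun 𝕜 → SuperFun 𝕜) where
  carrier := {u | ∃ a : ℕ →₀ SuperFun 𝕜, ∀ F, u F = a.sum fun i b => b * etaBar^[i] F}
  zero_mem' := ⟨0, fun F => by simp⟩
  add_mem' := by
    rintro u v ⟨a, ha⟩ ⟨b, hb⟩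
    refine ⟨a + b, fun F => ?_⟩
    rw [Pi.add_apply, ha, hb, Finsupp.sum_add_index' (fun _ => zero_mul _)
      fun _ _ _ => add_mul _ _ _]
  neg_mem' := by
    rintro u ⟨a, ha⟩
    refine ⟨-a, fun F => ?_⟩
    rw [Pi.neg_apply, ha, Finsupp.sum_neg_index fun _ => zero_mul _]
    simp only [Finsupp.sum, neg_mul, Finset.sum_neg_distrib]

theorem mul_iterate_etaBar_mem (b : SuperFun 𝕜) (i : ℕ) :
    (fun F => b * etaBar^[i] F) ∈ etaBarOps 𝕜 :=
  ⟨Finsupp.single i b, fun F =>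
    (Finsupp.sum_single_index (h := fun i b => b * etaBar^[i] F) (zero_mul _)).symm⟩

theorem mul_mem_etaBarOps (b : SuperFun 𝕜) {u : SuperFun 𝕜 → SuperFun 𝕜} (hu : u ∈ etaBarOps 𝕜) :
    (fun F => b * u F) ∈ etaBarOps 𝕜 := by
  obtain ⟨a, ha⟩ := hu
  have : (fun F => b * u F) = ∑ i ∈ a.support, fun F => (b * a i) * etaBar^[i] F := by
    funext F
    rw [ha, Finset.sum_apply, Finsupp.sum, Finset.mul_sum]
    exact Finset.sum_congr rfl fun i _ => (mul_assoc _ _ _).symm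
  rw [this]
  exact sum_mem fun i _ => mul_iterate_etaBar_mem _ _

theorem isDifferentialOperator_iff {φ : SuperFun 𝕜 →ₗ[𝕜] SuperFun 𝕜} :
    IsDifferentialOperator φ ↔ ⇑φ ∈ etaBarOps 𝕜 := by
  constructor
  · rintro ⟨N, a, h⟩
    have : ⇑φ = ∑ i ∈ Finset.range N, fun F => a i * etaBar^[i] F := by
      funext F
      rw [h, Finset.sum_apply]
    rw [this]
    exact sum_mem fun i _ => mul_iterate_etaBar_mem _ _
  · rintro ⟨a, h⟩
    refine ⟨a.support.sup id + 1, a, fun F => ?_⟩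
    rw [h]
    refine Finset.sum_subset (fun i hi => ?_) fun i _ hi => ?_
    · exact Finset.mem_range.2 (Nat.lt_succ_of_le (Finset.le_sup (f := id) hi))
    · rw [Finsupp.notMem_support_iff.1 hi]
      exact zero_mul _

/-- The parity involution is itself a differential operator, so the powers of σ in a homogeneous
series do not leave the class of differential operators. -/
theorem sigma_eq_sub (F : SuperFun 𝕜) : sigma F = F - (2 : 𝕜) • (theta * etaBar F) := by
  apply SuperFun.ext
  · simp
  · simp [two_smul]

theorem sigmaPow_iterate_etaBar_mem (n : ℤ) (i : ℕ) :
    (fun F => sigmaPow n (etaBar^[i] F)) ∈ etaBarOps 𝕜 := by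
  have h1 : (fun F => etaBar^[i] F) ∈ etaBarOps 𝕜 := by
    simpa only [one_mul] using mul_iterate_etaBar_mem (1 : SuperFun 𝕜) i
  rcases Int.even_or_odd n with h | h
  · simpa only [sigmaPow_even h] using h1
  · simp only [sigmaPow_odd h, sigma_eq_sub, ← Function.iterate_succ_apply' etaBar,
      ← smul_mul_assoc]
    exact sub_mem h1 (mul_iterate_etaBar_mem _ _)

theorem coeff_homogeneousSeries_mem_etaBarOps (p : ℕ → 𝕜) (k : ℤ) :
    (fun F => coeff (homogeneousSeries 2 p F) k) ∈ etaBarOps 𝕜 := by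
  have : (fun F => coeff (homogeneousSeries 2 p F) k) = ∑ i ∈ Finset.range ((3 - k).toNat + 1),
      fun F => (p i • etaBarPow (2 - i) k) * sigmaPow (i - 2) (etaBar^[i] F) := by
    funext F
    rw [coeff_homogeneousSeries_eq_sum p F (K := (3 - k).toNat + 1) (by push_cast; omega),
      Finset.sum_apply]
    refine Finset.sum_congr rfl fun i _ => ?_
    rw [homTerm, mul_comm (sigmaPow _ _), smul_mul_assoc]
  rw [this]
  exact sum_mem fun i _ => mul_mem_etaBarOps _ (sigmaPow_iterate_etaBar_mem _ _)

theorem mul_mem_superDiffOps (b : SuperFun 𝕜) {u : CircleFun 𝕜 → SuperFun 𝕜}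
    (hu : u ∈ superDiffOps 𝕜) : (fun f => b * u f) ∈ superDiffOps 𝕜 := by
  constructor
  · simp only [SuperFun.fst_mul]
    exact isDiffOp_mul _ hu.1
  · simp only [SuperFun.snd_mul]
    exact isDiffOp_add (isDiffOp_mul _ hu.2) (isDiffOp_mul _ hu.1)

theorem iterate_etaBar_mem_superDiffOps {u : CircleFun 𝕜 → SuperFun 𝕜} (hu : u ∈ superDiffOps 𝕜)
    (i : ℕ) : (fun f => etaBar^[i] (u f)) ∈ superDiffOps 𝕜 := by
  induction i with
  | zero => exact hu
  | succ i ih =>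
    simp only [Function.iterate_succ_apply']
    constructor
    · simpa only [fst_etaBar] using ih.2
    · simpa only [snd_etaBar] using isDiffOp_neg (isDiffOp_ddx ih.1)

theorem comp_mem_superDiffOps {v : SuperFun 𝕜 → SuperFun 𝕜} (hv : v ∈ etaBarOps 𝕜)
    {u : CircleFun 𝕜 → SuperFun 𝕜} (hu : u ∈ superDiffOps 𝕜) :
    (fun f => v (u f)) ∈ superDiffOps 𝕜 := by
  obtain ⟨a, ha⟩ := hv
  have : (fun f => v (u f)) = ∑ i ∈ a.support, fun f => a i * etaBar^[i] (u f) := by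
    funext f
    rw [ha, Finset.sum_apply, Finsupp.sum]
  rw [this]
  exact sum_mem fun i _ => mul_mem_superDiffOps _ (iterate_etaBar_mem_superDiffOps hu i)

theorem mkFun_left_mem_superDiffOps : (fun f : CircleFun 𝕜 => mkFun f 0) ∈ superDiffOps 𝕜 :=
  ⟨by simpa only [fst_mkFun] using isDiffOp_id, by simpa only [snd_mkFun] using isDiffOp_zero⟩

theorem mkFun_right_mem_superDiffOps : (fun f : CircleFun 𝕜 => mkFun 0 f) ∈ superDiffOps 𝕜 :=
  ⟨by simpa only [fst_mkFun] using isDiffOp_zero, by simpa only [snd_mkFun] using isDiffOp_id⟩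

/-- Differential operators `φ` such that `F ↦ φ(F) η^k` is even. -/
def evenDiffOps (𝕜 : Type*) [RCLike 𝕜] (k : ℤ) :
    Submodule 𝕜 (SuperFun 𝕜 →ₗ[𝕜] SuperFun 𝕜) where
  carrier := {φ | IsDifferentialOperator φ ∧ IsEvenAt k φ}
  zero_mem' := ⟨⟨0, 0, fun F => by simp⟩, fun F => by simp⟩
  add_mem' := by
    rintro φ ψ ⟨h1, h2⟩ ⟨h3, h4⟩
    refine ⟨isDifferentialOperator_iff.2
      (add_mem (isDifferentialOperator_iff.1 h1) (isDifferentialOperator_iff.1 h3)), fun F => ?_⟩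
    rw [LinearMap.add_apply, LinearMap.add_apply, h2, h4]
    split_ifs
    · rw [sigma_add]
    · rw [sigma_add, neg_add]
  smul_mem' := by
    rintro r φ ⟨h1, h2⟩
    constructor
    · have := mul_mem_etaBarOps (r • (1 : SuperFun 𝕜)) (isDifferentialOperator_iff.1 h1)
      simp only [smul_mul_assoc, one_mul] at this
      exact isDifferentialOperator_iff.2 this
    · intro F
      rw [LinearMap.smul_apply, LinearMap.smul_apply, h2, sigma_smul]
      split_ifs
      · rfl
      · rw [smul_neg]

/-! ### Coefficients of a deformation -/

/-- The coefficient of `η^k` in a homogeneous series of degree two with a single term. -/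
def homCoeffL (𝕜 : Type*) [RCLike 𝕜] (k : ℤ) (i : ℕ) : SuperFun 𝕜 →ₗ[𝕜] SuperFun 𝕜 where
  toFun F := coeff (homogeneousSeries 2 (Pi.single i 1) F) k
  map_add' F G := by
    rcases int_trichotomy k with h | ⟨n, rfl⟩ | ⟨n, rfl⟩
    · simp only [coeff_homogeneousSeries_of_lt _ _ h, add_zero]
    · simp only [coeff_homogeneousSeries_even, TrivSqZeroExt.fst_add, TrivSqZeroExt.snd_add,
        iterate_ddx_add, smul_add]
      apply SuperFun.ext <;> simp
    · simp only [coeff_homogeneousSeries_odd, TrivSqZeroExt.fst_add, TrivSqZeroExt.snd_add,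
        iterate_ddx_add]
      apply SuperFun.ext <;> simp
  map_smul' r F := by
    rw [RingHom.id_apply]
    rcases int_trichotomy k with h | ⟨n, rfl⟩ | ⟨n, rfl⟩
    · simp only [coeff_homogeneousSeries_of_lt _ _ h, smul_zero]
    · simp only [coeff_homogeneousSeries_even, TrivSqZeroExt.fst_smul, TrivSqZeroExt.snd_smul,
        iterate_ddx_smul]
      apply SuperFun.ext
      · simp only [fst_mkFun, TrivSqZeroExt.fst_smul]; module
      · simp only [snd_mkFun, TrivSqZeroExt.snd_smul]; module
    · simp only [coeff_homogeneousSeries_odd, TrivSqZeroExt.fst_smul, TrivSqZeroExt.snd_smul,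
        iterate_ddx_smul]
      apply SuperFun.ext
      · simp only [fst_mkFun, TrivSqZeroExt.fst_smul]; module
      · simp only [snd_mkFun, TrivSqZeroExt.snd_smul]; module

theorem coeff_homogeneousSeries_eq_sum_homCoeffL (p : ℕ → 𝕜) (F : SuperFun 𝕜) (k : ℤ) :
    coeff (homogeneousSeries 2 p F) k =
      ∑ i ∈ Finset.range ((3 - k).toNat + 1), p i • homCoeffL 𝕜 k i F := by
  rw [coeff_homogeneousSeries_eq_sum p F (K := (3 - k).toNat + 1) (by push_cast; omega)]
  refine Finset.sum_congr rfl fun i hi => ?_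
  change _ = p i • coeff (homogeneousSeries 2 (Pi.single i 1) F) k
  rw [coeff_homogeneousSeries_eq_sum _ F (K := (3 - k).toNat + 1) (by push_cast; omega),
    Finset.sum_eq_single_of_mem i hi fun j _ hj => by
      rw [homTerm, Pi.single_eq_of_ne hj, zero_smul], homTerm, homTerm, Pi.single_eq_same, one_smul]

theorem homCoeffL_mem (k : ℤ) (i : ℕ) : homCoeffL 𝕜 k i ∈ evenDiffOps 𝕜 k := by
  refine ⟨isDifferentialOperator_iff.2 (coeff_homogeneousSeries_mem_etaBarOps _ k), fun F => ?_⟩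
  have := congrArg (fun X => coeff X k) (parity_homogeneousSeries (Pi.single i (1 : 𝕜)) F)
  exact this.symm.trans (coeff_parity _ _)

theorem homCoeffL_of_lt {k : ℤ} (hk : 2 < k) (i : ℕ) : homCoeffL 𝕜 k i = 0 :=
  LinearMap.ext fun F => coeff_homogeneousSeries_of_lt _ F hk

theorem IsRep.of_coeff {φ : SuperFun 𝕜 →ₗ[𝕜] SPDO 𝕜}
    (hb : ∀ F G, φ (contactBracket F G) = superBracket (φ F) (φ G)) {N : ℤ}
    (hN : ∀ k, N < k → ∀ F, coeff (φ F) k = 0)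
    (h : ∀ k, ∃ L ∈ evenDiffOps 𝕜 k, ∀ F, coeff (φ F) k = L F) : IsRep φ := by
  have hD : ∀ k, (fun F => coeff (φ F) k) ∈ etaBarOps 𝕜 := fun k => by
    obtain ⟨L, hL, h⟩ := h k
    simp only [h]
    exact isDifferentialOperator_iff.1 hL.1
  have he := fun k => comp_mem_superDiffOps (hD k) mkFun_left_mem_superDiffOps
  have ho := fun k => comp_mem_superDiffOps (hD k) mkFun_right_mem_superDiffOps
  refine ⟨hb, fun F => SPDO.ext fun k => ?_, ⟨N, fun F k hk => hN k hk F⟩, fun k => (he k).1,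
    fun k => (he k).2, fun k => (ho k).1, fun k => (ho k).2⟩
  obtain ⟨L, hL, h⟩ := h k
  rw [coeff_parity, h, h, hL.2]

/-- The component of degree zero in `θ`. -/
def fstL (𝕜 : Type*) [RCLike 𝕜] : SuperFun 𝕜 →ₗ[𝕜] CircleFun 𝕜 where
  toFun F := F.fst
  map_add' _ _ := rfl
  map_smul' _ _ := rfl

/-- The component of degree one in `θ`. -/
def sndL (𝕜 : Type*) [RCLike 𝕜] : SuperFun 𝕜 →ₗ[𝕜] CircleFun 𝕜 where
  toFun F := F.snd
  map_add' _ _ := rfl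
  map_smul' _ _ := rfl

section Deformation

variable {V : Set (Fin 3 → ℝ)} {R : (Fin 3 → ℝ) → SuperFun 𝕜 →ₗ[𝕜] SPDO 𝕜}

theorem IsPolynomialDeformation.isRep (hR : IsPolynomialDeformation V R) {c : Fin 3 → ℝ}
    (hc : c ∈ V) : IsRep (R c) := by
  obtain ⟨S, ⟨N, hN⟩, -, hS, hform⟩ := hR.form
  have hf : ∀ k F, coeff (R c F) k = (∑ i ∈ Finset.range ((3 - k).toNat + 1),
      linSeq 𝕜 c i • homCoeffL 𝕜 k i + ParamPoly.eval (𝕜 := 𝕜) c (S k)) F := fun k F => by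
    rw [hform c hc, infinitesimal_eq_homogeneousSeries, coeff_homogeneousSeries_eq_sum_homCoeffL,
      LinearMap.add_apply, LinearMap.sum_apply]
    rfl
  refine IsRep.of_coeff (N := max N 2) (hR.map_bracket c hc) (fun k hk F => ?_) fun k =>
    ⟨_, Submodule.add_mem _ (Submodule.sum_mem _ fun i _ => Submodule.smul_mem _ _
      (homCoeffL_mem k i)) (ParamPoly.eval_mem _ (hS k) c), hf k⟩
  rw [hform c hc, infinitesimal_eq_homogeneousSeries, hN k ((le_max_left _ _).trans_lt hk),
    coeff_homogeneousSeries_of_lt _ _ ((le_max_right _ _).trans_lt hk), ParamPoly.eval_zero,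
    LinearMap.zero_apply, add_zero]

theorem IsPolynomialDeformation.coeff_sub_mem (hR : IsPolynomialDeformation V R) (F : SuperFun 𝕜)
    (k : ℤ) : (fun c : V => coeff (R c F) k - coeff (homogeneousSeries 2 (linSeq 𝕜 c) F) k) ∈
      polyFamilies 𝕜 V (SuperFun 𝕜) 2 := by
  obtain ⟨S, -, hord, -, hform⟩ := hR.form
  have h : (fun c : V => coeff (R c F) k - coeff (homogeneousSeries 2 (linSeq 𝕜 c) F) k) =
      ∑ α ∈ (S k).support, fun c : V => paramMonomial 𝕜 α c.1 • S k α F := by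
    funext c
    rw [hform c c.2, infinitesimal_eq_homogeneousSeries, add_sub_cancel_left,
      ParamPoly.eval_eq_sum, LinearMap.sum_apply, Finset.sum_apply]
    rfl
  rw [h]
  exact Submodule.sum_mem _ fun α hα => Submodule.subset_span ⟨α, hord k α hα, _, rfl⟩

theorem linSeq_mem_polyFamilies (i : ℕ) :
    (fun c : V => linSeq 𝕜 c i) ∈ polyFamilies 𝕜 V 𝕜 0 := by
  have h : ∀ (j : Fin 3) (r : 𝕜), (fun c : V => (c.1 j : 𝕜) * r) ∈ polyFamilies 𝕜 V 𝕜 0 :=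
    fun j r => map_mem_polyFamilies (LinearMap.mulRight 𝕜 r)
      (polyFamilies_mono (Nat.zero_le 1) (coord_mem_polyFamilies j))
  exact Submodule.add_mem _ (Submodule.add_mem _ (Submodule.add_mem _
    (const_mem_polyFamilies (rhoSeq 𝕜 i)) (h 0 _)) (h 1 _)) (h 2 _)

theorem IsPolynomialDeformation.coeff_mem (hR : IsPolynomialDeformation V R) (F : SuperFun 𝕜)
    (k : ℤ) : (fun c : V => coeff (R c F) k) ∈ polyFamilies 𝕜 V (SuperFun 𝕜) 0 := by
  have h : (fun c : V => coeff (homogeneousSeries 2 (linSeq 𝕜 c) F) k) ∈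
      polyFamilies 𝕜 V (SuperFun 𝕜) 0 := by
    have : (fun c : V => coeff (homogeneousSeries 2 (linSeq 𝕜 c) F) k) =
        ∑ i ∈ Finset.range ((3 - k).toNat + 1), fun c : V =>
          linSeq 𝕜 c i • homCoeffL 𝕜 k i F := by
      funext c
      rw [coeff_homogeneousSeries_eq_sum_homCoeffL, Finset.sum_apply]
    rw [this]
    exact Submodule.sum_mem _ fun i _ =>
      map_mem_polyFamilies (LinearMap.toSpanSingleton 𝕜 _ (homCoeffL 𝕜 k i F))
        (linSeq_mem_polyFamilies i)
  have := Submodule.add_mem _ (polyFamilies_mono (Nat.zero_le 2) (hR.coeff_sub_mem F k)) h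
  convert this using 1
  funext c
  exact (sub_add_cancel _ _).symm

theorem IsPolynomialDeformation.eq_rho (hR : IsPolynomialDeformation V R) (h : 0 ∈ V)
    (F : SuperFun 𝕜) : R 0 F = rho F := by
  obtain ⟨S, -, hord, -, hform⟩ := hR.form
  apply SPDO.ext
  intro k
  rw [hform 0 h, ParamPoly.eval_apply_zero one_le_two (hord k)]
  simp

/-- A polynomial curve in `V` from the origin to `c` reduces the claim to one parameter; at the
origin all terms other than ρ vanish. -/
theorem IsPolynomialDeformation.ordLE_sub_rho (hV : IsParameterSet V)
    (hR : IsPolynomialDeformation V R) {c : Fin 3 → ℝ} (hc : c ∈ V) (F : SuperFun 𝕜) :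
    OrdLE (R c F - rho F) 0 := by
  obtain ⟨γ, h0, ⟨t, ht⟩, hγ⟩ := hV c hc
  have h0' : (fun i => (γ i).eval 0) = 0 := funext h0
  have ht' : (fun i => (γ i).eval t) = c := funext ht
  rw [← ht']
  refine ordLE_sub_rho_of_curve (Φ := fun t => R fun i => (γ i).eval t) (fun t => hR.isRep (hγ t))
    (fun F => ?_) (fun F k x => ?_) (fun F k x => ?_) t F
  · have h00 := hγ 0
    rw [h0'] at h00 ⊢
    exact hR.eq_rho h00 F
  · exact isCurvePoly_of_mem_polyFamilies (map_mem_polyFamilies (evalAt 𝕜 x)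
      (map_mem_polyFamilies (fstL 𝕜) (hR.coeff_mem F k))) γ hγ
  · exact isCurvePoly_of_mem_polyFamilies (map_mem_polyFamilies (evalAt 𝕜 x)
      (map_mem_polyFamilies (sndL 𝕜) (hR.coeff_mem F k))) γ hγ

end Deformation

/-! ### Polynomial dependence of the conjugating operator -/

/-- Functions without `θ`-component. -/
def inlL (𝕜 : Type*) [RCLike 𝕜] : CircleFun 𝕜 →ₗ[𝕜] SuperFun 𝕜 where
  toFun f := mkFun f 0
  map_add' _ _ := by apply SuperFun.ext <;> simp
  map_smul' _ _ := by apply SuperFun.ext <;> simp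

/-- Multiples of `θ`. -/
def inrL (𝕜 : Type*) [RCLike 𝕜] : CircleFun 𝕜 →ₗ[𝕜] SuperFun 𝕜 where
  toFun f := mkFun 0 f
  map_add' _ _ := by apply SuperFun.ext <;> simp
  map_smul' _ _ := by apply SuperFun.ext <;> simp

/-- Projection to the functions `F` such that `F η^k` is even. -/
def parityProj (𝕜 : Type*) [RCLike 𝕜] (k : ℤ) : SuperFun 𝕜 →ₗ[𝕜] SuperFun 𝕜 :=
  (1 / 2 : 𝕜) • (LinearMap.id + if Even k then sigmaL 𝕜 else -sigmaL 𝕜)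

theorem parityProj_apply (k : ℤ) (F : SuperFun 𝕜) : parityProj 𝕜 k F =
    (1 / 2 : 𝕜) • (F + if Even k then sigma F else -sigma F) := by
  rw [parityProj]
  split_ifs <;> rfl

theorem sigma_parityProj (k : ℤ) (F : SuperFun 𝕜) :
    sigma (parityProj 𝕜 k F) = if Even k then parityProj 𝕜 k F else -parityProj 𝕜 k F := by
  rw [parityProj_apply, sigma_smul, sigma_add]
  split_ifs
  · rw [sigma_sigma, add_comm]
  · rw [sigma_neg, sigma_sigma]
    module

theorem parityProj_coeff {A : SPDO 𝕜} (hA : parity A = A) (k : ℤ) :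
    parityProj 𝕜 k (coeff A k) = coeff A k := by
  rw [parityProj_apply, ← coeff_parity, hA]
  module

section GaugeFamily

variable {V : Set (Fin 3 → ℝ)} {R : (Fin 3 → ℝ) → SuperFun 𝕜 →ₗ[𝕜] SPDO 𝕜}

/-- Multiplication of functions as a bilinear map. -/
def mulL (𝕜 : Type*) [RCLike 𝕜] : SuperFun 𝕜 →ₗ[𝕜] SuperFun 𝕜 →ₗ[𝕜] SuperFun 𝕜 :=
  LinearMap.mk₂ 𝕜 (fun F G => F * G) (fun _ _ _ => add_mul _ _ _) (fun _ _ _ => smul_mul_assoc _ _ _)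
    (fun _ _ _ => mul_add _ _ _) fun _ _ _ => mul_smul_comm _ _ _

theorem mul_mem_polyFamilies {d e : ℕ} {u v : V → SuperFun 𝕜}
    (hu : u ∈ polyFamilies 𝕜 V (SuperFun 𝕜) d) (hv : v ∈ polyFamilies 𝕜 V (SuperFun 𝕜) e) :
    (fun c => u c * v c) ∈ polyFamilies 𝕜 V (SuperFun 𝕜) (d + e) :=
  bilin_mem_polyFamilies (mulL 𝕜) hu hv

/-- Polynomial families of functions on the supercircle. -/
def polyAddSubgroup (𝕜 : Type*) [RCLike 𝕜] (V : Set (Fin 3 → ℝ)) (d : ℕ) :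
    AddSubgroup (V → SuperFun 𝕜) where
  carrier := {u | u ∈ polyFamilies 𝕜 V (SuperFun 𝕜) d}
  zero_mem' := Submodule.zero_mem (polyFamilies 𝕜 V (SuperFun 𝕜) d)
  add_mem' hu hv := Submodule.add_mem (polyFamilies 𝕜 V (SuperFun 𝕜) d) hu hv
  neg_mem' hu := Submodule.neg_mem (polyFamilies 𝕜 V (SuperFun 𝕜) d) hu

theorem mem_polyAddSubgroup {d : ℕ} {u : V → SuperFun 𝕜} :
    u ∈ polyAddSubgroup 𝕜 V d ↔ u ∈ polyFamilies 𝕜 V (SuperFun 𝕜) d := Iff.rfl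

theorem polyAddSubgroup_le (𝕜 : Type*) [RCLike 𝕜] (V : Set (Fin 3 → ℝ)) :
    polyAddSubgroup 𝕜 V 2 ≤ polyAddSubgroup 𝕜 V 0 := fun _ hu =>
  mem_polyAddSubgroup.2 (polyFamilies_mono (Nat.zero_le 2) (mem_polyAddSubgroup.1 hu))

theorem mul_mem_polyAddSubgroup {u v : V → SuperFun 𝕜}
    (hu : u ∈ polyAddSubgroup 𝕜 V 2) (hv : v ∈ polyAddSubgroup 𝕜 V 0) :
    (fun c => u c * v c) ∈ polyAddSubgroup 𝕜 V 2 := by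
  have := mul_mem_polyFamilies (mem_polyAddSubgroup.1 hu) (mem_polyAddSubgroup.1 hv)
  rw [add_zero] at this
  exact mem_polyAddSubgroup.2 this

theorem map_mem_polyAddSubgroup {d : ℕ} (L : SuperFun 𝕜 →ₗ[𝕜] SuperFun 𝕜) {u : V → SuperFun 𝕜}
    (hu : u ∈ polyAddSubgroup 𝕜 V d) : (fun c => L (u c)) ∈ polyAddSubgroup 𝕜 V d :=
  mem_polyAddSubgroup.2 (map_mem_polyFamilies L (mem_polyAddSubgroup.1 hu))

theorem smul_mem_polyAddSubgroup {d : ℕ} (r : 𝕜) {u : V → SuperFun 𝕜}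
    (hu : u ∈ polyAddSubgroup 𝕜 V d) : (fun c => r • u c) ∈ polyAddSubgroup 𝕜 V d :=
  mem_polyAddSubgroup.2 (Submodule.smul_mem _ r (mem_polyAddSubgroup.1 hu))

/-- Every term of exp(ad G) A - A contains `G`, hence inherits its vanishing in degrees less than
two, although `A` may have terms of any degree. -/
theorem coeff_conj_sub_mem {G : V → EvenLE 𝕜} {A : V → SPDO 𝕜} {N : ℤ} (hN : ∀ c, OrdLE (A c) N)
    (hG : ∀ k, (fun c => coeff (G c).1 k) ∈ polyFamilies 𝕜 V (SuperFun 𝕜) 2)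
    (hA : ∀ k, (fun c => coeff (A c) k) ∈ polyFamilies 𝕜 V (SuperFun 𝕜) 0) (k : ℤ) :
    (fun c => coeff ((G c).conj (A c)) k - coeff (A c) k) ∈ polyFamilies 𝕜 V (SuperFun 𝕜) 2 := by
  have := coeff_expAd_sub_mem (polyAddSubgroup_le 𝕜 V)
    (fun _ hu _ hv => mul_mem_polyAddSubgroup hu hv)
    (fun _ hv => map_mem_polyAddSubgroup (etaL 𝕜) hv)
    (fun _ hv => map_mem_polyAddSubgroup (sigmaL 𝕜) hv)
    (fun _ hv => map_mem_polyAddSubgroup (etaL 𝕜) hv)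
    (fun _ hv => map_mem_polyAddSubgroup (sigmaL 𝕜) hv)
    (fun r _ hv => smul_mem_polyAddSubgroup r hv) (fun c => (G c).2.1) (fun c => (G c).2.2) hN
    (fun k => mem_polyAddSubgroup.2 (hG k)) (fun k => mem_polyAddSubgroup.2 (hA k)) k
  exact mem_polyAddSubgroup.1 this

/-- On v_θ a homogeneous series of degree two involves, at nonpositive order, only derivatives of
the constant 1 and of 0. Thus ρ and the cocycles do not contribute and only the terms of degree at
least two in c remain. -/
theorem coeff_theta_mem (hR : IsPolynomialDeformation V R) {k : ℤ} (hk : k ≤ 0) :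
    (fun c : V => coeff (R c theta) k) ∈ polyFamilies 𝕜 V (SuperFun 𝕜) 2 := by
  have h := hR.coeff_sub_mem theta k
  have h1 : ∀ n : ℕ, n ≠ 0 → ddx^[n] (1 : CircleFun 𝕜) = 0 := fun n hn => by
    obtain ⟨m, rfl⟩ := Nat.exists_eq_succ_of_ne_zero hn
    rw [Function.iterate_succ_apply, ← map_one (algebraMap 𝕜 (CircleFun 𝕜)), ddx_algebraMap,
      iterate_ddx_zero]
  have h2 : ∀ p : ℕ → 𝕜, coeff (homogeneousSeries 2 p theta) k = 0 := fun p => by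
    rcases int_trichotomy k with h | ⟨n, rfl⟩ | ⟨n, rfl⟩
    · exact coeff_homogeneousSeries_of_lt _ _ h
    · rw [coeff_homogeneousSeries_even, fst_theta, snd_theta, h1 n (by omega), iterate_ddx_zero]
      apply SuperFun.ext <;> simp
    · rw [coeff_homogeneousSeries_odd, fst_theta, snd_theta, h1 n (by omega), iterate_ddx_zero]
      apply SuperFun.ext <;> simp
  simpa only [h2, sub_zero] using h

/-- At η^(-2m) a homogeneous series involves f^(m+1), which for m ≠ 0 vanishes at the origin when f
is a local coordinate. -/
theorem evalAt_blkA_mem (hR : IsPolynomialDeformation V R) {m : ℕ} (hm : m ≠ 0) :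
    (fun c : V => evalAt 𝕜 0 (blkA (R c (mkFun (locMon 1 0) 0)) (-m))) ∈ polyFamilies 𝕜 V 𝕜 2 := by
  have h := map_mem_polyFamilies (evalAt 𝕜 0) (map_mem_polyFamilies (fstL 𝕜)
    (hR.coeff_sub_mem (mkFun (locMon 1 0) 0) (2 * -(m : ℤ))))
  convert h using 1
  funext c
  change evalAt 𝕜 0 (coeff _ _).fst = evalAt 𝕜 0 ((coeff _ _).fst - (coeff _ _).fst)
  rw [show 2 * -(m : ℤ) = 2 - 2 * ((m + 1 : ℕ) : ℤ) by push_cast; ring, coeff_homogeneousSeries_even,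
    fst_mkFun, fst_mkFun, map_sub, map_smul, evalAt_iterate_locMon, if_neg (by omega), smul_zero,
    sub_zero]

/-- The corrections are obtained from two kinds of data without terms of degree less than two in c,
the low coefficients of v_θ and the values of the Euler field at the origin, by fixed linear maps:
the primitive with fixed base point, evaluation, and scalar multiples. Conjugation by the previous
exponent preserves this property. -/
theorem coeff_gaugeSeq_mem
    (hV : IsParameterSet V) (hR : IsPolynomialDeformation V R) (m : ℕ) (k : ℤ) :
    (fun c : V => coeff (gaugeSeq (R c) m).1 k) ∈ polyFamilies 𝕜 V (SuperFun 𝕜) 2 := by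
  induction m generalizing k with
  | zero => exact Submodule.zero_mem _
  | succ m ih =>
    have hO : ∀ F, ∀ c : V, OrdLE (R c F) 2 := fun F c =>
      ordLE_of_sub_rho (hR.ordLE_sub_rho hV c.2) F
    have hc : ∀ F k, (fun c : V => coeff (R c F) k) ∈ polyFamilies 𝕜 V (SuperFun 𝕜) 2 →
        (fun c : V => coeff ((gaugeSeq (R c) m).conj (R c F)) k) ∈
          polyFamilies 𝕜 V (SuperFun 𝕜) 2 := fun F k hF => by
      convert Submodule.add_mem _ (coeff_conj_sub_mem (hO F) ih (hR.coeff_mem F) k) hF using 1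
      funext c
      exact (sub_add_cancel _ _).symm
    have hq : (fun c : V => gaugeOdd (R c) m (gaugeSeq (R c) m)) ∈
        polyFamilies 𝕜 V (CircleFun 𝕜) 2 :=
      Submodule.smul_mem _ _ (map_mem_polyFamilies (fstL 𝕜)
        (hc theta _ (coeff_theta_mem hR (by omega))))
    have hg1 : (fun c : V => antideriv
        ((2 : 𝕜) • (coeff ((gaugeSeq (R c) m).conj (R c theta)) (2 * -(m : ℤ))).snd +
        (4 : 𝕜) • (coeff ((gaugeSeq (R c) m).conj (R c theta)) (2 * -(m : ℤ) - 1)).fst)) ∈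
        polyFamilies 𝕜 V (CircleFun 𝕜) 2 :=
      map_mem_polyFamilies (antiderivL 𝕜) (Submodule.add_mem _
        (Submodule.smul_mem _ _ (map_mem_polyFamilies (sndL 𝕜)
          (hc theta _ (coeff_theta_mem hR (by omega)))))
        (Submodule.smul_mem _ _ (map_mem_polyFamilies (fstL 𝕜)
          (hc theta _ (coeff_theta_mem hR (by omega))))))
    have hg2 : (fun c : V => evalAt 𝕜 0
        (blkA ((gaugeSeq (R c) m).conj (R c (mkFun (locMon 1 0) 0))) (-m)) / (m : 𝕜)) ∈
        polyFamilies 𝕜 V 𝕜 2 := by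
      rcases eq_or_ne m 0 with rfl | hm
      · simp only [Nat.cast_zero, div_zero]
        exact Submodule.zero_mem _
      · have h1 := map_mem_polyFamilies (evalAt 𝕜 0) (map_mem_polyFamilies (fstL 𝕜)
          (coeff_conj_sub_mem (hO (mkFun (locMon 1 0) 0)) ih (hR.coeff_mem _) (2 * -(m : ℤ))))
        have h2 := Submodule.smul_mem _ (m : 𝕜)⁻¹ (Submodule.add_mem _ h1 (evalAt_blkA_mem hR hm))
        convert h2 using 1
        funext c
        change _ = (m : 𝕜)⁻¹ * (evalAt 𝕜 0 ((coeff _ _).fst - (coeff _ _).fst) +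
          evalAt 𝕜 0 (coeff _ _).fst)
        rw [map_sub, sub_add_cancel, div_eq_inv_mul]
        rfl
    have hg : (fun c : V => gaugeEven (R c) m (gaugeSeq (R c) m)) ∈
        polyFamilies 𝕜 V (CircleFun 𝕜) 2 :=
      Submodule.add_mem _ hg1 (map_mem_polyFamilies (Algebra.linearMap 𝕜 (CircleFun 𝕜)) hg2)
    have hp : (fun c : V => coeff (evenPair m (gaugeEven (R c) m (gaugeSeq (R c) m))
        (gaugeOdd (R c) m (gaugeSeq (R c) m))) k) ∈ polyFamilies 𝕜 V (SuperFun 𝕜) 2 := by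
      by_cases h1 : k = 2 * -(m : ℤ)
      · subst h1
        simp only [coeff_evenPair_even]
        exact map_mem_polyFamilies (inlL 𝕜) hg
      by_cases h2 : k = 2 * -(m : ℤ) - 1
      · subst h2
        simp only [coeff_evenPair_odd]
        exact map_mem_polyFamilies (inrL 𝕜) hq
      · simp only [coeff_evenPair_of_ne _ _ _ h1 h2]
        exact Submodule.zero_mem _
    exact Submodule.add_mem _ (ih k) hp

theorem coeff_gauge_mem
    (hV : IsParameterSet V) (hR : IsPolynomialDeformation V R) (k : ℤ) :
    (fun c : V => coeff (gauge (R c)).1 k) ∈ polyFamilies 𝕜 V (SuperFun 𝕜) 2 :=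
  coeff_gaugeSeq_mem hV hR _ k

/-! ### The normal form of a deformation. -/

/-- The conjugated deformation. -/
def normalForm (R : (Fin 3 → ℝ) → SuperFun 𝕜 →ₗ[𝕜] SPDO 𝕜) (c : Fin 3 → ℝ) :
    SuperFun 𝕜 →ₗ[𝕜] SPDO 𝕜 :=
  (gauge (R c)).conj.toLinearMap ∘ₗ R c

/-- The sequence consists of values at the origin on local monomials. On the homogeneous series of ρ
+ ∑ c_i Θ_i these values return `linSeq`, and both the deformation and the conjugation depart from
it only in degree at least two. -/
theorem seqOf_normalForm_sub_mem
    (hV : IsParameterSet V) (hR : IsPolynomialDeformation V R) (i : ℕ) :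
    (fun c : V => seqOf (normalForm R c) i - linSeq 𝕜 c i) ∈ polyFamilies 𝕜 V 𝕜 2 := by
  have h : ∀ F k, (fun c : V => evalAt 𝕜 0 (coeff (normalForm R c F) k).fst -
      evalAt 𝕜 0 (coeff (homogeneousSeries 2 (linSeq 𝕜 c) F) k).fst) ∈
      polyFamilies 𝕜 V 𝕜 2 := fun F k => by
    have h1 := Submodule.add_mem _ (coeff_conj_sub_mem
      (fun c : V => ordLE_of_sub_rho (hR.ordLE_sub_rho hV c.2) F) (coeff_gauge_mem hV hR)
      (hR.coeff_mem F) k) (hR.coeff_sub_mem F k)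
    convert map_mem_polyFamilies (evalAt 𝕜 0) (map_mem_polyFamilies (fstL 𝕜) h1) using 1
    funext c
    change _ = evalAt 𝕜 0 ((coeff (normalForm R c F) k).fst - (coeff (R c F) k).fst +
      ((coeff (R c F) k).fst - (coeff (homogeneousSeries 2 (linSeq 𝕜 c) F) k).fst))
    rw [sub_add_sub_cancel, map_sub]
  obtain ⟨n, rfl | rfl⟩ := Nat.even_or_odd' i
  · convert Submodule.neg_mem _ (h (mkFun (locMon n 0) 0) (2 * (1 - n))) using 1
    funext c
    rw [Pi.neg_apply, show 2 * (1 - (n : ℤ)) = 2 - 2 * n by ring, coeff_homogeneousSeries_even,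
      fst_mkFun, fst_mkFun, map_smul, evalAt_iterate_locMon, if_pos rfl, seqOf_even, blkA,
      show 2 * (1 - (n : ℤ)) = 2 - 2 * n by ring, smul_eq_mul]
    ring
  · convert h (mkFun 0 (locMon n 0)) (2 * (-n) + 1) using 1
    funext c
    rw [show 2 * (-(n : ℤ)) + 1 = 1 - 2 * n by ring, coeff_homogeneousSeries_odd,
      TrivSqZeroExt.fst_smul, fst_mkFun, snd_mkFun, map_smul, evalAt_iterate_locMon, if_pos rfl,
      seqOf_odd, blkB, show 2 * (-(n : ℤ)) + 1 = 1 - 2 * n by ring, smul_eq_mul, mul_one]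

theorem normalForm_eq_homogeneousSeries
    (hV : IsParameterSet V) (hR : IsPolynomialDeformation V R) (h0 : ∀ c ∈ V, theta0Component (R c) = 0) {c : Fin 3 → ℝ}
    (hc : c ∈ V) (F : SuperFun 𝕜) :
    normalForm R c F = homogeneousSeries 2 (seqOf (normalForm R c)) F := by
  have hφ := hR.isRep hc
  have hρ := hR.ordLE_sub_rho hV hc
  have hm : mean (blkA (R c (mkFun 1 0)) 0) = 0 := by
    rw [← one_eq_mkFun]
    exact h0 c hc
  exact IsRep.eq_homogeneousSeries (hφ.expAd_comp (gauge (R c)).2.1 (gauge (R c)).2.2)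
    (ordLE_conj_gauge_sub_rho hρ) (hφ.conj_gauge_theta hρ hm)
    (fun m hm => evalAt_conj_gauge hρ hφ.even hm) F

/-- The normal form is a homogeneous deformation. -/
theorem exists_seq_normalForm
    (hV : IsParameterSet V) (hR : IsPolynomialDeformation V R) : ∃ Q : ℕ → ParamPoly 𝕜, (∀ i, (Q i).OrderGE 2) ∧
    ∀ c ∈ V, seqOf (normalForm R c) = linSeq 𝕜 c + fun i => ParamPoly.eval (𝕜 := 𝕜) c (Q i) := by
  have := fun i => mem_polyFamilies_iff.1 (seqOf_normalForm_sub_mem hV hR i)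
  choose Q hQ h using this
  refine ⟨Q, hQ, fun c hc => funext fun i => ?_⟩
  have := h i ⟨c, hc⟩
  rw [Pi.add_apply, ← this, add_sub_cancel]

theorem isHomogeneousOfDegree_normalForm
    (hV : IsParameterSet V) (hR : IsPolynomialDeformation V R) (h0 : ∀ c ∈ V, theta0Component (R c) = 0) :
    IsHomogeneousOfDegree 2 V (normalForm R) := by
  have : ∀ i, (fun c : V => seqOf (normalForm R c) i) ∈ polyFamilies 𝕜 V 𝕜 0 := fun i => by
    convert Submodule.add_mem _ (polyFamilies_mono (Nat.zero_le 2)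
      (seqOf_normalForm_sub_mem hV hR i)) (linSeq_mem_polyFamilies i) using 1
    funext c
    exact (sub_add_cancel _ _).symm
  choose P _ hP using fun i => mem_polyFamilies_iff.1 (this i)
  refine ⟨P, fun c hc F => ?_⟩
  rw [normalForm_eq_homogeneousSeries hV hR h0 hc]
  congr 1
  exact funext fun i => hP i ⟨c, hc⟩

/-- For a homogeneous series the coefficients are automatically even differential operators
(`homCoeffL_mem`), so only the scalar polynomials matter, and these differ from the infinitesimal
ones in degree at least two. -/
theorem isPolynomialDeformation_normalForm
    (hV : IsParameterSet V) (hR : IsPolynomialDeformation V R) (h0 : ∀ c ∈ V, theta0Component (R c) = 0) :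
    IsPolynomialDeformation V (normalForm R) := by
  obtain ⟨Q, hQ, hseq⟩ := exists_seq_normalForm hV hR
  refine ⟨fun c hc => ((hR.isRep hc).expAd_comp (gauge (R c)).2.1 (gauge (R c)).2.2).map_bracket,
    fun k => ∑ i ∈ Finset.range ((3 - k).toNat + 1),
      ParamPoly.map (LinearMap.toSpanSingleton 𝕜 _ (homCoeffL 𝕜 k i)) (Q i),
    ⟨2, fun k hk => Finset.sum_eq_zero fun i _ => ?_⟩, fun k => ?_, fun k α => ?_,
    fun c hc F k => ?_⟩
  · refine Finsupp.ext fun α => ?_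
    rw [ParamPoly.map_apply, LinearMap.toSpanSingleton_apply, homCoeffL_of_lt hk, smul_zero]
    rfl
  · refine ParamPoly.orderGE_iff.2 fun α hα => ?_
    rw [Finsupp.finsetSum_apply]
    refine Finset.sum_eq_zero fun i _ => ?_
    rw [ParamPoly.map_apply, ParamPoly.orderGE_iff.1 (hQ i) α hα, map_zero]
  · have : (∑ i ∈ Finset.range ((3 - k).toNat + 1), ParamPoly.map
        (LinearMap.toSpanSingleton 𝕜 _ (homCoeffL 𝕜 k i)) (Q i)) α ∈ evenDiffOps 𝕜 k := by
      rw [Finsupp.finsetSum_apply]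
      exact Submodule.sum_mem _ fun i _ => Submodule.smul_mem _ _ (homCoeffL_mem k i)
    exact this
  · rw [normalForm_eq_homogeneousSeries hV hR h0 hc, hseq c hc, homogeneousSeries_add, coeff_add,
      ← infinitesimal_eq_homogeneousSeries, ParamPoly.eval_sum, LinearMap.sum_apply,
      coeff_homogeneousSeries_eq_sum_homCoeffL]
    refine congrArg _ (Finset.sum_congr rfl fun i _ => ?_)
    rw [ParamPoly.eval_map]
    rfl

theorem isEquivalent_normalForm
    (hV : IsParameterSet V) (hR : IsPolynomialDeformation V R) : IsEquivalent V R (normalForm R) := by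
  choose P hP hPe using fun k => mem_polyFamilies_iff.1 (coeff_gauge_mem hV hR k)
  -- Polynomials chosen to represent the exponent on `V` need be neither even nor zero in positive
  -- order, so they are projected. The projection fixes the actual coefficients of the exponent and
  -- hence does not change its values on `V`.
  let π : ℤ → SuperFun 𝕜 →ₗ[𝕜] SuperFun 𝕜 := fun k => if 0 < k then 0 else parityProj 𝕜 k
  have hπ : ∀ k, 0 < k → π k = 0 := fun k hk => if_pos hk
  have hs : ∀ k F, sigma (π k F) = if Even k then π k F else -π k F := fun k F => by
    by_cases h0 : 0 < k
    · simp [hπ k h0]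
    · rw [show π k = parityProj 𝕜 k from if_neg h0, sigma_parityProj]
  have hg : ∀ c k, π k (coeff (gauge (R c)).1 k) = coeff (gauge (R c)).1 k := fun c k => by
    by_cases h0 : 0 < k
    · rw [hπ k h0, (gauge (R c)).2.2 k h0]
      rfl
    · rw [show π k = parityProj 𝕜 k from if_neg h0, parityProj_coeff (gauge (R c)).2.1]
  have hE : ∀ (c : Fin 3 → ℝ) (k : ℤ), 0 < k →
      ParamPoly.eval (𝕜 := 𝕜) c (ParamPoly.map (π k) (P k)) = 0 := fun c k hk => by
    rw [ParamPoly.eval_map, hπ k hk]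
    rfl
  let G : (Fin 3 → ℝ) → SPDO 𝕜 := fun c =>
    ⟨fun k => ParamPoly.eval (𝕜 := 𝕜) c (ParamPoly.map (π k) (P k)), 0, hE c⟩
  have hG : ∀ c ∈ V, G c = (gauge (R c)).1 := fun c hc => SPDO.ext fun k => by
    change ParamPoly.eval (𝕜 := 𝕜) c (ParamPoly.map (π k) (P k)) = _
    rw [ParamPoly.eval_map, ← hPe k ⟨c, hc⟩, hg]
  refine ⟨fun k => ParamPoly.map (π k) (P k), G, fun c => (gauge (R c)).conj,
    ⟨0, fun k hk => ?_⟩, fun k => ?_, fun k α => ?_, fun c k => rfl, fun c hc => ?_⟩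
  · refine Finsupp.ext fun α => ?_
    rw [ParamPoly.map_apply, hπ k hk]
    rfl
  · refine ParamPoly.orderGE_iff.2 fun α hα => ?_
    rw [ParamPoly.map_apply, ParamPoly.orderGE_iff.1 (hP k) α (by omega), map_zero]
  · rw [ParamPoly.map_apply, hs]
  · rw [hG c hc]
    exact ⟨isExpAd_expAd _ _ _, expAd_superBracket _ _ _, fun F => rfl⟩

end GaugeFamily

end SuperCircle

end

open SuperCircle in
theorem mainTheorem5 {𝕜 : Type*} [RCLike 𝕜] (V : Set (Fin 3 → ℝ)) (hV : IsParameterSet V)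
    (R : (Fin 3 → ℝ) → SuperFun 𝕜 →ₗ[𝕜] SPDO 𝕜) (hR : IsPolynomialDeformation V R)
    (h0 : ∀ c ∈ V, theta0Component (R c) = 0) :
    ∃ R' : (Fin 3 → ℝ) → SuperFun 𝕜 →ₗ[𝕜] SPDO 𝕜,
      IsPolynomialDeformation V R' ∧ IsHomogeneousOfDegree 2 V R' ∧ IsEquivalent V R R' :=
  ⟨normalForm R, isPolynomialDeformation_normalForm hV hR h0,
    isHomogeneousOfDegree_normalForm hV hR h0, isEquivalent_normalForm hV hR⟩
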